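/- **Request model.** There are finitely many types $t\in[T]$, finitely many recurring objects $c\in\mathcal K=\{1,\dots,K\}$, each with a type $c_{typ}$ and a size $w_c>0$, and for each $t$ a (possibly infinite) set $\mathcal R_t$ of rare objects of type $t$, all of size $\bar w_t>0$. The $l$-th request ($l\ge 1$) arrives at time $A(l)=X(1)+\dots+X(l)$ and is for the object $c(l)$. The inter-arrival times $X(l)\ge 0$ are i.i.d. with finite mean $1/\lambda>0$ and a density $f$ such that $\{f>0\}$ is an interval. They are independent of the process $Z(l)$, where $Z(l)=k$ if $c(l)$ is the recurring object $k$ and $Z(l)=K+t$ if $c(l)\in\mathcal R_t$. The process $Z$ is an irreducible Markov chain on $[K+T]$, with arbitrary initial law, whose transition matrix has positive diagonal entries; $\pi$ is its stationary distribution, $\lambda_c=\pi_c\lambda$ and $\alpha_t=\pi_{K+t}$. For $R\geq 0$ let $\beta_t(l;R)$ be the indicator that $c(l)\in\mathcal R_t$ and that the same object was requested before, strictly less than $R$ time units earlier. The $R$-rarity condition says that for every $t$ and every integer sequence $N_m=\omega(\sqrt m)$, almost surely $\frac1{N_m}\sum_{l=m}^{m+N_m}\beta_t(l;R)\to 0$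 as $m\to\infty$. **f-TTL with fixed TTLs $\theta,\theta^s\in\mathbb R_{\ge0}^T$.** Each object has three timers (deep cache, shallow cache, and shadow cache for its metadata), which decrease in real time until they reach $0$; a timer at $0$ means absence. The object is in the cache if its deep or shallow timer is positive. A request for an object of type $t$ is a hit if the object is in the cache, a virtual hit if only its metadata is present, and a miss otherwise. After a hit or a virtual hit its timers are set to $(\theta_t,0,0)$, after a miss to $(0,\theta^s_t,\theta_t)$. At time $0$ only finitely many objects have nonzero timers. The object (resp. byte) hit rate of type $t$ is the $\liminf_{u\to\infty}$ of the fraction of the requests (resp. requested bytes) of type $t$ up to time $u$ that are hits; the normalized size of type $t$ is the $\limsup_{u\to\infty}$ of $\int_0^u(\text{total size of the type-}t\text{ objects in the cache at time }u')\,du'$ divided by the number of bytes of type $t$ requested up to time $u$. For $c\in\mathcal K$ let $p_c$ be the c.d.f. of the time between the first and the second request for $c$, and let $\hat s_c(x)=\int_0^{x}y\,dp_c(y)+x(1-p_c(x))$. **Theorem.** Let $L\in\mathbb R^T$, let the $\|L\|_\infty$-rarity condition hold, and let $0\le\theta^s_t\le\theta_t\le L_t$ for all $t$. Then almost surely, for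 every type $t$: 1. the object hit rate of type $t$ (with $\widehat w_c=\widehat{\bar w}_t=1$) and the byte hit rate of type $t$ (with $\widehat w_c=w_c$, $\widehat{\bar w}_t=\bar w_t$) equal $$h_t(\theta,\theta^s)=\frac{\sum_{c\in\mathcal K:\,c_{typ}=t}\widehat w_c\lambda_c\bigl(p_c(\theta_t)^2+(1-p_c(\theta_t))\,p_c(\theta^s_t)\bigr)}{\widehat{\bar w}_t\alpha_t\lambda+\sum_{c\in\mathcal K:\,c_{typ}=t}\widehat w_c\lambda_c};$$ 2. the normalized size of type $t$ equals $$s_t(\theta,\theta^s)=\frac{\sum_{c\in\mathcal K:\,c_{typ}=t}w_c\lambda_c\bigl(p_c(\theta_t)\hat s_c(\theta_t)+(1-p_c(\theta_t))\hat s_c(\theta^s_t)\bigr)+\bar w_t\alpha_t\lambda\theta^s_t}{\bar w_t\alpha_t\lambda+\sum_{c\in\mathcal K:\,c_{typ}=t}w_c\lambda_c};$$ 3. the $\liminf$ and $\limsup$ defining these quantities are limits, and the fraction of the first $n$ requests that are hits or virtual hits of rare objects of type $t$ tends to $0$ as $n\to\infty$. -/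

import Mathlib

open MeasureTheory ProbabilityTheory Filter Topology

noncomputable section

namespace FTTL

/-- The objects served by the cache: finitely many recurring objects `κ`, finitely many types `τ`,
and a (possibly infinite) collection `ρ` of rare objects. An object is an element of `κ ⊕ ρ`.
All rare objects of the same type have the same size. -/
structure Catalog (κ τ ρ : Type*) where
  /-- type of a recurring object -/
  recType : κ → τ
  /-- type of a rare object -/
  rareType : ρ → τ
  /-- size `w_c` of a recurring object -/
  recSize : κ → ℝ
  /-- common size of the rare objects of a given type -/
  rareSize : τ → ℝ
  recSize_pos : ∀ c, 0 < recSize c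
  rareSize_pos : ∀ t, 0 < rareSize t

namespace Catalog

variable {κ τ ρ : Type*} (C : Catalog κ τ ρ)

/-- The type of an object. -/
def typ : κ ⊕ ρ → τ := Sum.elim C.recType C.rareType

/-- The weight of an object, when recurring object `c` weighs `v c` and every rare object of
type `t` weighs `vr t`. -/
def weight (v : κ → ℝ) (vr : τ → ℝ) : κ ⊕ ρ → ℝ := Sum.elim v (fun r => vr (C.rareType r))

/-- The size of an object. -/
def size : κ ⊕ ρ → ℝ := C.weight C.recSize C.rareSize

/-- The label process state of a request: the object itself if it is recurring, and only its type
if it is rare. -/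
def label : κ ⊕ ρ → κ ⊕ τ := Sum.map id C.rareType

end Catalog

variable {Ω κ τ ρ : Type*}

/-! ### Arrivals

`X n` is the `n`-th inter-arrival time and `obj n` the object requested at the end of it, at time
`arrivalTime X (n + 1)`. Requests are numbered from `0`, the system starts at time `0`. -/

/-- `A(n) = X 0 + ⋯ + X (n-1)`, with `A(0) = 0`. -/
def arrivalTime (X : ℕ → Ω → ℝ) (n : ℕ) (ω : Ω) : ℝ := ∑ i ∈ Finset.range n, X i ω

/-- Number of requests that arrive up to time `u`. -/
def requestCount (X : ℕ → Ω → ℝ) (ω : Ω) (u : ℝ) : ℕ :=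
  Set.ncard {i : ℕ | arrivalTime X (i + 1) ω ≤ u}

/-- The general content request model: i.i.d. inter-arrival times with a density whose support is
an interval and with mean `1 / lam`, independent of the label process `Z`, which is
an irreducible Markov chain on `κ ⊕ τ` with transition matrix `P` having a positive diagonal, and
with stationary distribution `π`. The initial law of `Z` is arbitrary. Which rare object
of the type given by `Z` is requested is not restricted here. -/
structure IsRequestModel [MeasurableSpace Ω] [Fintype κ] [Fintype τ] [DecidableEq κ]
    [DecidableEq τ] (C : Catalog κ τ ρ) (μ : Measure Ω) (X : ℕ → Ω → ℝ) (obj : ℕ → Ω → κ ⊕ ρ)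
    (lam : ℝ) (P : Matrix (κ ⊕ τ) (κ ⊕ τ) ℝ) (π : κ ⊕ τ → ℝ) : Prop where
  measurable_X : ∀ n, Measurable (X n)
  indep_X : iIndepFun X μ
  density_X : ∃ f : ℝ → ℝ, Measurable f ∧ (∀ x, 0 ≤ f x) ∧ (∀ x < 0, f x = 0) ∧
    {x | 0 < f x}.OrdConnected ∧
    ∀ n, μ.map (X n) = (volume : Measure ℝ).withDensity (fun x => ENNReal.ofReal (f x))
  lam_pos : 0 < lam
  integrable_X : ∀ n, Integrable (X n) μ
  mean_X : ∀ n, ∫ ω, X n ω ∂μ = 1 / lam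
  measurable_Z : ∀ n, Measurable[_, ⊤] (fun ω => C.label (obj n ω))
  indep_X_Z : Indep (⨆ n, MeasurableSpace.comap (X n) inferInstance)
    (⨆ n, MeasurableSpace.comap (fun ω => C.label (obj n ω)) ⊤) μ
  stochastic : P ∈ Matrix.rowStochastic ℝ (κ ⊕ τ)
  irreducible : P.IsIrreducible
  diag_pos : ∀ z, 0 < P z z
  markov : ∀ (n : ℕ) (z : ℕ → κ ⊕ τ),
    μ.real {ω | ∀ i ≤ n + 1, C.label (obj i ω) = z i} =
      μ.real {ω | ∀ i ≤ n, C.label (obj i ω) = z i} * P (z n) (z (n + 1))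
  stationary_mem : π ∈ stdSimplex ℝ (κ ⊕ τ)
  stationary : Matrix.vecMul π P = π

/-- The `n`-th request is a bursty request for a rare object of type `t`: the same
rare object was already requested strictly less than `R` units of time earlier. -/
def Bursty (C : Catalog κ τ ρ) (X : ℕ → Ω → ℝ) (obj : ℕ → Ω → κ ⊕ ρ) (R : ℝ) (t : τ) (n : ℕ)
    (ω : Ω) : Prop :=
  C.label (obj n ω) = Sum.inr t ∧
    ∃ m < n, obj m ω = obj n ω ∧ arrivalTime X (n + 1) ω - arrivalTime X (m + 1) ω < R

open Classical in
/-- The `R`-rarity condition: for every type and every window length `N m = ω(√m)`, the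
fraction of bursty requests in the window `[m, m + N m]` tends to `0` almost surely. -/
def RarityCondition [MeasurableSpace Ω] (C : Catalog κ τ ρ) (μ : Measure Ω) (X : ℕ → Ω → ℝ)
    (obj : ℕ → Ω → κ ⊕ ρ) (R : ℝ) : Prop :=
  ∀ (t : τ) (N : ℕ → ℕ),
    (fun m : ℕ => Real.sqrt m) =o[atTop] (fun m : ℕ => (N m : ℝ)) →
    ∀ᵐ ω ∂μ, Tendsto (fun m : ℕ => (1 / (N m : ℝ)) *
      ∑ l ∈ Finset.Icc m (m + N m), (if Bursty C X obj R t l ω then (1 : ℝ) else 0))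
      atTop (𝓝 0)

/-! ### The f-TTL cache with fixed TTLs -/

/-- The remaining lifetimes of one object in the deep cache, in the shallow cache, and
of its metadata in the shadow cache; a lifetime that is not positive means absence. -/
structure Timers where
  deep : ℝ
  shallow : ℝ
  shadow : ℝ

/-- All three timers `0`: object and metadata are absent. -/
instance : Zero Timers := ⟨⟨0, 0, 0⟩⟩

namespace Timers

/-- Decrement all timers by the elapsed time `x`, stopping at `0`. -/
def age (ψ : Timers) (x : ℝ) : Timers :=
  ⟨max (ψ.deep - x) 0, max (ψ.shallow - x) 0, max (ψ.shadow - x) 0⟩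

/-- The object is in the deep or in the shallow cache; a request for it is then a cache hit. -/
def InCache (ψ : Timers) : Prop := 0 < ψ.deep ∨ 0 < ψ.shallow

/-- Only the metadata is stored; a request for the object is then a virtual hit. -/
def OnlyMetadata (ψ : Timers) : Prop := ¬ ψ.InCache ∧ 0 < ψ.shadow

open Classical in
/-- New timers of a requested object with TTL `θ` and shallow TTL `θs`: after a hit or
a virtual hit it is put in the deep cache; after a miss it is put in the shallow cache and
its metadata in the shadow cache. -/
def onRequest (θ θs : ℝ) (ψ : Timers) : Timers :=
  if ψ.InCache ∨ ψ.OnlyMetadata then ⟨θ, 0, 0⟩ else ⟨0, θs, θ⟩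

end Timers

section Cache

variable (C : Catalog κ τ ρ) (θ θs : τ → ℝ) (ψ₀ : κ ⊕ ρ → Timers) (X : ℕ → Ω → ℝ)
  (obj : ℕ → Ω → κ ⊕ ρ)

open Classical in
/-- Timers of all objects at time `arrivalTime X n`, right after the first `n` requests have been
processed, starting from the timers `ψ₀` at time `0`. -/
def timersAfter (ω : Ω) : ℕ → κ ⊕ ρ → Timers
  | 0 => ψ₀
  | n + 1 => fun c =>
      if c = obj n ω then
        ((timersAfter ω n c).age (X n ω)).onRequest (θ (C.typ c)) (θs (C.typ c))
      else (timersAfter ω n c).age (X n ω)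

/-- Timers of the object requested by the `n`-th request, just before that request is processed. -/
def timersAtRequest (n : ℕ) (ω : Ω) : Timers :=
  (timersAfter C θ θs ψ₀ X obj ω n (obj n ω)).age (X n ω)

/-- The `n`-th request is a cache hit. -/
def Hit (n : ℕ) (ω : Ω) : Prop := (timersAtRequest C θ θs ψ₀ X obj n ω).InCache

/-- The `n`-th request is a cache virtual hit. -/
def VirtualHit (n : ℕ) (ω : Ω) : Prop := (timersAtRequest C θ θs ψ₀ X obj n ω).OnlyMetadata

/-- Timers of all objects at real time `u ≥ 0`. -/
def timersAt (ω : Ω) (u : ℝ) (c : κ ⊕ ρ) : Timers :=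
  (timersAfter C θ θs ψ₀ X obj ω (requestCount X ω u) c).age
    (u - arrivalTime X (requestCount X ω u) ω)

/-- Total size of the objects of type `t` that are in the cache (deep or shallow) at time `u`. -/
def cacheSize (t : τ) (ω : Ω) (u : ℝ) : ℝ :=
  ∑ᶠ c ∈ {c : κ ⊕ ρ | C.typ c = t ∧ (timersAt C θ θs ψ₀ X obj ω u c).InCache}, C.size c

open Classical in
/-- Total weight of the requests of type `t` up to time `u`. As the inter-arrival times are
nonnegative, these are the first `requestCount X ω u` requests. -/
def requestedWeight (v : κ ⊕ ρ → ℝ) (t : τ) (ω : Ω) (u : ℝ) : ℝ :=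
  ∑ l ∈ Finset.range (requestCount X ω u), if C.typ (obj l ω) = t then v (obj l ω) else 0

open Classical in
/-- Total weight of the requests of type `t` up to time `u` that are cache hits. -/
def hitWeight (v : κ ⊕ ρ → ℝ) (t : τ) (ω : Ω) (u : ℝ) : ℝ :=
  ∑ l ∈ Finset.range (requestCount X ω u),
    if C.typ (obj l ω) = t ∧ Hit C θ θs ψ₀ X obj l ω then v (obj l ω) else 0

/-- Hit ratio of type `t` up to time `u`, with respect to the weights `v`. -/
def hitRatio (v : κ ⊕ ρ → ℝ) (t : τ) (ω : Ω) (u : ℝ) : ℝ :=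
  hitWeight C θ θs ψ₀ X obj v t ω u / requestedWeight C X obj v t ω u

/-- Time integral of the cache size of type `t` up to time `u`, divided by the number of bytes of
type `t` requested up to time `u`. -/
def sizeRatio (t : τ) (ω : Ω) (u : ℝ) : ℝ :=
  (∫ s in (0 : ℝ)..u, cacheSize C θ θs ψ₀ X obj t ω s) / requestedWeight C X obj C.size t ω u

/-- Object hit rate of type `t`. -/
def objectHitRate (t : τ) (ω : Ω) : ℝ :=
  liminf (hitRatio C θ θs ψ₀ X obj (fun _ => 1) t ω) atTop

/-- Byte hit rate of type `t`. -/
def byteHitRate (t : τ) (ω : Ω) : ℝ :=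
  liminf (hitRatio C θ θs ψ₀ X obj C.size t ω) atTop

/-- Normalized size of type `t`. -/
def normalizedSize (t : τ) (ω : Ω) : ℝ :=
  limsup (sizeRatio C θ θs ψ₀ X obj t ω) atTop

open Classical in
/-- Fraction of the first `n` requests that are hits or virtual hits of rare objects
of type `t`. -/
def rareHitFraction (t : τ) (ω : Ω) (n : ℕ) : ℝ :=
  (1 / (n : ℝ)) * ∑ l ∈ Finset.range n,
    if C.label (obj l ω) = Sum.inr t ∧
      (Hit C θ θs ψ₀ X obj l ω ∨ VirtualHit C θ θs ψ₀ X obj l ω) then (1 : ℝ) else 0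

end Cache

/-! ### The limiting formulas -/

section Formulas

variable [MeasurableSpace Ω]

/-- `A_c(j)`: the time of the `j`-th request for the object `c`, `j = 0, 1, 2, …`. -/
def objectArrival (X : ℕ → Ω → ℝ) (obj : ℕ → Ω → κ ⊕ ρ) (c : κ ⊕ ρ) (j : ℕ) (ω : Ω) : ℝ :=
  arrivalTime X (Nat.nth (fun n => obj n ω = c) j + 1) ω

/-- The law of `X_c(1) = A_c(1) - A_c(0)`, the first inter-arrival time of the recurring
object `c`. -/
def interArrivalLaw (μ : Measure Ω) (X : ℕ → Ω → ℝ) (obj : ℕ → Ω → κ ⊕ ρ) (c : κ) : Measure ℝ :=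
  μ.map (fun ω => objectArrival X obj (Sum.inl c) 1 ω - objectArrival X obj (Sum.inl c) 0 ω)

/-- `p_c(x) = ℙ(X_c(1) ≤ x)`. -/
def interArrivalCDF (μ : Measure Ω) (X : ℕ → Ω → ℝ) (obj : ℕ → Ω → κ ⊕ ρ) (c : κ) (x : ℝ) : ℝ :=
  (interArrivalLaw μ X obj c).real (Set.Iic x)

/-- `ŝ_c(θ) = ∫_0^θ x dp_c(x) + θ (1 - p_c(θ))`. -/
def truncatedMean (μ : Measure Ω) (X : ℕ → Ω → ℝ) (obj : ℕ → Ω → κ ⊕ ρ) (c : κ) (θ : ℝ) : ℝ :=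
  (∫ x in Set.Ioc 0 θ, x ∂(interArrivalLaw μ X obj c)) +
    θ * (1 - interArrivalCDF μ X obj c θ)

variable [Fintype κ] [DecidableEq τ] (C : Catalog κ τ ρ) (μ : Measure Ω) (X : ℕ → Ω → ℝ)
  (obj : ℕ → Ω → κ ⊕ ρ) (lam : ℝ) (π : κ ⊕ τ → ℝ) (θ θs : τ → ℝ)

/-- The limiting hit rate `h_t(θ, θs)`, for weights `v` of the recurring objects and `vr` of the
rare ones; `λ_c = π_c λ` and `α_t = π_{K+t}`. -/
def hitRateFormula (v : κ → ℝ) (vr : τ → ℝ) (t : τ) : ℝ :=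
  (∑ c with C.recType c = t, v c * (π (Sum.inl c) * lam) *
      (interArrivalCDF μ X obj c (θ t) ^ 2 +
        (1 - interArrivalCDF μ X obj c (θ t)) * interArrivalCDF μ X obj c (θs t))) /
    (vr t * π (Sum.inr t) * lam +
      ∑ c with C.recType c = t, v c * (π (Sum.inl c) * lam))

/-- The limiting normalized size `s_t(θ, θs)`. -/
def sizeFormula (t : τ) : ℝ :=
  ((∑ c with C.recType c = t, C.recSize c * (π (Sum.inl c) * lam) *
      (interArrivalCDF μ X obj c (θ t) * truncatedMean μ X obj c (θ t) +
        (1 - interArrivalCDF μ X obj c (θ t)) * truncatedMean μ X obj c (θs t))) +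
      C.rareSize t * π (Sum.inr t) * lam * θs t) /
    (C.rareSize t * π (Sum.inr t) * lam +
      ∑ c with C.recType c = t, C.recSize c * (π (Sum.inl c) * lam))

end Formulas

end FTTL

end

namespace FTTL

/-! Fix a recurring object. Because `θs ≤ θ`, after any request for it the object or its metadata
survives for exactly `θ` time units: following a miss, the shadow timer outlasts the shallow one
(`Timers.present_age_onRequest`). So, apart from the first request, a request is a hit or a virtual
hit (a `Renewal`) iff the gap since the preceding request for the object is less than `θ`, whatever
the earlier cache state. A hit therefore depends on two successive gaps: the older one selects the
TTL, `θ` or `θs`, and the newer one is compared with it. Given the past and a current visit, the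
next gap has the fixed law `gapLaw` (`measure_inter_gap`). This yields p(θ)² + (1 - p(θ)) p(θs),
and, with min(gap, TTL) in place of the indicator of a hit, the size formula. The marks have a
density, so the gap law has no atoms and strict comparisons agree with the c.d.f.

The averages are taken over request numbers. Summands that are centred given the past are pairwise
orthogonal, and bounded orthogonal variables obey the strong law
(`ae_tendsto_average_zero_of_orthogonal`). For transitions of the chain this gives, together with
uniqueness of the stationary distribution, the visit frequencies (`ae_tendsto_frequency`); for gaps
weighted by a flag known from the past it gives `ae_tendsto_flagged_gap`. What is observed at a
request is moved to the preceding visit, where it becomes a function of flag and gap, by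
`abs_sum_sub_sum_le_of_consecutive`; the bounded error also absorbs the initial timers of the
recurring objects.

A renewal of a rare object is either bursty or the first request for one of the finitely many
objects stored at time 0. The rarity condition on the windows [m, 2m] thus gives renewals of rare
objects density zero (`tendsto_rare_renewal`); asymptotically these objects produce no hits and each
request for one occupies the cache for time `θs`.

For the size, the remaining lifetime in the cache serves as a potential: the time integral of the
occupancy equals the sum over requests of assigned TTL minus leftover lifetime, up to the potential
at both ends (`integral_occupancy_arrivalTime`). The final potential is controlled by the number of
requests in a time window of fixed length, which is o(n) because arrival times grow linearly
(`tendsto_recent_requests`). -/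

/-! ### Cesàro means -/

/-- The second moment of a sum of pairwise orthogonal random variables bounded by `M`. -/
lemma integral_sq_sum_le_of_orthogonal {Ω : Type*} [MeasurableSpace Ω] {μ : Measure Ω}
    [IsProbabilityMeasure μ] {ξ : ℕ → Ω → ℝ} {M : ℝ} (hmeas : ∀ l, Measurable (ξ l))
    (hbdd : ∀ l ω, |ξ l ω| ≤ M) (horth : ∀ l m, l < m → ∫ ω, ξ l ω * ξ m ω ∂μ = 0) (n : ℕ) :
    ∫ ω, (∑ l ∈ Finset.range n, ξ l ω) ^ 2 ∂μ ≤ n * M ^ 2 := by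
  have hint : ∀ l m, Integrable (fun ω => ξ l ω * ξ m ω) μ := fun l m =>
    Integrable.of_bound ((hmeas l).mul (hmeas m)).aestronglyMeasurable (M * M)
      (ae_of_all _ fun ω => by
        rw [Real.norm_eq_abs, abs_mul]
        exact mul_le_mul (hbdd l ω) (hbdd m ω) (abs_nonneg _) ((abs_nonneg _).trans (hbdd l ω)))
  have horth' : ∀ l m, l ≠ m → ∫ ω, ξ l ω * ξ m ω ∂μ = 0 := by
    intro l m hlm
    rcases lt_or_gt_of_ne hlm with h | h
    · exact horth l m h
    · simp_rw [mul_comm (ξ l _)]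
      exact horth m l h
  simp_rw [sq (∑ l ∈ Finset.range n, ξ l _), Finset.sum_mul_sum]
  rw [integral_finsetSum _ fun i _ => integrable_finsetSum _ fun j _ => hint i j]
  have : ∀ i ∈ Finset.range n, ∫ ω, ∑ j ∈ Finset.range n, ξ i ω * ξ j ω ∂μ ≤ M ^ 2 := by
    intro i hi
    rw [integral_finsetSum _ fun j _ => hint i j,
      Finset.sum_eq_single_of_mem i hi fun j _ hj => horth' i j hj.symm]
    calc ∫ ω, ξ i ω * ξ i ω ∂μ ≤ ∫ _, M ^ 2 ∂μ :=
          integral_mono (hint i i) (integrable_const _) fun ω => by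
            have := hbdd i ω
            simp only
            rw [← sq, ← sq_abs]
            exact pow_le_pow_left₀ (abs_nonneg _) this 2
      _ = M ^ 2 := by simp
  calc _ ≤ ∑ i ∈ Finset.range n, M ^ 2 := Finset.sum_le_sum this
    _ = n * M ^ 2 := by simp

/-- Strong law of large numbers for uniformly bounded pairwise orthogonal random variables. -/
theorem ae_tendsto_average_zero_of_orthogonal {Ω : Type*} [MeasurableSpace Ω] {μ : Measure Ω}
    [IsProbabilityMeasure μ] {ξ : ℕ → Ω → ℝ} {M : ℝ} (hmeas : ∀ l, Measurable (ξ l))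
    (hbdd : ∀ l ω, |ξ l ω| ≤ M) (horth : ∀ l m, l < m → ∫ ω, ξ l ω * ξ m ω ∂μ = 0) :
    ∀ᵐ ω ∂μ, Tendsto (fun n : ℕ => (∑ l ∈ Finset.range n, ξ l ω) / n) atTop (𝓝 0) := by
  set S : ℕ → Ω → ℝ := fun n ω => ∑ l ∈ Finset.range n, ξ l ω with hS
  have hSm : ∀ n, Measurable (S n) := fun n => Finset.measurable_sum _ fun l _ => hmeas l
  have hSb : ∀ n ω, |S n ω| ≤ n * M := fun n ω =>
    (Finset.abs_sum_le_sum_abs _ _).trans ((Finset.sum_le_sum fun l _ => hbdd l ω).trans (by simp))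
  have hsummable : Summable fun k : ℕ => M ^ 2 * (1 / (k : ℝ) ^ 2) :=
    (Real.summable_one_div_nat_pow.2 one_lt_two).mul_left _
  -- Along the squares the second moment of the average is at most k² M² / k⁴ = M² / k², which is
  -- summable; hence the squared averages have an almost surely finite sum and tend to 0.
  have hlint : ∀ k : ℕ, ∫⁻ ω, ENNReal.ofReal ((S (k ^ 2) ω / (k ^ 2 : ℕ)) ^ 2) ∂μ
      ≤ ENNReal.ofReal (M ^ 2 * (1 / (k : ℝ) ^ 2)) := by
    intro k
    rw [← ofReal_integral_eq_lintegral_ofReal]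
    · refine ENNReal.ofReal_le_ofReal ?_
      simp_rw [div_pow]
      rw [integral_div]
      have := integral_sq_sum_le_of_orthogonal hmeas hbdd horth (k ^ 2)
      rcases Nat.eq_zero_or_pos k with rfl | hk
      · simp
      have hk' : (0 : ℝ) < k := by exact_mod_cast hk
      rw [div_le_iff₀ (by positivity)]
      refine this.trans (le_of_eq ?_)
      push_cast
      field_simp
    · refine Integrable.of_bound (((hSm _).div_const _).pow_const 2).aestronglyMeasurable (M ^ 2)
        (ae_of_all _ fun ω => ?_)
      rw [Real.norm_eq_abs, abs_pow, abs_div]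
      have hM : 0 ≤ M := (abs_nonneg _).trans (hbdd 0 ω)
      refine pow_le_pow_left₀ (by positivity) ?_ 2
      rcases Nat.eq_zero_or_pos k with rfl | hk
      · simpa using hM
      have hk' : (0 : ℝ) < k := by exact_mod_cast hk
      rw [div_le_iff₀ (by positivity)]
      refine (hSb _ ω).trans (le_of_eq ?_)
      rw [Nat.abs_cast, mul_comm]
    · exact ae_of_all _ fun ω => sq_nonneg _
  have hfin : ∫⁻ ω, ∑' k : ℕ, ENNReal.ofReal ((S (k ^ 2) ω / (k ^ 2 : ℕ)) ^ 2) ∂μ ≠ ⊤ := by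
    rw [lintegral_tsum fun k =>
      (((hSm _).div_const _).pow_const 2).ennreal_ofReal.aemeasurable]
    refine ne_top_of_le_ne_top ?_ (ENNReal.tsum_le_tsum hlint)
    exact hsummable.tsum_ofReal_ne_top
  have hae := ae_lt_top' (AEMeasurable.tsum fun k =>
      (((hSm _).div_const _).pow_const 2).ennreal_ofReal.aemeasurable) hfin
  filter_upwards [hae] with ω hω
  have h1 : Tendsto (fun k : ℕ => S (k ^ 2) ω / (k ^ 2 : ℕ)) atTop (𝓝 0) := by
    have h2 := ENNReal.tendsto_atTop_zero_of_tsum_ne_top hω.ne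
    have h3 := (ENNReal.tendsto_toReal ENNReal.zero_ne_top).comp h2
    simp only [Function.comp_def, ENNReal.toReal_ofReal (sq_nonneg _), ENNReal.toReal_zero] at h3
    have h4 := h3.sqrt
    simp only [Real.sqrt_sq_eq_abs, Real.sqrt_zero] at h4
    exact (tendsto_zero_iff_abs_tendsto_zero _).2 h4
  -- Adding `n * M` makes the partial sums nondecreasing. Convergence along the squares then extends
  -- to all n, since (k + 1)² / k² tends to 1.
  have hmono : Monotone fun n : ℕ => S n ω + n * M := by
    refine monotone_nat_of_le_succ fun n => ?_
    simp only [hS, Finset.sum_range_succ]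
    push_cast
    have := (abs_le.1 (hbdd n ω)).1
    linarith
  have key := tendsto_div_of_monotone_of_exists_subseq_tendsto_div
    (fun n : ℕ => S n ω + n * M) M hmono (by
      intro a ha
      refine ⟨fun k => k ^ 2, ?_, tendsto_pow_atTop (by norm_num), ?_⟩
      · have h5 : Tendsto (fun k : ℕ => (1 + 1 / ((k : ℝ))) ^ 2) atTop (𝓝 ((1 + 0) ^ 2)) :=
          (tendsto_const_nhds.add tendsto_one_div_atTop_nhds_zero_nat).pow 2
        have h6 := h5.eventually_lt_const (u := a) (by simpa using ha)
        filter_upwards [h6, eventually_gt_atTop 0] with k hk hk0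
        have hk' : (0 : ℝ) < k := by exact_mod_cast hk0
        push_cast
        have h7 : ((k : ℝ) + 1) ^ 2 = (1 + 1 / (k : ℝ)) ^ 2 * k ^ 2 := by field_simp
        rw [h7]
        gcongr
      · have h8 := h1.add_const M
        rw [zero_add] at h8
        refine h8.congr' ?_
        filter_upwards [eventually_gt_atTop 0] with k hk
        have hk' : ((k ^ 2 : ℕ) : ℝ) ≠ 0 := by positivity
        field_simp)
  have h9 := key.sub_const M
  rw [sub_self] at h9
  refine h9.congr' ?_
  filter_upwards [eventually_gt_atTop 0] with n hn
  have hn' : (n : ℝ) ≠ 0 := by positivity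
  field_simp
  ring

/-- If `a m = b l` whenever `l < m` are consecutive elements of `V`, then the sums of `a` and `b`
along `V` differ by a bounded amount. -/
lemma abs_sum_sub_sum_le_of_consecutive {V : ℕ → Prop} [DecidablePred V] {a b : ℕ → ℝ} {M : ℝ}
    (ha : ∀ m, |a m| ≤ M) (hb : ∀ m, |b m| ≤ M)
    (h : ∀ l m, l < m → V l → V m → (∀ i, l < i → i < m → ¬ V i) → a m = b l) (n : ℕ) :
    |(∑ m ∈ Finset.range n, if V m then a m else 0) -
      ∑ l ∈ Finset.range n, if V l then b l else 0| ≤ 2 * M := by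
  have hM : 0 ≤ M := (abs_nonneg _).trans (ha 0)
  -- The difference telescopes to `a` at the first visit minus `b` at the last one. The invariant
  -- records the last visit `l` and adds back its still uncancelled `b l`, so that only the first
  -- `a` remains.
  have key : ∀ n, ((∀ m < n, ¬ V m) ∧ (∑ m ∈ Finset.range n, if V m then a m else 0) -
      (∑ l ∈ Finset.range n, if V l then b l else 0) = 0) ∨
      ∃ l < n, V l ∧ (∀ i, l < i → i < n → ¬ V i) ∧
        |(∑ m ∈ Finset.range n, if V m then a m else 0) -
          (∑ l ∈ Finset.range n, if V l then b l else 0) + b l| ≤ M := by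
    intro n
    induction n with
    | zero => left; simp
    | succ n ih =>
      simp only [Finset.sum_range_succ]
      by_cases hn : V n
      · right
        refine ⟨n, n.lt_succ_self, hn, fun i h1 h2 => by omega, ?_⟩
        simp only [hn, if_true]
        rcases ih with ⟨-, ih⟩ | ⟨l, hl, hVl, hc, ih⟩
        · have := ha n
          rwa [show ∀ x y : ℝ, x + a n - (y + b n) + b n = (x - y) + a n by intros; ring, ih,
            zero_add]
        · rw [h l n hl hVl hn hc]
          rwa [show ∀ x y : ℝ, x + b l - (y + b n) + b n = x - y + b l by intros; ring]
      · simp only [hn, if_false, add_zero]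
        rcases ih with ⟨h0, ih⟩ | ⟨l, hl, hVl, hc, ih⟩
        · exact Or.inl ⟨fun m hm => by
            rcases Nat.lt_succ_iff_lt_or_eq.1 hm with h' | rfl
            exacts [h0 m h', hn], ih⟩
        · refine Or.inr ⟨l, by omega, hVl, fun i h1 h2 => ?_, ih⟩
          rcases Nat.lt_succ_iff_lt_or_eq.1 h2 with h' | rfl
          exacts [hc i h1 h', hn]
  rcases key n with ⟨-, h0⟩ | ⟨l, -, -, -, h1⟩
  · rw [h0, abs_zero]; linarith
  · have := hb l
    rw [abs_le] at *
    constructor <;> linarith [h1.1, h1.2, this.1, this.2]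

/-- A bounded discrepancy between partial sums does not affect the limit of the averages. -/
lemma tendsto_div_of_abs_sub_le {s t : ℕ → ℝ} {K x : ℝ} (h : ∀ n, |s n - t n| ≤ K)
    (ht : Tendsto (fun n : ℕ => t n / n) atTop (𝓝 x)) :
    Tendsto (fun n : ℕ => s n / n) atTop (𝓝 x) := by
  have h0 : Tendsto (fun n : ℕ => (s n - t n) / n) atTop (𝓝 0) := by
    refine squeeze_zero_norm (a := fun n : ℕ => K / n) (fun n => ?_)
      (tendsto_const_div_atTop_nhds_zero_nat K)
    rw [norm_div, Real.norm_eq_abs, Real.norm_natCast]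
    gcongr
    exact h n
  have := h0.add ht
  rw [zero_add] at this
  refine this.congr fun n => ?_
  rw [← add_div]; ring_nf

/-- If the sums over the windows `[m, 2 m]` are `o(m)`, then so are the partial sums. -/
lemma tendsto_average_zero_of_windows {b : ℕ → ℝ} (hb0 : ∀ n, 0 ≤ b n)
    (h : Tendsto (fun m : ℕ => 1 / (m : ℝ) * ∑ l ∈ Finset.Icc m (m + m), b l) atTop (𝓝 0)) :
    Tendsto (fun n : ℕ => (∑ l ∈ Finset.range n, b l) / n) atTop (𝓝 0) := by
  -- Halving: the indices below n lie below n / 2 or in the window from n / 2 to 2 (n / 2), which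
  -- contributes less than ε n / 2. The constant `K` covers the small n for which the window bound
  -- is not yet available.
  have key : ∀ ε > 0, ∃ K, ∀ n : ℕ, ∑ l ∈ Finset.range n, b l ≤ K + ε * n := by
    intro ε hε
    obtain ⟨M, hM⟩ := eventually_atTop.1 ((h.eventually_lt_const hε).and (eventually_gt_atTop 0))
    refine ⟨∑ l ∈ Finset.range (2 * M + 2), b l, fun n => ?_⟩
    induction n using Nat.strong_induction_on with
    | _ n ih =>
      by_cases hn : n ≤ 2 * M + 2
      · have h1 : ∑ l ∈ Finset.range n, b l ≤ ∑ l ∈ Finset.range (2 * M + 2), b l :=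
          Finset.sum_le_sum_of_subset_of_nonneg (Finset.range_mono hn) fun i _ _ => hb0 i
        have : 0 ≤ ε * n := by positivity
        linarith
      · obtain ⟨h2, h3⟩ := hM (n / 2) (by omega)
        have h4 := ih (n / 2) (by omega)
        have h5 : ∑ l ∈ Finset.range n, b l ≤ ∑ l ∈ Finset.range (n / 2), b l +
            ∑ l ∈ Finset.Icc (n / 2) (n / 2 + n / 2), b l := by
          rw [← Finset.sum_union (Finset.disjoint_left.2 fun i h1 h2 => by
            simp only [Finset.mem_range, Finset.mem_Icc] at h1 h2; omega)]
          refine Finset.sum_le_sum_of_subset_of_nonneg (fun i hi => ?_) fun i _ _ => hb0 i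
          simp only [Finset.mem_range, Finset.mem_Icc, Finset.mem_union] at hi ⊢
          omega
        have h3' : (0 : ℝ) < (n / 2 : ℕ) := by exact_mod_cast h3
        rw [one_div, inv_mul_lt_iff₀ h3'] at h2
        have h6 : ((n / 2 : ℕ) : ℝ) + (n / 2 : ℕ) ≤ n := by
          exact_mod_cast (by omega : n / 2 + n / 2 ≤ n)
        nlinarith
  rw [Metric.tendsto_atTop]
  intro ε hε
  obtain ⟨K, hK⟩ := key (ε / 2) (by positivity)
  have h1 := (tendsto_const_div_atTop_nhds_zero_nat K).eventually_lt_const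
    (show (0 : ℝ) < ε / 2 by positivity)
  obtain ⟨N, hN⟩ := eventually_atTop.1 (h1.and (eventually_gt_atTop 0))
  refine ⟨N, fun n hn => ?_⟩
  obtain ⟨h2, h3⟩ := hN n hn
  have h3' : (0 : ℝ) < n := by exact_mod_cast h3
  have h4 : 0 ≤ (∑ l ∈ Finset.range n, b l) / n :=
    div_nonneg (Finset.sum_nonneg fun i _ => hb0 i) h3'.le
  rw [Real.dist_0_eq_abs, abs_of_nonneg h4, div_lt_iff₀ h3']
  rw [div_lt_iff₀ h3'] at h2
  have := hK n
  linarith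

/-! ### Markov chains with independent real marks -/

/-- Two finite measures that agree on intersections of elements of two σ-algebras agree on the
σ-algebra they generate. -/
lemma measure_eq_of_inter {Ω : Type*} {m₁ m₂ m₀ : MeasurableSpace Ω} {ν₁ ν₂ : Measure Ω}
    [IsFiniteMeasure ν₁] (h₁ : m₁ ≤ m₀) (h₂ : m₂ ≤ m₀)
    (h : ∀ A B, MeasurableSet[m₁] A → MeasurableSet[m₂] B → ν₁ (A ∩ B) = ν₂ (A ∩ B))
    {G : Set Ω} (hG : MeasurableSet[m₁ ⊔ m₂] G) : ν₁ G = ν₂ G := by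
  have huniv : ν₁ Set.univ = ν₂ Set.univ := by
    simpa using h _ _ (@MeasurableSet.univ _ m₁) (@MeasurableSet.univ _ m₂)
  have : IsFiniteMeasure ν₂ := ⟨by simp [← huniv]⟩
  have hle : m₁ ⊔ m₂ ≤ m₀ := sup_le h₁ h₂
  have hgen : m₁ ⊔ m₂ = MeasurableSpace.generateFrom
      {s | ∃ A B, MeasurableSet[m₁] A ∧ MeasurableSet[m₂] B ∧ s = A ∩ B} := by
    refine le_antisymm (sup_le (fun A hA => ?_) fun B hB => ?_)
      (MeasurableSpace.generateFrom_le ?_)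
    · exact MeasurableSpace.measurableSet_generateFrom
        ⟨A, Set.univ, hA, @MeasurableSet.univ _ m₂, by simp⟩
    · exact MeasurableSpace.measurableSet_generateFrom
        ⟨Set.univ, B, @MeasurableSet.univ _ m₁, hB, by simp⟩
    · rintro _ ⟨A, B, hA, hB, rfl⟩
      exact @MeasurableSet.inter _ (m₁ ⊔ m₂) _ _ ((le_sup_left : m₁ ≤ m₁ ⊔ m₂) A hA)
        ((le_sup_right : m₂ ≤ m₁ ⊔ m₂) B hB)
  refine MeasurableSpace.induction_on_inter (m := m₁ ⊔ m₂) (C := fun s _ => ν₁ s = ν₂ s)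
    hgen ?_ (by simp) ?_ ?_ ?_ G hG
  · rintro _ ⟨A, B, hA, hB, rfl⟩ _ ⟨A', B', hA', hB', rfl⟩ -
    exact ⟨A ∩ A', B ∩ B', @MeasurableSet.inter _ m₁ _ _ hA hA',
      @MeasurableSet.inter _ m₂ _ _ hB hB', Set.inter_inter_inter_comm ..⟩
  · rintro _ ⟨A, B, hA, hB, rfl⟩
    exact h A B hA hB
  · intro t ht h
    rw [measure_compl (hle t ht) (measure_ne_top _ _), measure_compl (hle t ht)
      (measure_ne_top _ _), h, huniv]
  · intro f hd hf h
    rw [measure_iUnion hd fun i => hle _ (hf i), measure_iUnion hd fun i => hle _ (hf i)]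
    simp_rw [h]

/-- A bounded function whose integral vanishes on every set of a sub-σ-algebra is orthogonal to
the bounded functions measurable with respect to it. -/
lemma integral_mul_eq_zero_of_setIntegral {Ω : Type*} {m m₀ : MeasurableSpace Ω} {μ : Measure Ω}
    [IsProbabilityMeasure μ] (hm : m ≤ m₀) {H f : Ω → ℝ} {K M : ℝ} (hH : Measurable[m] H)
    (hHb : ∀ ω, |H ω| ≤ K) (hf : Measurable f) (hfb : ∀ ω, |f ω| ≤ M)
    (h : ∀ G, MeasurableSet[m] G → ∫ ω in G, f ω ∂μ = 0) : ∫ ω, H ω * f ω ∂μ = 0 := by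
  have hfi : Integrable f μ := Integrable.of_bound hf.aestronglyMeasurable M (ae_of_all _ hfb)
  -- Vanishing set integrals mean that the conditional expectation of `f` is 0, and the
  -- `m`-measurable factor `H` can be pulled out of it.
  have h0 : (0 : Ω → ℝ) =ᵐ[μ] μ[f|m] := by
    refine ae_eq_condExp_of_forall_setIntegral_eq hm hfi (fun _ _ _ => integrableOn_zero)
      (fun s hs _ => by simp [h s hs]) aestronglyMeasurable_zero
  have hHf : Integrable (H * f) μ := by
    refine Integrable.of_bound ((hH.mono hm le_rfl).mul hf).aestronglyMeasurable (K * M)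
      (ae_of_all _ fun ω => ?_)
    rw [Pi.mul_apply, norm_mul]
    exact mul_le_mul (hHb ω) (hfb ω) (norm_nonneg _) ((abs_nonneg _).trans (hHb ω))
  have h1 := condExp_mul_of_stronglyMeasurable_left (m := m) hH.stronglyMeasurable hHf hfi
  have h2 : ∫ ω, (H * f) ω ∂μ = 0 := by
    rw [← integral_condExp hm (f := H * f)]
    rw [integral_congr_ae (h1.trans ((EventuallyEq.refl _ H).mul h0.symm))]
    simp
  exact h2

/-- A finite-state Markov chain `Z` with transition matrix `P`, together with an independent
i.i.d. sequence `X` of real marks. -/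
structure IsMarkedChain {Ω S : Type*} [MeasurableSpace Ω] [Fintype S] (μ : Measure Ω)
    (X : ℕ → Ω → ℝ) (Z : ℕ → Ω → S) (P : Matrix S S ℝ) (η : Measure ℝ) : Prop where
  measurable_X : ∀ n, Measurable (X n)
  indep_X : iIndepFun X μ
  map_X : ∀ n, μ.map (X n) = η
  measurable_Z : ∀ n, Measurable[_, ⊤] (Z n)
  indep_X_Z : Indep (⨆ n, MeasurableSpace.comap (X n) inferInstance)
    (⨆ n, MeasurableSpace.comap (Z n) ⊤) μ
  nonneg : ∀ w z, 0 ≤ P w z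
  row_sum : ∀ w, ∑ z, P w z = 1
  markov : ∀ (n : ℕ) (z : ℕ → S),
    μ.real {ω | ∀ i ≤ n + 1, Z i ω = z i} = μ.real {ω | ∀ i ≤ n, Z i ω = z i} * P (z n) (z (n + 1))

/-- The σ-algebra generated by the marks with index in `s`. -/
@[reducible] def markAlg {Ω : Type*} (X : ℕ → Ω → ℝ) (s : Set ℕ) : MeasurableSpace Ω :=
  ⨆ i ∈ s, MeasurableSpace.comap (X i) inferInstance

/-- The σ-algebra generated by the first `n + 1` states. -/
@[reducible] def labelAlg {Ω S : Type*} (Z : ℕ → Ω → S) (n : ℕ) : MeasurableSpace Ω :=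
  MeasurableSpace.comap (fun ω (i : Fin (n + 1)) => Z i ω) ⊤

/-- The σ-algebra generated by the first `n + 1` states and marks. -/
@[reducible] def pastAlg {Ω S : Type*} (X : ℕ → Ω → ℝ) (Z : ℕ → Ω → S) (n : ℕ) : MeasurableSpace Ω :=
  markAlg X (Set.Iic n) ⊔ labelAlg Z n

/-- The σ-algebra generated by the first `n + 1` states and all marks. -/
@[reducible] def markedPastAlg {Ω S : Type*} (X : ℕ → Ω → ℝ) (Z : ℕ → Ω → S) (n : ℕ) : MeasurableSpace Ω :=
  markAlg X Set.univ ⊔ labelAlg Z n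

section Algebras

variable {Ω S : Type*} {X : ℕ → Ω → ℝ} {Z : ℕ → Ω → S}

lemma markAlg_mono {s t : Set ℕ} (h : s ⊆ t) : markAlg X s ≤ markAlg X t :=
  biSup_mono h

lemma measurable_markAlg {s : Set ℕ} {i : ℕ} (hi : i ∈ s) : Measurable[markAlg X s] (X i) :=
  Measurable.of_comap_le (le_biSup (fun i => MeasurableSpace.comap (X i) inferInstance) hi)

lemma measurableSet_labelAlg {n i : ℕ} (hi : i ≤ n) (s : Set S) :
    MeasurableSet[labelAlg Z n] {ω | Z i ω ∈ s} :=
  ⟨{p | p ⟨i, Nat.lt_succ_of_le hi⟩ ∈ s}, trivial, rfl⟩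

lemma labelAlg_mono : Monotone (labelAlg Z) := by
  rintro m n h _ ⟨T, -, rfl⟩
  exact ⟨{p | (fun i : Fin (m + 1) => p ⟨i, by omega⟩) ∈ T}, trivial, rfl⟩

/-- Finiteness of `S` matters: an arbitrary set of label paths is then a countable union of
cylinders, so giving the path space its full σ-algebra adds nothing. -/
lemma labelAlg_le_iSup [Finite S] (n : ℕ) : labelAlg Z n ≤ ⨆ i, MeasurableSpace.comap (Z i) ⊤ := by
  rintro _ ⟨T, -, rfl⟩
  have : (fun ω (i : Fin (n + 1)) => Z i ω) ⁻¹' T =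
      ⋃ p ∈ T, ⋂ i : Fin (n + 1), {ω | Z i ω = p i} := by
    ext ω
    simp only [Set.mem_preimage, Set.mem_iUnion, Set.mem_iInter, Set.mem_ofPred_eq, exists_prop]
    exact ⟨fun h => ⟨_, h, fun i => rfl⟩, fun ⟨p, hp, h⟩ => (funext h : _ = p) ▸ hp⟩
  rw [this]
  refine MeasurableSet.biUnion (Set.to_countable T) fun p _ => MeasurableSet.iInter fun i => ?_
  exact (le_iSup (fun i => MeasurableSpace.comap (Z i) ⊤) (i : ℕ)) _ ⟨{p i}, trivial, rfl⟩

lemma pastAlg_mono : Monotone (pastAlg X Z) := fun _ _ h =>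
  sup_le_sup (markAlg_mono (Set.Iic_subset_Iic.2 h)) (labelAlg_mono h)

lemma markedPastAlg_mono : Monotone (markedPastAlg X Z) := fun _ _ h =>
  sup_le_sup le_rfl (labelAlg_mono h)

lemma pastAlg_le_markedPastAlg (n : ℕ) : pastAlg X Z n ≤ markedPastAlg X Z n :=
  sup_le_sup (markAlg_mono (Set.subset_univ _)) le_rfl

lemma measurable_pastAlg {n i : ℕ} (hi : i ≤ n) : Measurable[pastAlg X Z n] (X i) :=
  (measurable_markAlg (Set.mem_Iic.2 hi)).mono le_sup_left le_rfl

lemma measurableSet_pastAlg {n i : ℕ} (hi : i ≤ n) (s : Set S) :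
    MeasurableSet[pastAlg X Z n] {ω | Z i ω ∈ s} :=
  (le_sup_right : labelAlg Z n ≤ pastAlg X Z n) _ (measurableSet_labelAlg hi s)

lemma measurableSet_markedPastAlg {n i : ℕ} (hi : i ≤ n) (s : Set S) :
    MeasurableSet[markedPastAlg X Z n] {ω | Z i ω ∈ s} :=
  (le_sup_right : labelAlg Z n ≤ markedPastAlg X Z n) _ (measurableSet_labelAlg hi s)

end Algebras

namespace IsMarkedChain

variable {Ω S : Type*} [MeasurableSpace Ω] [Fintype S] {μ : Measure Ω} {X : ℕ → Ω → ℝ} {Z : ℕ → Ω → S}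
  {P : Matrix S S ℝ} {η : Measure ℝ}

lemma measurableSet_label (hZ : IsMarkedChain μ X Z P η) (n : ℕ) (s : Set S) :
    MeasurableSet {ω | Z n ω ∈ s} :=
  hZ.measurable_Z n (t := s) trivial

lemma markAlg_le (hZ : IsMarkedChain μ X Z P η) (s : Set ℕ) : markAlg X s ≤ ‹_› :=
  iSup₂_le fun i _ => (hZ.measurable_X i).comap_le

lemma labelAlg_le (hZ : IsMarkedChain μ X Z P η) (n : ℕ) : labelAlg Z n ≤ ‹_› :=
  (labelAlg_le_iSup n).trans (iSup_le fun i => (hZ.measurable_Z i).comap_le)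

lemma pastAlg_le (hZ : IsMarkedChain μ X Z P η) (n : ℕ) : pastAlg X Z n ≤ ‹_› :=
  sup_le (hZ.markAlg_le _) (hZ.labelAlg_le n)

lemma markedPastAlg_le (hZ : IsMarkedChain μ X Z P η) (n : ℕ) : markedPastAlg X Z n ≤ ‹_› :=
  sup_le (hZ.markAlg_le _) (hZ.labelAlg_le n)

variable [IsProbabilityMeasure μ]

/-- The Markov property with respect to the past states. -/
lemma measure_inter_step_of_labelAlg (hZ : IsMarkedChain μ X Z P η) {n : ℕ} {B : Set Ω}
    (hB : MeasurableSet[labelAlg Z n] B) (w z : S) :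
    μ (B ∩ {ω | Z n ω = w} ∩ {ω | Z (n + 1) ω = z}) =
      μ (B ∩ {ω | Z n ω = w}) * ENNReal.ofReal (P w z) := by
  classical
  obtain ⟨T, -, rfl⟩ := hB
  set Φ : Ω → Fin (n + 1) → S := fun ω i => Z i ω with hΦ
  -- The event splits into finitely many disjoint label paths ending in `w`, and the Markov
  -- hypothesis is applied to each of them.
  set T' : Finset (Fin (n + 1) → S) := Finset.univ.filter fun p => p ∈ T ∧ p (Fin.last n) = w
  have hatom : ∀ p, MeasurableSet (Φ ⁻¹' {p}) := fun p =>
    hZ.labelAlg_le n _ ⟨{p}, trivial, rfl⟩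
  have hdisj : Set.PairwiseDisjoint (T' : Set (Fin (n + 1) → S)) fun p => Φ ⁻¹' {p} :=
    fun p _ q _ hpq => Set.disjoint_left.2 fun ω h1 h2 => hpq (h1.symm.trans h2)
  have hset : Φ ⁻¹' T ∩ {ω | Z n ω = w} = ⋃ p ∈ T', Φ ⁻¹' {p} := by
    ext ω
    simp [T', hΦ, Fin.last]
  have hz : MeasurableSet {ω | Z (n + 1) ω = z} := hZ.measurableSet_label (n + 1) {z}
  rw [hset, Set.iUnion₂_inter, measure_biUnion_finset
    (fun p hp q hq hpq => (hdisj hp hq hpq).mono Set.inter_subset_left Set.inter_subset_left)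
    fun p _ => (hatom p).inter hz, measure_biUnion_finset hdisj fun p _ => hatom p,
    Finset.sum_mul]
  refine Finset.sum_congr rfl fun p hp => ?_
  have hpw : p (Fin.last n) = w := by simpa [T'] using (Finset.mem_filter.1 hp).2.2
  -- Continuing the path `p` by the constant `z` lets one sequence describe both the event up to
  -- time n and its extension to time n + 1.
  have hm := hZ.markov n fun i => if h : i < n + 1 then p ⟨i, h⟩ else z
  have e1 : {ω | ∀ i ≤ n, Z i ω = if h : i < n + 1 then p ⟨i, h⟩ else z} = Φ ⁻¹' {p} := by
    ext ω
    simp only [Set.mem_ofPred_eq, Set.mem_preimage, Set.mem_singleton_iff, funext_iff, hΦ]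
    constructor
    · intro h i
      rw [h i (by omega), dif_pos i.isLt]
    · intro h i hi
      have hi' : i < n + 1 := by omega
      rw [dif_pos hi', ← h ⟨i, hi'⟩]
  have e2 : {ω | ∀ i ≤ n + 1, Z i ω = if h : i < n + 1 then p ⟨i, h⟩ else z} =
      Φ ⁻¹' {p} ∩ {ω | Z (n + 1) ω = z} := by
    rw [← e1]
    ext ω
    simp only [Set.mem_ofPred_eq, Set.mem_inter_iff]
    constructor
    · intro h
      exact ⟨fun i hi => h i (by omega), by simpa using h (n + 1) le_rfl⟩
    · rintro ⟨h1, h2⟩ i hi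
      rcases Nat.le_succ_iff.1 hi with h | rfl
      · exact h1 i h
      · simpa using h2
  rw [e1, e2] at hm
  have hmw : (if h : n < n + 1 then p ⟨n, h⟩ else z) = w := by
    rw [dif_pos n.lt_succ_self, ← hpw]; rfl
  simp only [hmw, lt_irrefl, dite_false] at hm
  rw [← ofReal_measureReal, hm, ENNReal.ofReal_mul measureReal_nonneg, ofReal_measureReal]

/-- The Markov property with respect to the past states and all marks. -/
lemma measure_inter_step (hZ : IsMarkedChain μ X Z P η) {n : ℕ} {G : Set Ω}
    (hG : MeasurableSet[markedPastAlg X Z n] G) (w z : S) :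
    μ (G ∩ {ω | Z n ω = w} ∩ {ω | Z (n + 1) ω = z}) =
      μ (G ∩ {ω | Z n ω = w}) * ENNReal.ofReal (P w z) := by
  have hw : MeasurableSet {ω | Z n ω = w} := hZ.measurableSet_label n {w}
  have hz : MeasurableSet {ω | Z (n + 1) ω = z} := hZ.measurableSet_label (n + 1) {z}
  -- For fixed `w` and `z` both sides are finite measures in `G`, so it is enough to test
  -- intersections of a mark event with a label event, where independence factors out the mark
  -- event.
  have key := measure_eq_of_inter (hZ.markAlg_le Set.univ) (hZ.labelAlg_le n)
    (ν₁ := μ.restrict ({ω | Z n ω = w} ∩ {ω | Z (n + 1) ω = z}))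
    (ν₂ := ENNReal.ofReal (P w z) • μ.restrict {ω | Z n ω = w}) (fun A B hA hB => ?_) hG
  · rw [Measure.restrict_apply (hZ.markedPastAlg_le n _ hG), Measure.smul_apply,
      Measure.restrict_apply (hZ.markedPastAlg_le n _ hG), ← Set.inter_assoc] at key
    rw [key, smul_eq_mul, mul_comm]
  · have hA' := hZ.markAlg_le _ _ hA
    have hB' := hZ.labelAlg_le n _ hB
    rw [Measure.smul_apply, Measure.restrict_apply (hA'.inter hB'),
      Measure.restrict_apply (hA'.inter hB'), smul_eq_mul, Set.inter_assoc, Set.inter_assoc]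
    have hind := (Indep_iff _ _ μ).1 hZ.indep_X_Z
    have hA'' : MeasurableSet[⨆ n, MeasurableSpace.comap (X n) inferInstance] A := by
      rwa [markAlg, iSup_congr fun i => iSup_pos (Set.mem_univ i)] at hA
    have hBw : MeasurableSet[labelAlg Z n] (B ∩ {ω | Z n ω = w}) :=
      @MeasurableSet.inter _ (labelAlg Z n) _ _ hB (measurableSet_labelAlg le_rfl {w})
    have hBz : MeasurableSet[labelAlg Z (n + 1)]
        (B ∩ {ω | Z n ω = w} ∩ {ω | Z (n + 1) ω = z}) := @MeasurableSet.inter _ (labelAlg Z (n + 1)) _ _ (labelAlg_mono n.le_succ _ hBw)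
      (measurableSet_labelAlg (Z := Z) (le_refl (n + 1)) {z})
    rw [← Set.inter_assoc B, hind _ _ hA'' (labelAlg_le_iSup _ _ hBz),
      hind A (B ∩ {ω | Z n ω = w}) hA'' (labelAlg_le_iSup _ _ hBw)]
    have := hZ.measure_inter_step_of_labelAlg hB w z
    rw [this, mul_comm (ENNReal.ofReal _), mul_assoc]

open Classical in
/-- The transition counts obey the law of large numbers. -/
lemma ae_tendsto_transition (hZ : IsMarkedChain μ X Z P η) (w z : S) :
    ∀ᵐ ω ∂μ, Tendsto (fun n : ℕ => (∑ l ∈ Finset.range n, if Z l ω = w then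
      (if Z (l + 1) ω = z then (1 : ℝ) else 0) - P w z else 0) / n) atTop (𝓝 0) := by
  have hm : ∀ n l, l ≤ n → ∀ v, MeasurableSet[markedPastAlg X Z n] {ω | Z l ω = v} :=
    fun n l h v => measurableSet_markedPastAlg h {v}
  have hP1 : P w z ≤ 1 := by
    rw [← hZ.row_sum w]
    exact Finset.single_le_sum (fun i _ => hZ.nonneg w i) (Finset.mem_univ z)
  have hmeas : ∀ l, Measurable[markedPastAlg X Z (l + 1)] fun ω => if Z l ω = w then
      (if Z (l + 1) ω = z then (1 : ℝ) else 0) - P w z else 0 := fun l => by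
    have h1 : Measurable[markedPastAlg X Z (l + 1)] fun ω =>
        if Z (l + 1) ω = z then (1 : ℝ) else 0 :=
      Measurable.ite (hm _ _ le_rfl z) measurable_const measurable_const
    exact Measurable.ite (hm _ _ (Nat.le_succ l) w) (h1.sub_const _) measurable_const
  have hb : ∀ l ω, |if Z l ω = w then
      (if Z (l + 1) ω = z then (1 : ℝ) else 0) - P w z else 0| ≤ 1 := by
    intro l ω
    have := hZ.nonneg w z
    split_ifs <;> rw [abs_le] <;> constructor <;> linarith
  refine ae_tendsto_average_zero_of_orthogonal
    (fun l => (hmeas l).mono (hZ.markedPastAlg_le _) le_rfl) hb fun l m hlm => ?_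
  -- A martingale difference argument: the l-th term is known at time l + 1 ≤ m, and the m-th term
  -- has mean zero given the past at time m.
  refine integral_mul_eq_zero_of_setIntegral (hZ.markedPastAlg_le m)
    ((hmeas l).mono (markedPastAlg_mono hlm) le_rfl) (hb l)
    ((hmeas m).mono (hZ.markedPastAlg_le _) le_rfl) (hb m) fun G hG => ?_
  have hG' := hZ.markedPastAlg_le m _ hG
  have hw : MeasurableSet {ω | Z m ω = w} := hZ.measurableSet_label m {w}
  have hz : MeasurableSet {ω | Z (m + 1) ω = z} := hZ.measurableSet_label (m + 1) {z}
  have e : (fun ω => if Z m ω = w then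
      (if Z (m + 1) ω = z then (1 : ℝ) else 0) - P w z else 0) = fun ω =>
      ({ω | Z m ω = w} ∩ {ω | Z (m + 1) ω = z}).indicator (fun _ => (1 : ℝ)) ω -
        {ω | Z m ω = w}.indicator (fun _ => P w z) ω := by
    ext ω
    by_cases h1 : Z m ω = w <;> by_cases h2 : Z (m + 1) ω = z <;> simp [h1, h2]
  rw [e, integral_sub ((integrable_const _).indicator (hw.inter hz))
    ((integrable_const _).indicator hw), integral_indicator (hw.inter hz), integral_indicator hw,
    Measure.restrict_restrict (hw.inter hz), Measure.restrict_restrict hw]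
  have := hZ.measure_inter_step hG w z
  simp only [integral_const, MeasurableSet.univ, measureReal_restrict_apply, Set.univ_inter,
    smul_eq_mul, mul_one]
  rw [show {ω | Z m ω = w} ∩ {ω | Z (m + 1) ω = z} ∩ G =
    G ∩ {ω | Z m ω = w} ∩ {ω | Z (m + 1) ω = z} by rw [Set.inter_comm, Set.inter_assoc],
    Set.inter_comm {ω | Z m ω = w} G, measureReal_def, this, ENNReal.toReal_mul,
    ENNReal.toReal_ofReal (hZ.nonneg w z), measureReal_def, sub_self]

end IsMarkedChain

/-! ### Stationary distributions and visit frequencies -/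

section Stationary

variable {S : Type*} [Fintype S] {P : Matrix S S ℝ}

/-- A nonnegative invariant vector of an irreducible matrix that is positive somewhere is positive
everywhere. -/
lemma pos_of_vecMul_eq (hP : P.IsIrreducible) {p : S → ℝ} (hp : Matrix.vecMul p P = p)
    (h0 : ∀ z, 0 ≤ p z) {w : S} (hw : 0 < p w) (z : S) : 0 < p z := by
  classical
  obtain ⟨k, -, hk⟩ := (Matrix.isIrreducible_iff_exists_pow_pos hP.nonneg).1 hP w z
  have hpow : ∀ k : ℕ, Matrix.vecMul p (P ^ k) = p := by
    intro k
    induction k with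
    | zero => simp
    | succ k ih => rw [pow_succ, ← Matrix.vecMul_vecMul, ih, hp]
  have hPk : ∀ i j, 0 ≤ (P ^ k) i j := Matrix.pow_apply_nonneg hP.nonneg k
  rw [← hpow k, Matrix.vecMul, dotProduct]
  exact (mul_pos hw hk).trans_le (Finset.single_le_sum
    (f := fun i => p i * (P ^ k) i z) (fun i _ => mul_nonneg (h0 i) (hPk i z)) (Finset.mem_univ w))

/-- The entries of a stationary distribution of an irreducible matrix are positive. -/
lemma stationary_pos (hP : P.IsIrreducible) {π : S → ℝ} (hπ : π ∈ stdSimplex ℝ S)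
    (hπP : Matrix.vecMul π P = π) (z : S) : 0 < π z := by
  by_contra hz
  have h : ∀ w, π w ≤ 0 := fun w => by
    by_contra hw
    exact hz (pos_of_vecMul_eq hP hπP hπ.1 (not_le.1 hw) z)
  have := hπ.2
  linarith [Finset.sum_nonpos fun w (_ : w ∈ Finset.univ) => h w]

/-- The stationary distribution of an irreducible stochastic matrix is unique. -/
lemma stationary_unique (hP : P.IsIrreducible) (hrow : ∀ w, ∑ z, P w z = 1) {p q : S → ℝ}
    (hp : p ∈ stdSimplex ℝ S) (hq : q ∈ stdSimplex ℝ S) (hpP : Matrix.vecMul p P = p)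
    (hqP : Matrix.vecMul q P = q) : p = q := by
  -- The positive part of `p - q` is subinvariant, and `P` preserves total mass, so it is invariant.
  -- If it were positive somewhere it would be positive everywhere, against p and q having equal
  -- mass.
  set v : S → ℝ := fun z => max (p z - q z) 0 with hv
  have hle : ∀ z, v z ≤ Matrix.vecMul v P z := by
    intro z
    refine max_le ?_ ?_
    · rw [← congrFun hpP z, ← congrFun hqP z]
      simp only [Matrix.vecMul, dotProduct, ← Finset.sum_sub_distrib, ← sub_mul]
      exact Finset.sum_le_sum fun w _ => mul_le_mul_of_nonneg_right (le_max_left _ _) (hP.nonneg w z)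
    · exact Finset.sum_nonneg fun w _ => mul_nonneg (le_max_right _ _) (hP.nonneg w z)
  have hsum : ∑ z, Matrix.vecMul v P z = ∑ z, v z := by
    simp only [Matrix.vecMul, dotProduct]
    rw [Finset.sum_comm]
    simp [← Finset.mul_sum, hrow]
  have heq : Matrix.vecMul v P = v := by
    ext z
    exact ((Finset.sum_eq_sum_iff_of_le fun z _ => hle z).1 hsum.symm z (Finset.mem_univ z)).symm
  have hdiff : ∑ z, (p z - q z) = 0 := by
    rw [Finset.sum_sub_distrib, hp.2, hq.2, sub_self]
  have hnonpos : ∀ z, p z - q z ≤ 0 := by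
    by_contra! h
    obtain ⟨w, hw⟩ := h
    have hpos : ∀ z, 0 < p z - q z := fun z => by
      have := pos_of_vecMul_eq hP heq (fun z => le_max_right _ _) (lt_max_of_lt_left hw) z
      simpa [hv] using this
    have := Finset.sum_pos (fun z _ => hpos z) ⟨w, Finset.mem_univ w⟩
    linarith
  ext z
  have := (Finset.sum_eq_zero_iff_of_nonpos fun z _ => hnonpos z).1 hdiff z (Finset.mem_univ z)
  linarith

/-- A sequence of distributions that is asymptotically invariant converges to the stationary
distribution. -/
lemma tendsto_of_asymptotically_invariant (hP : P.IsIrreducible) (hrow : ∀ w, ∑ z, P w z = 1)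
    {π : S → ℝ} (hπ : π ∈ stdSimplex ℝ S) (hπP : Matrix.vecMul π P = π) {q : ℕ → S → ℝ}
    (hq : ∀ᶠ n in atTop, q n ∈ stdSimplex ℝ S)
    (h : Tendsto (fun n => q n - Matrix.vecMul (q n) P) atTop (𝓝 0)) :
    Tendsto q atTop (𝓝 π) := by
  -- By compactness only cluster points matter; each is invariant by continuity, hence equal to `π`
  -- by uniqueness.
  refine (isCompact_stdSimplex ℝ S).tendsto_nhds_of_unique_mapClusterPt hq fun p hp hcl => ?_
  refine stationary_unique hP hrow hp hπ ?_ hπP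
  obtain ⟨φ, hφ, hlim⟩ := MapClusterPt.tendsto_subseq hcl
  have hc : Continuous fun x : S → ℝ => x - Matrix.vecMul x P :=
    continuous_id.sub (continuous_id.matrix_vecMul continuous_const)
  have h1 := (hc.tendsto p).comp hlim
  have h2 := h.comp hφ.tendsto_atTop
  exact (sub_eq_zero.1 (tendsto_nhds_unique h1 h2)).symm

end Stationary

namespace IsMarkedChain

variable {Ω S : Type*} [MeasurableSpace Ω] [Fintype S] {μ : Measure Ω} {X : ℕ → Ω → ℝ}
  {Z : ℕ → Ω → S} {P : Matrix S S ℝ} {η : Measure ℝ} [IsProbabilityMeasure μ]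

open Classical in
/-- Ergodic theorem: the frequency of visits to a state converges to its stationary
probability. -/
theorem ae_tendsto_frequency (hZ : IsMarkedChain μ X Z P η) (hP : P.IsIrreducible) {π : S → ℝ}
    (hπ : π ∈ stdSimplex ℝ S) (hπP : Matrix.vecMul π P = π) :
    ∀ᵐ ω ∂μ, ∀ z, Tendsto (fun n : ℕ =>
      (∑ l ∈ Finset.range n, if Z l ω = z then (1 : ℝ) else 0) / n) atTop (𝓝 (π z)) := by
  have hall : ∀ᵐ ω ∂μ, ∀ w z, Tendsto (fun n : ℕ => (∑ l ∈ Finset.range n, if Z l ω = w then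
      (if Z (l + 1) ω = z then (1 : ℝ) else 0) - P w z else 0) / n) atTop (𝓝 0) :=
    ae_all_iff.2 fun w => ae_all_iff.2 fun z => hZ.ae_tendsto_transition w z
  filter_upwards [hall] with ω hω
  set q : ℕ → S → ℝ := fun n z =>
    (∑ l ∈ Finset.range n, if Z l ω = z then (1 : ℝ) else 0) / n with hq
  suffices h : Tendsto q atTop (𝓝 π) from fun z => (tendsto_pi_nhds.1 h) z
  refine tendsto_of_asymptotically_invariant hP hZ.row_sum hπ hπP ?_ ?_
  · filter_upwards [eventually_gt_atTop 0] with n hn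
    refine ⟨fun z => div_nonneg (Finset.sum_nonneg fun l _ => by positivity) (Nat.cast_nonneg n), ?_⟩
    rw [hq]
    simp only
    rw [← Finset.sum_div, Finset.sum_comm]
    simp [hn.ne']
  · rw [tendsto_pi_nhds]
    intro z
    have h1 : Tendsto (fun n : ℕ => ∑ w, (∑ l ∈ Finset.range n, if Z l ω = w then
        (if Z (l + 1) ω = z then (1 : ℝ) else 0) - P w z else 0) / n) atTop (𝓝 0) := by
      simpa using tendsto_finsetSum Finset.univ fun w _ => hω w z
    -- Summing the transition laws over the departure state `w` compares the frequencies shifted by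
    -- one step with `q n` multiplied by `P`.
    have h2 : Tendsto (fun n : ℕ => (∑ l ∈ Finset.range n, if Z (l + 1) ω = z then (1 : ℝ) else 0) / n
        - Matrix.vecMul (q n) P z) atTop (𝓝 0) := by
      refine h1.congr fun n => ?_
      rw [← Finset.sum_div, Finset.sum_comm, Matrix.vecMul, dotProduct, hq]
      simp only [div_mul_eq_mul_div, ← Finset.sum_div]
      rw [← sub_div]
      congr 1
      simp only [Finset.sum_mul]
      rw [Finset.sum_comm (s := Finset.univ), ← Finset.sum_sub_distrib]
      refine Finset.sum_congr rfl fun l _ => ?_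
      simp
    -- The shift by one step changes the visit count only through the terms at times 0 and n.
    have h3 : Tendsto (fun n : ℕ => ((∑ l ∈ Finset.range n, if Z l ω = z then (1 : ℝ) else 0) -
        ∑ l ∈ Finset.range n, if Z (l + 1) ω = z then (1 : ℝ) else 0) / n) atTop (𝓝 0) := by
      refine tendsto_div_of_abs_sub_le (t := fun _ => 0) (K := 1) (fun n => ?_) (by simp)
      have : ∀ n, (∑ l ∈ Finset.range n, if Z (l + 1) ω = z then (1 : ℝ) else 0) +
          (if Z 0 ω = z then (1 : ℝ) else 0) =
          (∑ l ∈ Finset.range n, if Z l ω = z then (1 : ℝ) else 0) +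
          (if Z n ω = z then (1 : ℝ) else 0) := fun n => by
        rw [← Finset.sum_range_succ' (fun l => if Z l ω = z then (1 : ℝ) else 0),
          Finset.sum_range_succ]
      have h := this n
      rw [sub_zero, abs_le]
      constructor <;> split_ifs at h <;> linarith
    have h4 := h3.add h2
    simp only [add_zero] at h4
    refine h4.congr fun n => ?_
    simp only [hq, Pi.sub_apply]
    rw [sub_div]
    ring

end IsMarkedChain

/-! ### Gaps between consecutive visits to a state -/

/-- The time of the first visit to `c`. -/
noncomputable def firstVisit {Ω S : Type*} (Z : ℕ → Ω → S) (c : S) (ω : Ω) : ℕ := sInf {m | Z m ω = c}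

/-- The time of the first visit to `c` after time `l`. -/
noncomputable def nextVisit {Ω S : Type*} (Z : ℕ → Ω → S) (c : S) (l : ℕ) (ω : Ω) : ℕ :=
  sInf {m | l < m ∧ Z m ω = c}

/-- The sum of the marks after time `l` up to the next visit to `c`. -/
noncomputable def gap {Ω S : Type*} (X : ℕ → Ω → ℝ) (Z : ℕ → Ω → S) (c : S) (l : ℕ) (ω : Ω) : ℝ :=
  arrivalTime X (nextVisit Z c l ω + 1) ω - arrivalTime X (l + 1) ω

/-- The first visit to `c` after time `l` takes place at time `l + 1 + k`. -/
noncomputable def firstReturn {Ω S : Type*} (Z : ℕ → Ω → S) (c : S) (l k : ℕ) : Set Ω :=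
  {ω | Z (l + 1 + k) ω = c ∧ ∀ i < k, Z (l + 1 + i) ω ≠ c}

/-- The sum of `k + 1` consecutive marks after time `l`. -/
noncomputable def blockSum {Ω : Type*} (X : ℕ → Ω → ℝ) (l k : ℕ) (ω : Ω) : ℝ :=
  ∑ i ∈ Finset.range (k + 1), X (l + 1 + i) ω

/-- The law of a sum of `k + 1` independent variables of law `η`. -/
noncomputable def blockLaw (η : Measure ℝ) : ℕ → Measure ℝ
  | 0 => η
  | k + 1 => (blockLaw η k).conv η

open Classical in
/-- Probability that the chain with transition matrix `P` started at `z` first visits `c`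
(at a positive time) after `k + 1` steps. -/
noncomputable def hitProb {S : Type*} [Fintype S] (P : Matrix S S ℝ) (c : S) : ℕ → S → ENNReal
  | 0, z => ENNReal.ofReal (P z c)
  | k + 1, z => ∑ w with w ≠ c, ENNReal.ofReal (P z w) * hitProb P c k w

/-- The law of the gap between two visits to `c`. -/
noncomputable def gapLaw {S : Type*} [Fintype S] (P : Matrix S S ℝ) (η : Measure ℝ) (c : S) : Measure ℝ :=
  Measure.sum fun k => hitProb P c k c • blockLaw η k

/-- Evaluation of a sequence of measurable functions at a measurable random index. -/
lemma measurable_eval_index {Ω : Type*} [MeasurableSpace Ω] {f : ℕ → Ω → ℝ} {N : Ω → ℕ}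
    (hf : ∀ n, Measurable (f n)) (hN : Measurable N) : Measurable fun ω => f (N ω) ω :=
  (measurable_from_prod_countable_right (f := fun p : ℕ × Ω => f p.1 p.2) hf).comp
    (hN.prodMk measurable_id)

lemma measurable_sInf_nat {Ω : Type*} [MeasurableSpace Ω] {p : ℕ → Ω → Prop}
    (hp : ∀ m, MeasurableSet {ω | p m ω}) : Measurable fun ω => sInf {m | p m ω} := by
  refine measurable_to_countable' fun n => ?_
  -- Since `sInf ∅ = 0` in ℕ, the fibre over 0 also contains the event that `p` never holds.
  have : (fun ω => sInf {m | p m ω}) ⁻¹' {n} =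
      ({ω | p n ω} ∩ ⋂ i, ⋂ _ : i < n, {ω | p i ω}ᶜ) ∪
        ({_ω | n = 0} ∩ ⋂ i, {ω | p i ω}ᶜ) := by
    ext ω
    simp only [Set.mem_preimage, Set.mem_singleton_iff, Set.mem_union, Set.mem_inter_iff,
      Set.mem_iInter, Set.mem_compl_iff, Set.mem_ofPred_eq]
    constructor
    · intro h
      by_cases hne : {m | p m ω}.Nonempty
      · left
        refine ⟨h ▸ Nat.sInf_mem hne, fun i hi => ?_⟩
        exact Nat.notMem_of_lt_sInf (h ▸ hi)
      · right
        rw [Set.not_nonempty_iff_eq_empty] at hne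
        refine ⟨by rw [← h, hne, Nat.sInf_empty], fun i hi => ?_⟩
        exact (hne ▸ (show i ∈ {m | p m ω} from hi) : i ∈ (∅ : Set ℕ))
    · rintro (⟨h1, h2⟩ | ⟨rfl, h2⟩)
      · refine le_antisymm (Nat.sInf_le h1) ?_
        by_contra! hlt
        exact h2 _ hlt (Nat.sInf_mem (s := {m | p m ω}) ⟨n, h1⟩)
      · rw [show {m | p m ω} = ∅ from Set.eq_empty_of_forall_notMem h2, Nat.sInf_empty]
  rw [this]
  exact ((hp n).inter (MeasurableSet.iInter fun i => MeasurableSet.iInter fun _ => (hp i).compl)).union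
    ((MeasurableSet.const _).inter (MeasurableSet.iInter fun i => (hp i).compl))

/-! ### Return times and gaps along a fixed path -/

section Pathwise

variable {Ω S : Type*} {X : ℕ → Ω → ℝ} {Z : ℕ → Ω → S} {c : S}

lemma blockSum_eq (l k : ℕ) (ω : Ω) :
    blockSum X l k ω = arrivalTime X (l + 1 + k + 1) ω - arrivalTime X (l + 1) ω := by
  rw [blockSum, arrivalTime, arrivalTime, add_assoc (l + 1), Finset.sum_range_add _ (l + 1),
    add_sub_cancel_left]

lemma nextVisit_eq {l m : ℕ} {ω : Ω} (hlm : l < m) (hm : Z m ω = c)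
    (h : ∀ i, l < i → i < m → Z i ω ≠ c) : nextVisit Z c l ω = m := by
  refine le_antisymm (Nat.sInf_le ⟨hlm, hm⟩) ?_
  by_contra! hlt
  have := Nat.sInf_mem (s := {m | l < m ∧ Z m ω = c}) ⟨m, hlm, hm⟩
  exact h _ this.1 hlt this.2

lemma gap_eq_of_consecutive {l m : ℕ} {ω : Ω} (hlm : l < m) (hm : Z m ω = c)
    (h : ∀ i, l < i → i < m → Z i ω ≠ c) :
    gap X Z c l ω = arrivalTime X (m + 1) ω - arrivalTime X (l + 1) ω := by
  rw [gap, nextVisit_eq hlm hm h]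

lemma gap_eq_blockSum {l k : ℕ} {ω : Ω} (h : ω ∈ firstReturn Z c l k) :
    gap X Z c l ω = blockSum X l k ω := by
  rw [gap_eq_of_consecutive (m := l + 1 + k) (by omega) h.1 fun i h1 h2 => ?_, blockSum_eq]
  have := h.2 (i - (l + 1)) (by omega)
  rwa [show l + 1 + (i - (l + 1)) = i by omega] at this

lemma firstReturn_disjoint (Z : ℕ → Ω → S) (c : S) (l : ℕ) :
    Pairwise (Function.onFun Disjoint (firstReturn Z c l)) := by
  intro j k hjk
  refine Set.disjoint_left.2 fun ω h1 h2 => ?_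
  rcases lt_or_gt_of_ne hjk with h | h
  · exact h2.2 j h h1.1
  · exact h1.2 k h h2.1

lemma exists_mem_firstReturn {l m : ℕ} {ω : Ω} (hlm : l < m) (hm : Z m ω = c) :
    ∃ k < m - l, ω ∈ firstReturn Z c l k := by
  classical
  have hex : ∃ k, Z (l + 1 + k) ω = c := ⟨m - (l + 1), by rwa [show l + 1 + (m - (l + 1)) = m by omega]⟩
  refine ⟨Nat.find hex, ?_, Nat.find_spec hex, fun i hi => Nat.find_min hex hi⟩
  have : Nat.find hex ≤ m - (l + 1) :=
    Nat.find_min' hex (by rwa [show l + 1 + (m - (l + 1)) = m by omega])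
  omega

lemma firstReturn_succ (l k : ℕ) :
    firstReturn Z c l (k + 1) = {ω | Z (l + 1) ω ≠ c} ∩ firstReturn Z c (l + 1) k := by
  ext ω
  simp only [firstReturn, Set.mem_inter_iff, Set.mem_ofPred_eq]
  constructor
  · rintro ⟨h1, h2⟩
    refine ⟨by simpa using h2 0 (by omega), by rwa [show l + 1 + 1 + k = l + 1 + (k + 1) by omega],
      fun i hi => ?_⟩
    rw [show l + 1 + 1 + i = l + 1 + (i + 1) by omega]
    exact h2 (i + 1) (by omega)
  · rintro ⟨h1, h2, h3⟩
    refine ⟨by rwa [show l + 1 + (k + 1) = l + 1 + 1 + k by omega], fun i hi => ?_⟩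
    rcases i with _ | i
    · exact h1
    · rw [show l + 1 + (i + 1) = l + 1 + 1 + i by omega]
      exact h3 i (by omega)

lemma measurableSet_firstReturn_pastAlg {l k m : ℕ} (h : l + 1 + k ≤ m) :
    MeasurableSet[pastAlg X Z m] (firstReturn Z c l k) := by
  have : firstReturn Z c l k = {ω | Z (l + 1 + k) ω ∈ ({c} : Set S)} ∩
      ⋂ i, ⋂ _ : i < k, {ω | Z (l + 1 + i) ω ∈ ({c}ᶜ : Set S)} := by
    ext ω; simp [firstReturn]
  rw [this]
  refine @MeasurableSet.inter _ (pastAlg X Z m) _ _ (measurableSet_pastAlg h _) ?_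
  refine @MeasurableSet.iInter _ _ (pastAlg X Z m) _ _ fun i =>
    @MeasurableSet.iInter _ _ (pastAlg X Z m) _ _ fun hi => measurableSet_pastAlg (by omega) _

lemma measurable_blockSum_pastAlg {l k m : ℕ} (h : l + 1 + k ≤ m) :
    Measurable[pastAlg X Z m] (blockSum X l k) :=
  Finset.measurable_sum _ fun i hi =>
    measurable_pastAlg (by have := Finset.mem_range.1 hi; omega)

end Pathwise

/-! ### The law of a gap and its independence of the past -/

namespace IsMarkedChain

variable {Ω S : Type*} [MeasurableSpace Ω] [Fintype S] {μ : Measure Ω} {X : ℕ → Ω → ℝ}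
  {Z : ℕ → Ω → S} {P : Matrix S S ℝ} {η : Measure ℝ} {c : S}

lemma measurable_arrivalTime (hZ : IsMarkedChain μ X Z P η) (n : ℕ) :
    Measurable (arrivalTime X n) :=
  Finset.measurable_sum _ fun i _ => hZ.measurable_X i

lemma measurable_gap (hZ : IsMarkedChain μ X Z P η) (c : S) (l : ℕ) :
    Measurable (gap X Z c l) := by
  refine Measurable.sub (measurable_eval_index (f := fun n => arrivalTime X (n + 1))
    (fun n => hZ.measurable_arrivalTime _) ?_) (hZ.measurable_arrivalTime _)
  exact measurable_sInf_nat fun m => (MeasurableSet.const _).inter (hZ.measurableSet_label m {c})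

lemma measurableSet_firstReturn (hZ : IsMarkedChain μ X Z P η) (c : S) (l k : ℕ) :
    MeasurableSet (firstReturn Z c l k) :=
  hZ.pastAlg_le _ _ (measurableSet_firstReturn_pastAlg (X := X) le_rfl)

lemma measurable_blockSum (hZ : IsMarkedChain μ X Z P η) (l k : ℕ) :
    Measurable (blockSum X l k) :=
  Finset.measurable_sum _ fun _ _ => hZ.measurable_X _

variable [IsProbabilityMeasure μ]

lemma isProbabilityMeasure_law (hZ : IsMarkedChain μ X Z P η) : IsProbabilityMeasure η := by
  rw [← hZ.map_X 0]
  exact Measure.isProbabilityMeasure_map (hZ.measurable_X 0).aemeasurable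

/-- The marks after time `l` are independent of the states and marks up to time `l`. -/
lemma indep_future_past (hZ : IsMarkedChain μ X Z P η) (l : ℕ) :
    Indep (markAlg X (Set.Ioi l)) (pastAlg X Z l) μ := by
  refine (Indep_iff _ _ _).2 fun W G hW hG => ?_
  have hW' := hZ.markAlg_le _ _ hW
  have hG' := hZ.pastAlg_le _ _ hG
  have hXX : Indep (markAlg X (Set.Ioi l)) (markAlg X (Set.Iic l)) μ :=
    indep_iSup_of_disjoint (fun i => (hZ.measurable_X i).comap_le) hZ.indep_X.iIndep
      (Set.disjoint_left.2 fun i h1 h2 => not_lt.2 (Set.mem_Iic.1 h2) h1)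
  have hle : ∀ s, markAlg X s ≤ ⨆ n, MeasurableSpace.comap (X n) inferInstance :=
    fun s => iSup₂_le fun i _ => le_iSup (fun n => MeasurableSpace.comap (X n) inferInstance) i
  have hXZ := (Indep_iff _ _ μ).1 hZ.indep_X_Z
  -- With the future event `W` fixed, it suffices to test past mark events against past label
  -- events: marks are split from labels by `indep_X_Z`, and future marks from past marks by `hXX`.
  have key := measure_eq_of_inter (hZ.markAlg_le (Set.Iic l)) (hZ.labelAlg_le l)
    (ν₁ := μ.restrict W) (ν₂ := μ W • μ) (fun A B hA hB => ?_) hG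
  · rw [Measure.restrict_apply hG', Measure.smul_apply, smul_eq_mul] at key
    rw [Set.inter_comm, key]
  · have hAB := (hZ.markAlg_le _ _ hA).inter (hZ.labelAlg_le l _ hB)
    rw [Measure.restrict_apply hAB, Measure.smul_apply, smul_eq_mul,
      hXZ A B (hle _ _ hA) (labelAlg_le_iSup l _ hB),
      show A ∩ B ∩ W = (W ∩ A) ∩ B by rw [Set.inter_comm, ← Set.inter_assoc],
      hXZ (W ∩ A) B (MeasurableSet.inter (hle _ _ hW) (hle _ _ hA)) (labelAlg_le_iSup l _ hB),
      (Indep_iff _ _ μ).1 hXX W A hW hA, mul_assoc]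

/-- Each new mark is independent of the earlier ones, so a step of the induction is one convolution.
The law does not depend on the starting time `l`. -/
lemma map_blockSum (hZ : IsMarkedChain μ X Z P η) (l k : ℕ) :
    μ.map (blockSum X l k) = blockLaw η k := by
  induction k with
  | zero =>
    have : blockSum X l 0 = X (l + 1) := by ext ω; simp [blockSum]
    rw [this, hZ.map_X, blockLaw]
  | succ k ih =>
    have e : blockSum X l (k + 1) = blockSum X l k + X (l + 1 + (k + 1)) := by
      ext ω
      simp [blockSum, Finset.sum_range_succ]
    have hind : IndepFun (blockSum X l k) (X (l + 1 + (k + 1))) μ := by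
      have h1 : Indep (markAlg X (Set.Ioi (l + 1 + k))) (markAlg X (Set.Iic (l + 1 + k))) μ :=
        indep_of_indep_of_le_right (hZ.indep_future_past _) le_sup_left
      refine (IndepFun_iff_Indep _ _ _).2 (indep_of_indep_of_le h1.symm ?_ ?_)
      · refine Measurable.comap_le (Finset.measurable_sum _ fun i hi => measurable_markAlg ?_)
        have := Finset.mem_range.1 hi
        exact Set.mem_Iic.2 (by omega)
      · exact Measurable.comap_le (measurable_markAlg (Set.mem_Ioi.2 (by omega)))
    rw [e, hind.map_add_eq_map_conv_map (hZ.measurable_blockSum l k) (hZ.measurable_X _), ih,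
      hZ.map_X, blockLaw]

lemma isProbabilityMeasure_blockLaw (hZ : IsMarkedChain μ X Z P η) (k : ℕ) :
    IsProbabilityMeasure (blockLaw η k) := by
  rw [← hZ.map_blockSum 0]
  exact Measure.isProbabilityMeasure_map (hZ.measurable_blockSum 0 k).aemeasurable

/-- One absolutely continuous factor makes a convolution absolutely continuous. This excludes atoms
of the gap law. -/
lemma blockLaw_absolutelyContinuous (hZ : IsMarkedChain μ X Z P η) (hη : η ≪ volume) (k : ℕ) :
    blockLaw η k ≪ volume := by
  have := hZ.isProbabilityMeasure_law
  induction k with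
  | zero => exact hη
  | succ k ih =>
    have := hZ.isProbabilityMeasure_blockLaw k
    exact Measure.conv_absolutelyContinuous hη

/-- The gap law has no atoms. -/
lemma gapLaw_singleton (hZ : IsMarkedChain μ X Z P η) (hη : η ≪ volume) (c : S) (x : ℝ) :
    gapLaw P η c {x} = 0 := by
  rw [gapLaw, Measure.sum_apply _ (measurableSet_singleton x)]
  simp [hZ.blockLaw_absolutelyContinuous hη _ (measure_singleton (μ := (volume : Measure ℝ)) x)]

/-- The first return time is independent of the past and of the marks, given the current state. -/
lemma measure_inter_firstReturn (hZ : IsMarkedChain μ X Z P η) (k : ℕ) :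
    ∀ {l : ℕ} {G : Set Ω}, MeasurableSet[markedPastAlg X Z l] G → ∀ w,
    μ (G ∩ {ω | Z l ω = w} ∩ firstReturn Z c l k) =
      μ (G ∩ {ω | Z l ω = w}) * hitProb P c k w := by
  classical
  induction k with
  | zero =>
    intro l G hG w
    have : firstReturn Z c l 0 = {ω | Z (l + 1) ω = c} := by ext ω; simp [firstReturn]
    rw [this, hZ.measure_inter_step hG, hitProb]
  | succ k ih =>
    intro l G hG w
    set G' := G ∩ {ω | Z l ω = w} with hG'
    have hGm : MeasurableSet[markedPastAlg X Z l] G' :=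
      @MeasurableSet.inter _ (markedPastAlg X Z l) _ _ hG (measurableSet_markedPastAlg le_rfl {w})
    have hGm' := markedPastAlg_mono l.le_succ _ hGm
    -- Split according to the next state `z ≠ c`. The event `G'` serves as a past event at time l +
    -- 1 in the induction hypothesis, which explains why `l` and `G` are universally quantified.
    have e : G' ∩ firstReturn Z c l (k + 1) = ⋃ z ∈ Finset.univ.filter fun z => z ≠ c,
        G' ∩ {ω | Z (l + 1) ω = z} ∩ firstReturn Z c (l + 1) k := by
      ext ω
      rw [firstReturn_succ]
      simp only [Set.mem_inter_iff, Set.mem_iUnion, Finset.mem_filter, Finset.mem_univ, true_and,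
        exists_prop, Set.mem_ofPred_eq]
      constructor
      · rintro ⟨h1, h2, h3⟩
        exact ⟨_, h2, ⟨h1, rfl⟩, h3⟩
      · rintro ⟨z, hz, ⟨h1, rfl⟩, h3⟩
        exact ⟨h1, hz, h3⟩
    rw [e, measure_biUnion_finset]
    · rw [hitProb, Finset.mul_sum]
      refine Finset.sum_congr rfl fun z _ => ?_
      rw [ih hGm' z, hG', hZ.measure_inter_step hG, mul_assoc]
    · intro z _ z' _ hzz
      refine Set.disjoint_left.2 fun ω h1 h2 => hzz (h1.1.2.symm.trans h2.1.2)
    · intro z _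
      exact ((hZ.markedPastAlg_le _ _ hGm).inter (hZ.measurableSet_label _ {z})).inter
        (hZ.measurableSet_firstReturn c _ k)

/-- The return time is independent of all marks given the current state, so the condition on the
block of marks can first be counted as part of the past. Afterwards these future marks are separated
from the true past by independence. -/
lemma measure_inter_firstReturn_blockSum (hZ : IsMarkedChain μ X Z P η) {l : ℕ} {G : Set Ω}
    (hG : MeasurableSet[pastAlg X Z l] G) (k : ℕ) {B : Set ℝ} (hB : MeasurableSet B) :
    μ (G ∩ {ω | Z l ω = c} ∩ (firstReturn Z c l k ∩ blockSum X l k ⁻¹' B)) =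
      μ (G ∩ {ω | Z l ω = c}) * (hitProb P c k c * blockLaw η k B) := by
  have hGc : MeasurableSet[pastAlg X Z l] (G ∩ {ω | Z l ω = c}) :=
    @MeasurableSet.inter _ (pastAlg X Z l) _ _ hG (measurableSet_pastAlg le_rfl {c})
  have hS : MeasurableSet[markAlg X (Set.Ioi l)] (blockSum X l k ⁻¹' B) := by
    have : Measurable[markAlg X (Set.Ioi l)] (blockSum X l k) :=
      Finset.measurable_sum _ fun i _ => measurable_markAlg (Set.mem_Ioi.2 (by omega))
    exact this hB
  have hG' : MeasurableSet[markedPastAlg X Z l] (G ∩ blockSum X l k ⁻¹' B) :=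
    @MeasurableSet.inter _ (markedPastAlg X Z l) _ _ (pastAlg_le_markedPastAlg l _ hG)
      (((markAlg_mono (Set.subset_univ _)).trans le_sup_left : markAlg X (Set.Ioi l) ≤ _) _ hS)
  have h1 := hZ.measure_inter_firstReturn (c := c) k hG' c
  have h2 := (Indep_iff _ _ μ).1 (hZ.indep_future_past l) _ _ hS hGc
  rw [show G ∩ {ω | Z l ω = c} ∩ (firstReturn Z c l k ∩ blockSum X l k ⁻¹' B) =
    G ∩ blockSum X l k ⁻¹' B ∩ {ω | Z l ω = c} ∩ firstReturn Z c l k by ext ω; simp; tauto, h1,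
    show G ∩ blockSum X l k ⁻¹' B ∩ {ω | Z l ω = c} =
      blockSum X l k ⁻¹' B ∩ (G ∩ {ω | Z l ω = c}) by ext ω; simp; tauto, h2,
    ← Measure.map_apply (hZ.measurable_blockSum l k) hB, hZ.map_blockSum]
  ring

/-- A recurrent chain with an irreducible transition matrix visits every state infinitely often. -/
lemma ae_exists_visit (hZ : IsMarkedChain μ X Z P η) (hP : P.IsIrreducible) {π : S → ℝ}
    (hπ : π ∈ stdSimplex ℝ S) (hπP : Matrix.vecMul π P = π) (c : S) :
    ∀ᵐ ω ∂μ, ∀ l, ∃ m, l < m ∧ Z m ω = c := by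
  classical
  filter_upwards [hZ.ae_tendsto_frequency hP hπ hπP] with ω hω l
  by_contra! h
  have h0 : Tendsto (fun n : ℕ =>
      (∑ l ∈ Finset.range n, if Z l ω = c then (1 : ℝ) else 0) / n) atTop (𝓝 0) := by
    refine tendsto_div_of_abs_sub_le (t := fun _ => 0) (K := l + 1) (fun n => ?_) (by simp)
    rw [sub_zero, abs_of_nonneg (Finset.sum_nonneg fun _ _ => by positivity), Finset.sum_boole]
    have : (Finset.range n).filter (fun m => Z m ω = c) ⊆ Finset.range (l + 1) := by
      intro m hm
      by_contra hlt
      exact h m (by simpa using hlt) (Finset.mem_filter.1 hm).2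
    exact_mod_cast (Finset.card_le_card this).trans (by simp)
  have := tendsto_nhds_unique h0 (by convert hω c)
  exact (stationary_pos hP hπ hπP c).ne this

/-- Given the past and a current visit to `c`, the next gap has the gap law. -/
lemma measure_inter_gap (hZ : IsMarkedChain μ X Z P η)
    (hrec : ∀ᵐ ω ∂μ, ∀ l, ∃ m, l < m ∧ Z m ω = c) {l : ℕ} {G : Set Ω}
    (hG : MeasurableSet[pastAlg X Z l] G) {B : Set ℝ} (hB : MeasurableSet B) :
    μ (G ∩ {ω | Z l ω = c} ∩ gap X Z c l ⁻¹' B) = μ (G ∩ {ω | Z l ω = c}) * gapLaw P η c B := by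
  -- Decomposition by the length of the return, where the gap is an ordinary block sum. Recurrence
  -- makes the pieces cover everything up to a null set.
  have h1 : (G ∩ {ω | Z l ω = c} ∩ gap X Z c l ⁻¹' B : Set Ω) =ᵐ[μ]
      ⋃ k, G ∩ {ω | Z l ω = c} ∩ (firstReturn Z c l k ∩ blockSum X l k ⁻¹' B) := by
    refine eventuallyEq_set.2 ?_
    filter_upwards [hrec] with ω hω
    obtain ⟨m, hm, hmc⟩ := hω l
    obtain ⟨k, -, hk⟩ := exists_mem_firstReturn hm hmc
    simp only [Set.mem_inter_iff, Set.mem_iUnion, Set.mem_preimage]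
    constructor
    · rintro ⟨h1, h2⟩
      exact ⟨k, h1, hk, by rwa [← gap_eq_blockSum hk]⟩
    · rintro ⟨j, h1, h2, h3⟩
      exact ⟨h1, by rwa [gap_eq_blockSum h2]⟩
  rw [measure_congr h1, measure_iUnion, gapLaw, Measure.sum_apply _ hB, ← ENNReal.tsum_mul_left]
  · exact tsum_congr fun k => hZ.measure_inter_firstReturn_blockSum hG k hB
  · exact fun j k hjk => (firstReturn_disjoint Z c l hjk).mono
      (Set.inter_subset_right.trans Set.inter_subset_left)
      (Set.inter_subset_right.trans Set.inter_subset_left)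
  · exact fun k => ((hZ.pastAlg_le l _ hG).inter (hZ.measurableSet_label l {c})).inter
      ((hZ.measurableSet_firstReturn c l k).inter (hZ.measurable_blockSum l k hB))

/-- Recurrence provides a time at which `c` is visited with positive probability; the total mass is
then read off from `measure_inter_gap` with the whole line as target set. -/
lemma isProbabilityMeasure_gapLaw (hZ : IsMarkedChain μ X Z P η)
    (hrec : ∀ᵐ ω ∂μ, ∀ l, ∃ m, l < m ∧ Z m ω = c) : IsProbabilityMeasure (gapLaw P η c) := by
  obtain ⟨l, hl⟩ : ∃ l, μ {ω | Z l ω = c} ≠ 0 := by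
    by_contra! h
    have h0 : ∀ᵐ ω ∂μ, ∀ l, Z l ω ≠ c := ae_all_iff.2 fun l => by
      rw [ae_iff]; simpa using h l
    have : ∀ᵐ ω ∂μ, False := by
      filter_upwards [h0, hrec] with ω h1 h2
      obtain ⟨m, -, hm⟩ := h2 0
      exact h1 m hm
    exact this.exists.elim fun _ h => h
  have := hZ.measure_inter_gap hrec (l := l) (G := Set.univ) (@MeasurableSet.univ _ (pastAlg X Z l))
    MeasurableSet.univ
  rw [Set.preimage_univ, Set.inter_univ, Set.univ_inter] at this
  refine ⟨?_⟩
  exact ((ENNReal.mul_eq_left hl (measure_ne_top _ _)).1 this.symm)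

/-- The gap following the first visit has the gap law. -/
lemma map_gap_firstVisit (hZ : IsMarkedChain μ X Z P η)
    (hrec : ∀ᵐ ω ∂μ, ∀ l, ∃ m, l < m ∧ Z m ω = c) :
    μ.map (fun ω => gap X Z c (firstVisit Z c ω) ω) = gapLaw P η c := by
  have hmeas : Measurable fun ω => gap X Z c (firstVisit Z c ω) ω :=
    measurable_eval_index (hZ.measurable_gap c)
      (measurable_sInf_nat fun m => hZ.measurableSet_label m {c})
  -- The first visit takes place at `l` on `G l ∩ {Z l = c}`, an event of the past at `l`. Every
  -- such piece contributes the same gap law, and their probabilities add up to 1.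
  set G : ℕ → Set Ω := fun l => {ω | ∀ i < l, Z i ω ≠ c} with hGdef
  have hG : ∀ l, MeasurableSet[pastAlg X Z l] (G l) := by
    intro l
    have : G l = ⋂ i, ⋂ _ : i < l, {ω | Z i ω ∈ ({c}ᶜ : Set S)} := by ext ω; simp [hGdef]
    rw [this]
    exact @MeasurableSet.iInter _ _ (pastAlg X Z l) _ _ fun i =>
      @MeasurableSet.iInter _ _ (pastAlg X Z l) _ _ fun hi => measurableSet_pastAlg hi.le _
  have hGc : ∀ l, MeasurableSet (G l ∩ {ω | Z l ω = c}) := fun l =>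
    (hZ.pastAlg_le l _ (hG l)).inter (hZ.measurableSet_label l {c})
  have hdisj : Pairwise (Function.onFun Disjoint fun l => G l ∩ {ω | Z l ω = c}) := by
    intro j k hjk
    refine Set.disjoint_left.2 fun ω h1 h2 => ?_
    rcases lt_or_gt_of_ne hjk with h | h
    · exact h2.1 j h h1.2
    · exact h1.1 k h h2.2
  have hfv : ∀ l ω, ω ∈ G l ∩ {ω | Z l ω = c} → firstVisit Z c ω = l := by
    intro l ω h
    refine le_antisymm (Nat.sInf_le h.2) ?_
    by_contra! hlt
    exact h.1 _ hlt (Nat.sInf_mem (s := {m | Z m ω = c}) ⟨l, h.2⟩)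
  have hcover : ∀ᵐ ω ∂μ, ∃ l, ω ∈ G l ∩ {ω | Z l ω = c} := by
    filter_upwards [hrec] with ω hω
    obtain ⟨m, -, hm⟩ := hω 0
    exact ⟨firstVisit Z c ω, fun i hi => Nat.notMem_of_lt_sInf (s := {m | Z m ω = c}) hi,
      Nat.sInf_mem (s := {m | Z m ω = c}) ⟨m, hm⟩⟩
  have hone : ∑' l, μ (G l ∩ {ω | Z l ω = c}) = 1 := by
    rw [← measure_iUnion hdisj hGc, prob_compl_eq_zero_iff (MeasurableSet.iUnion hGc) |>.1]
    rw [← mem_ae_iff]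
    filter_upwards [hcover] with ω hω
    exact Set.mem_iUnion.2 hω
  ext B hB
  rw [Measure.map_apply hmeas hB]
  have h1 : ((fun ω => gap X Z c (firstVisit Z c ω) ω) ⁻¹' B : Set Ω) =ᵐ[μ]
      ⋃ l, G l ∩ {ω | Z l ω = c} ∩ gap X Z c l ⁻¹' B := by
    refine eventuallyEq_set.2 ?_
    filter_upwards [hcover] with ω ⟨l, hl⟩
    simp only [Set.mem_preimage, Set.mem_iUnion]
    constructor
    · intro h
      exact ⟨l, hl, by simpa [hfv l ω hl] using h⟩
    · rintro ⟨j, h2, h3⟩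
      rw [hfv j ω h2]
      exact h3
  rw [measure_congr h1, measure_iUnion (fun j k hjk => (hdisj hjk).mono Set.inter_subset_left
    Set.inter_subset_left) fun l => (hGc l).inter (hZ.measurable_gap c l hB)]
  simp_rw [hZ.measure_inter_gap hrec (hG _) hB]
  rw [ENNReal.tsum_mul_right, hone, one_mul]

end IsMarkedChain

/-! ### Strong laws for gaps selected by the past -/

namespace IsMarkedChain

variable {Ω S : Type*} [MeasurableSpace Ω] [Fintype S] {μ : Measure Ω} {X : ℕ → Ω → ℝ}
  {Z : ℕ → Ω → S} {P : Matrix S S ℝ} {η : Measure ℝ} {c : S} [IsProbabilityMeasure μ]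

open Classical in
/-- Law of large numbers for the gaps following the visits to `c`, with weights depending on the
past. -/
lemma ae_tendsto_weighted_gap (hZ : IsMarkedChain μ X Z P η)
    (hrec : ∀ᵐ ω ∂μ, ∀ l, ∃ m, l < m ∧ Z m ω = c) {U : ℕ → Ω → ℝ} {φ : ℝ → ℝ} {M : ℝ}
    (hU : ∀ l, Measurable[pastAlg X Z l] fun ω => if Z l ω = c then U l ω else 0)
    (hUb : ∀ l ω, |U l ω| ≤ 1) (hφ : Measurable φ) (hφb : ∀ x, |φ x| ≤ M) :
    ∀ᵐ ω ∂μ, Tendsto (fun n : ℕ => (∑ l ∈ Finset.range n, if Z l ω = c then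
      U l ω * (φ (gap X Z c l ω) - ∫ x, φ x ∂(gapLaw P η c)) else 0) / n) atTop (𝓝 0) := by
  have := hZ.isProbabilityMeasure_gapLaw hrec
  set I := ∫ x, φ x ∂(gapLaw P η c) with hI
  have hM : 0 ≤ M := (abs_nonneg _).trans (hφb 0)
  have hIb : |I| ≤ M := by
    have := norm_integral_le_of_norm_le_const (μ := gapLaw P η c) (f := φ) (ae_of_all _ hφb)
    simpa using this
  set V : ℕ → Ω → ℝ := fun l ω => if Z l ω = c then U l ω else 0 with hV
  have hVb : ∀ l ω, |V l ω| ≤ 1 := fun l ω => by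
    simp only [hV]
    split_ifs
    · exact hUb l ω
    · simp
  set δ : ℕ → Ω → ℝ := fun l ω => φ (gap X Z c l ω) - I with hδ
  have hδm : ∀ l, Measurable (δ l) := fun l => (hφ.comp (hZ.measurable_gap c l)).sub_const _
  have hδb : ∀ l ω, |δ l ω| ≤ 2 * M := fun l ω => by
    refine (abs_sub _ _).trans ?_
    linarith [hφb (gap X Z c l ω)]
  have hVm : ∀ l, Measurable (V l) := fun l => (hU l).mono (hZ.pastAlg_le l) le_rfl
  have key := ae_tendsto_average_zero_of_orthogonal (μ := μ) (ξ := fun l ω => V l ω * δ l ω)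
    (M := 2 * M) (fun l => (hVm l).mul (hδm l)) (fun l ω => by
      rw [abs_mul]
      calc |V l ω| * |δ l ω| ≤ 1 * (2 * M) :=
            mul_le_mul (hVb l ω) (hδb l ω) (abs_nonneg _) zero_le_one
        _ = 2 * M := one_mul _) (fun l m hlm => ?_)
  · filter_upwards [key] with ω hω
    refine hω.congr fun n => ?_
    simp only [hV, hδ, ite_mul, zero_mul]
  -- The gap after `l` need not be known at time `m`. If `Z m = c`, however, the return has occurred
  -- within m - l steps, and `g` is a version of `φ` of the gap that only looks at the past of `m`.
  · set g : Ω → ℝ := fun ω => ∑ k ∈ Finset.range (m - l),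
      (firstReturn Z c l k).indicator (fun ω => φ (blockSum X l k ω)) ω with hg
    have hgm : Measurable[pastAlg X Z m] g :=
      Finset.measurable_sum _ fun k hk => by
        have hk' := Finset.mem_range.1 hk
        exact (hφ.comp (measurable_blockSum_pastAlg (by omega))).indicator
          (measurableSet_firstReturn_pastAlg (by omega))
    have hgeq : ∀ ω, Z m ω = c → φ (gap X Z c l ω) = g ω := by
      intro ω hω
      obtain ⟨k, hk, hkr⟩ := exists_mem_firstReturn hlm hω
      simp only [hg]
      rw [Finset.sum_eq_single_of_mem k (Finset.mem_range.2 hk), Set.indicator_of_mem hkr,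
        gap_eq_blockSum hkr]
      intro j _ hjk
      refine Set.indicator_of_notMem (fun hj => ?_) _
      exact Set.disjoint_left.1 (firstReturn_disjoint Z c l hjk) hj hkr
    -- The factor `V m` vanishes unless `Z m = c`, so the values of `g` off that event are
    -- irrelevant; it also keeps `H` bounded.
    set H : Ω → ℝ := fun ω => V l ω * (g ω - I) * V m ω with hH
    have hHm : Measurable[pastAlg X Z m] H :=
      (((hU l).mono (pastAlg_mono hlm.le) le_rfl).mul (hgm.sub_const I)).mul (hU m)
    have hHeq : ∀ ω, V l ω * δ l ω * (V m ω * δ m ω) =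
        H ω * (if Z m ω = c then δ m ω else 0) := by
      intro ω
      by_cases hω : Z m ω = c
      · simp only [hH, hδ, hgeq ω hω, hω, if_true]
        ring
      · simp [hV, hH, hω]
    have hHb : ∀ ω, |H ω| ≤ 2 * M := by
      intro ω
      by_cases hω : Z m ω = c
      · simp only [hH, ← hgeq ω hω, abs_mul]
        have h1 := hVb l ω
        have h2 := hVb m ω
        have h3 := hδb l ω
        calc |V l ω| * |φ (gap X Z c l ω) - I| * |V m ω| ≤ 1 * (2 * M) * 1 := by
              gcongr
        _ = 2 * M := by ring
      · simp [hH, hV, hω, hM]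
    simp_rw [hHeq]
    have hc : MeasurableSet {ω | Z m ω = c} := hZ.measurableSet_label m {c}
    refine integral_mul_eq_zero_of_setIntegral (M := 2 * M) (hZ.pastAlg_le m) hHm hHb
      (Measurable.ite hc (hδm m) measurable_const) (fun ω => ?_) fun G hG => ?_
    · split_ifs
      · exact hδb m ω
      · simpa using hM
    · have hG' := hZ.pastAlg_le m _ hG
      have e : (fun ω => if Z m ω = c then δ m ω else 0) = {ω | Z m ω = c}.indicator (δ m) := by
        ext ω; simp [Set.indicator_apply]
      rw [e, integral_indicator hc, Measure.restrict_restrict hc, Set.inter_comm]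
      have hmap : (μ.restrict (G ∩ {ω | Z m ω = c})).map (gap X Z c m) =
          μ (G ∩ {ω | Z m ω = c}) • gapLaw P η c := by
        ext B hB
        rw [Measure.map_apply (hZ.measurable_gap c m) hB,
          Measure.restrict_apply (hZ.measurable_gap c m hB), Measure.smul_apply, smul_eq_mul,
          ← hZ.measure_inter_gap hrec hG hB, Set.inter_comm]
      have hint : ∫ ω in G ∩ {ω | Z m ω = c}, φ (gap X Z c m ω) ∂μ =
          (μ (G ∩ {ω | Z m ω = c})).toReal * I := by
        rw [← integral_map (hZ.measurable_gap c m).aemeasurable hφ.aestronglyMeasurable, hmap,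
          integral_smul_measure, smul_eq_mul]
      rw [integral_sub _ (integrable_const _), hint]
      · simp [measureReal_def]
      · exact Integrable.of_bound (hφ.comp (hZ.measurable_gap c m)).aestronglyMeasurable M
          (ae_of_all _ fun ω => hφb _)

open Classical in
/-- Law of large numbers for the gaps following the visits to `c`. -/
lemma ae_tendsto_gap (hZ : IsMarkedChain μ X Z P η)
    (hrec : ∀ᵐ ω ∂μ, ∀ l, ∃ m, l < m ∧ Z m ω = c) {p : ℝ}
    (hfreq : ∀ᵐ ω ∂μ, Tendsto (fun n : ℕ =>
      (∑ l ∈ Finset.range n, if Z l ω = c then (1 : ℝ) else 0) / n) atTop (𝓝 p))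
    {φ : ℝ → ℝ} {M : ℝ} (hφ : Measurable φ) (hφb : ∀ x, |φ x| ≤ M) :
    ∀ᵐ ω ∂μ, Tendsto (fun n : ℕ => (∑ l ∈ Finset.range n, if Z l ω = c then
      φ (gap X Z c l ω) else 0) / n) atTop (𝓝 (p * ∫ x, φ x ∂(gapLaw P η c))) := by
  have h1 := hZ.ae_tendsto_weighted_gap hrec (U := fun _ _ => 1) (fun l =>
    Measurable.ite (measurableSet_pastAlg le_rfl {c}) measurable_const measurable_const)
    (by simp) hφ hφb
  filter_upwards [h1, hfreq] with ω h1 h2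
  have h3 := h1.add (h2.mul_const (∫ x, φ x ∂(gapLaw P η c)))
  rw [zero_add] at h3
  refine h3.congr fun n => ?_
  rw [div_mul_eq_mul_div, ← add_div, Finset.sum_mul, ← Finset.sum_add_distrib]
  congr 1
  refine Finset.sum_congr rfl fun l _ => ?_
  split_ifs <;> ring

open Classical in
/-- Law of large numbers for functions of the gaps that are selected by a flag which, at each visit
to `c`, tells whether the preceding gap was less than `θ`. -/
lemma ae_tendsto_flagged_gap (hZ : IsMarkedChain μ X Z P η)
    (hrec : ∀ᵐ ω ∂μ, ∀ l, ∃ m, l < m ∧ Z m ω = c) {p : ℝ}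
    (hfreq : ∀ᵐ ω ∂μ, Tendsto (fun n : ℕ =>
      (∑ l ∈ Finset.range n, if Z l ω = c then (1 : ℝ) else 0) / n) atTop (𝓝 p))
    {D : ℕ → Ω → Prop} (hD : ∀ l, MeasurableSet[pastAlg X Z l] {ω | Z l ω = c ∧ D l ω}) {θ : ℝ}
    (hstep : ∀ᵐ ω ∂μ, ∀ l m, l < m → Z l ω = c → Z m ω = c →
      (∀ i, l < i → i < m → Z i ω ≠ c) → (D m ω ↔ gap X Z c l ω < θ))
    {φ₁ φ₂ : ℝ → ℝ} {M : ℝ} (hφ₁ : Measurable φ₁) (hφ₁b : ∀ x, |φ₁ x| ≤ M)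
    (hφ₂ : Measurable φ₂) (hφ₂b : ∀ x, |φ₂ x| ≤ M) :
    ∀ᵐ ω ∂μ, Tendsto (fun n : ℕ => (∑ l ∈ Finset.range n, if Z l ω = c then
      (if D l ω then φ₁ (gap X Z c l ω) else φ₂ (gap X Z c l ω)) else 0) / n) atTop
      (𝓝 (p * ((gapLaw P η c).real (Set.Iio θ) * ∫ x, φ₁ x ∂(gapLaw P η c) +
        (1 - (gapLaw P η c).real (Set.Iio θ)) * ∫ x, φ₂ x ∂(gapLaw P η c)))) := by
  set I₁ := ∫ x, φ₁ x ∂(gapLaw P η c) with hI₁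
  set I₂ := ∫ x, φ₂ x ∂(gapLaw P η c) with hI₂
  set r := (gapLaw P η c).real (Set.Iio θ) with hr
  have hU₁ : ∀ l, Measurable[pastAlg X Z l] fun ω =>
      if Z l ω = c then (if D l ω then (1 : ℝ) else 0) else 0 := fun l => by
    simp_rw [← ite_and]
    exact Measurable.ite (hD l) measurable_const measurable_const
  have hU₂ : ∀ l, Measurable[pastAlg X Z l] fun ω =>
      if Z l ω = c then (if D l ω then (0 : ℝ) else 1) else 0 := fun l => by
    have h1 : Measurable[pastAlg X Z l] fun ω => if Z l ω = c then (1 : ℝ) else 0 :=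
      Measurable.ite (measurableSet_pastAlg le_rfl {c}) measurable_const measurable_const
    convert h1.sub (hU₁ l) using 2 with ω
    simp only [Pi.sub_apply]
    split_ifs <;> simp
  have hIio : Measurable ((Set.Iio θ).indicator fun _ : ℝ => (1 : ℝ)) :=
    measurable_const.indicator measurableSet_Iio
  have hflag := hZ.ae_tendsto_gap hrec hfreq hIio (M := 1)
    (fun x => by by_cases h : x ∈ Set.Iio θ <;> simp [h])
  rw [integral_indicator_const _ measurableSet_Iio, smul_eq_mul, mul_one] at hflag
  filter_upwards [hZ.ae_tendsto_weighted_gap hrec hU₁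
      (fun l ω => by split_ifs <;> simp) hφ₁ hφ₁b,
    hZ.ae_tendsto_weighted_gap hrec hU₂ (fun l ω => by split_ifs <;> simp) hφ₂ hφ₂b,
    hfreq, hflag, hstep] with ω h1 h2 h3 h4 h5
  -- The flag at a visit is the event that the preceding gap was below `θ`. Moving it back to the
  -- preceding visit turns its frequency into that of short gaps.
  have h6 : Tendsto (fun n : ℕ => (∑ l ∈ Finset.range n, if Z l ω = c then
      (if D l ω then (1 : ℝ) else 0) else 0) / n) atTop (𝓝 (p * r)) := by
    refine tendsto_div_of_abs_sub_le (fun n => abs_sum_sub_sum_le_of_consecutive (M := 1)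
      (V := fun l => Z l ω = c) (fun m => by split_ifs <;> simp)
      (fun m => ?_) (fun l m hlm hl hm hc => ?_) n) h4
    · by_cases h : gap X Z c m ω ∈ Set.Iio θ <;> simp [h]
    · rw [Set.indicator_apply]
      exact if_congr (h5 l m hlm hl hm hc) rfl rfl
  -- With D the indicator of the flag, each summand is D (φ₁ - I₁) + (1 - D) (φ₂ - I₂) + D (I₁ - I₂)
  -- + I₂; the first two terms average to zero.
  have h7 := ((h1.add h2).add (h6.mul_const (I₁ - I₂))).add (h3.mul_const I₂)
  rw [show 0 + 0 + p * r * (I₁ - I₂) + p * I₂ = p * (r * I₁ + (1 - r) * I₂) by ring] at h7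
  refine h7.congr fun n => ?_
  rw [div_mul_eq_mul_div, div_mul_eq_mul_div, ← add_div, ← add_div, ← add_div, Finset.sum_mul,
    Finset.sum_mul, ← Finset.sum_add_distrib, ← Finset.sum_add_distrib, ← Finset.sum_add_distrib]
  congr 1
  refine Finset.sum_congr rfl fun l _ => ?_
  split_ifs <;> ring

end IsMarkedChain

/-! ### Timers -/

namespace Timers

/-- Remaining time in the cache. -/
noncomputable def rem (ψ : Timers) : ℝ := max (max ψ.deep ψ.shallow) 0

lemma rem_nonneg (ψ : Timers) : 0 ≤ ψ.rem := le_max_right _ _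

lemma rem_zero : (0 : Timers).rem = 0 := by
  change max (max (0 : ℝ) 0) 0 = 0
  simp

lemma inCache_iff (ψ : Timers) : ψ.InCache ↔ 0 < ψ.rem := by
  simp only [InCache, rem, lt_max_iff, lt_irrefl, or_false]

lemma rem_age (ψ : Timers) {x : ℝ} (hx : 0 ≤ x) : (ψ.age x).rem = max (ψ.rem - x) 0 := by
  simp only [rem, age]
  rw [← max_sub_sub_right, ← max_sub_sub_right, ← max_max_max_comm, max_self, max_assoc, max_self,
    max_assoc _ (0 - x), max_eq_right (by linarith : 0 - x ≤ 0)]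

lemma age_age (ψ : Timers) (x : ℝ) {y : ℝ} (hy : 0 ≤ y) : (ψ.age x).age y = ψ.age (x + y) := by
  have h : ∀ d : ℝ, max (max (d - x) 0 - y) 0 = max (d - (x + y)) 0 := fun d => by
    rw [← max_sub_sub_right, max_assoc, max_eq_right (by linarith : 0 - y ≤ 0), sub_sub]
  simp only [age, h]

lemma age_zero {x : ℝ} (hx : 0 ≤ x) : (0 : Timers).age x = 0 := by
  have : max (0 - x) 0 = 0 := max_eq_right (by linarith)
  change Timers.mk (max (0 - x) 0) (max (0 - x) 0) (max (0 - x) 0) = ⟨0, 0, 0⟩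
  rw [this]

/-- The object or its metadata is stored. -/
def Present (ψ : Timers) : Prop := ψ.InCache ∨ ψ.OnlyMetadata

lemma not_present_zero : ¬ (0 : Timers).Present := by
  change ¬ ((0 < (0 : ℝ) ∨ 0 < (0 : ℝ)) ∨ (¬ (0 < (0 : ℝ) ∨ 0 < (0 : ℝ)) ∧ 0 < (0 : ℝ)))
  simp

open Classical in
lemma onRequest_eq (θ θs : ℝ) (ψ : Timers) :
    ψ.onRequest θ θs = if ψ.Present then ⟨θ, 0, 0⟩ else ⟨0, θs, θ⟩ := by
  unfold onRequest Present
  congr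

open Classical in
lemma rem_onRequest {θ θs : ℝ} (hθ : 0 ≤ θ) (hθs : 0 ≤ θs) (ψ : Timers) :
    (ψ.onRequest θ θs).rem = if ψ.Present then θ else θs := by
  rw [onRequest_eq]
  split_ifs <;> simp [rem, hθ, hθs]

/-- After a hit or virtual hit the deep timer runs for `θ`; after a miss the shadow timer does, and
it outlasts the shallow timer because `θs ≤ θ`. Either way presence lasts exactly `θ`, so the
previous state `ψ` drops out. -/
lemma present_age_onRequest {θ θs x : ℝ} (hs : θs ≤ θ) (ψ : Timers) (hx : 0 ≤ x) :
    ((ψ.onRequest θ θs).age x).Present ↔ x < θ := by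
  rw [onRequest_eq]
  split_ifs
  · simp [Present, InCache, OnlyMetadata, age, hx]
  · simp only [Present, InCache, OnlyMetadata, age, lt_max_iff, lt_irrefl, or_false, sub_pos,
      zero_sub, Left.neg_pos_iff, not_lt.2 hx, false_or]
    constructor
    · rintro (h | h)
      exacts [h.trans_le hs, h.2]
    · intro h
      by_cases h' : x < θs
      exacts [Or.inl h', Or.inr ⟨h', h⟩]

end Timers

/-! ### Evolution of the timers between requests -/

section Pathwise

variable {Ω κ τ ρ : Type*} {C : Catalog κ τ ρ} {θ θs : τ → ℝ} {ψ₀ : κ ⊕ ρ → Timers}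
  {X : ℕ → Ω → ℝ} {obj : ℕ → Ω → κ ⊕ ρ} {ω : Ω}

lemma arrivalTime_succ (n : ℕ) : arrivalTime X (n + 1) ω = arrivalTime X n ω + X n ω :=
  Finset.sum_range_succ _ _

lemma arrivalTime_zero : arrivalTime X 0 ω = 0 := Finset.sum_range_zero _

lemma arrivalTime_mono (hX : ∀ n, 0 ≤ X n ω) : Monotone fun n => arrivalTime X n ω :=
  monotone_nat_of_le_succ fun n => by rw [arrivalTime_succ]; linarith [hX n]

lemma requestCount_eq (hX : ∀ n, 0 ≤ X n ω) {n : ℕ} {u : ℝ} (h1 : arrivalTime X n ω ≤ u)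
    (h2 : u < arrivalTime X (n + 1) ω) : requestCount X ω u = n := by
  have : {i : ℕ | arrivalTime X (i + 1) ω ≤ u} = Set.Iio n := by
    ext i
    simp only [Set.mem_ofPred_eq, Set.mem_Iio]
    constructor
    · intro h
      by_contra! hi
      exact absurd (h2.trans_le (arrivalTime_mono hX (Nat.succ_le_succ hi))) (not_lt.2 h)
    · intro hi
      exact (arrivalTime_mono hX (Nat.succ_le_of_lt hi)).trans h1
  rw [requestCount, this, Set.ncard_eq_toFinset_card']
  simp

/-- Every nonnegative time lies between two consecutive arrivals. -/
lemma exists_arrival_interval (hA : Tendsto (fun n => arrivalTime X n ω) atTop atTop)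
    {u : ℝ} (hu : 0 ≤ u) : ∃ n, arrivalTime X n ω ≤ u ∧ u < arrivalTime X (n + 1) ω := by
  classical
  have hex : ∃ n, u < arrivalTime X (n + 1) ω :=
    ((hA.comp (tendsto_add_atTop_nat 1)).eventually_gt_atTop u).exists
  refine ⟨Nat.find hex, ?_, Nat.find_spec hex⟩
  rcases h : Nat.find hex with _ | k
  · rwa [arrivalTime_zero]
  · exact not_lt.1 (Nat.find_min hex (by omega : k < Nat.find hex))

lemma tendsto_requestCount (hX : ∀ n, 0 ≤ X n ω)
    (hA : Tendsto (fun n => arrivalTime X n ω) atTop atTop) :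
    Tendsto (requestCount X ω) atTop atTop := by
  refine tendsto_atTop.2 fun n => ?_
  filter_upwards [eventually_ge_atTop (max 0 (arrivalTime X n ω))] with u hu
  obtain ⟨m, hm1, hm2⟩ := exists_arrival_interval hA ((le_max_left _ _).trans hu)
  rw [requestCount_eq hX hm1 hm2]
  by_contra! hlt
  exact absurd (hm2.trans_le (arrivalTime_mono hX (Nat.succ_le_of_lt hlt)))
    (not_lt.2 ((le_max_right _ _).trans hu))

/-- Either no request before `n` was for `c`, or there is a last one. -/
lemma exists_last_request {V : ℕ → Prop} (n : ℕ) :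
    (∀ i < n, ¬ V i) ∨ ∃ l < n, V l ∧ ∀ i, l < i → i < n → ¬ V i := by
  induction n with
  | zero => left; simp
  | succ n ih =>
    by_cases hn : V n
    · exact Or.inr ⟨n, n.lt_succ_self, hn, fun i h1 h2 => by omega⟩
    · rcases ih with h | ⟨l, hl, hV, h⟩
      · exact Or.inl fun i hi => by
          rcases Nat.lt_succ_iff_lt_or_eq.1 hi with h' | rfl
          exacts [h i h', hn]
      · refine Or.inr ⟨l, by omega, hV, fun i h1 h2 => ?_⟩
        rcases Nat.lt_succ_iff_lt_or_eq.1 h2 with h' | rfl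
        exacts [h i h1 h', hn]

/-- The request renews an object that is in the cache or whose metadata is stored. -/
def Renewal (C : Catalog κ τ ρ) (θ θs : τ → ℝ) (ψ₀ : κ ⊕ ρ → Timers) (X : ℕ → Ω → ℝ)
    (obj : ℕ → Ω → κ ⊕ ρ) (n : ℕ) (ω : Ω) : Prop :=
  (timersAtRequest C θ θs ψ₀ X obj n ω).Present

open Classical in
/-- The TTL assigned to the object requested by the `n`-th request. -/
noncomputable def assignedTTL (C : Catalog κ τ ρ) (θ θs : τ → ℝ) (ψ₀ : κ ⊕ ρ → Timers)
    (X : ℕ → Ω → ℝ) (obj : ℕ → Ω → κ ⊕ ρ) (n : ℕ) (ω : Ω) : ℝ :=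
  if Renewal C θ θs ψ₀ X obj n ω then θ (C.typ (obj n ω)) else θs (C.typ (obj n ω))

lemma timersAfter_succ_self (n : ℕ) :
    timersAfter C θ θs ψ₀ X obj ω (n + 1) (obj n ω) =
      (timersAtRequest C θ θs ψ₀ X obj n ω).onRequest (θ (C.typ (obj n ω)))
        (θs (C.typ (obj n ω))) := by
  simp [timersAfter, timersAtRequest]

lemma timersAfter_succ_of_ne {n : ℕ} {c : κ ⊕ ρ} (h : obj n ω ≠ c) :
    timersAfter C θ θs ψ₀ X obj ω (n + 1) c =
      (timersAfter C θ θs ψ₀ X obj ω n c).age (X n ω) := by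
  simp [timersAfter, h.symm]

lemma rem_timersAfter_succ_self (hθ : ∀ t, 0 ≤ θ t) (hθs : ∀ t, 0 ≤ θs t) (n : ℕ) :
    (timersAfter C θ θs ψ₀ X obj ω (n + 1) (obj n ω)).rem =
      assignedTTL C θ θs ψ₀ X obj n ω := by
  rw [timersAfter_succ_self, Timers.rem_onRequest (hθ _) (hθs _)]
  rfl

/-- An object that is not requested just ages. -/
lemma age_timersAfter_add (hX : ∀ n, 0 ≤ X n ω) {l k : ℕ} {c : κ ⊕ ρ}
    (h : ∀ i, l ≤ i → i < l + k → obj i ω ≠ c) :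
    (timersAfter C θ θs ψ₀ X obj ω (l + k) c).age (X (l + k) ω) =
      (timersAfter C θ θs ψ₀ X obj ω l c).age
        (arrivalTime X (l + k + 1) ω - arrivalTime X l ω) := by
  induction k with
  | zero => simp [arrivalTime_succ]
  | succ k ih =>
    rw [← add_assoc, timersAfter_succ_of_ne (h (l + k) (by omega) (by omega)),
      ih fun i h1 h2 => h i h1 (by omega), Timers.age_age _ _ (hX _),
      arrivalTime_succ (l + k + 1)]
    congr 1
    ring

lemma timersAtRequest_of_consecutive (hX : ∀ n, 0 ≤ X n ω) {l m : ℕ} (hlm : l < m)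
    (hobj : obj l ω = obj m ω) (h : ∀ i, l < i → i < m → obj i ω ≠ obj m ω) :
    timersAtRequest C θ θs ψ₀ X obj m ω =
      ((timersAtRequest C θ θs ψ₀ X obj l ω).onRequest (θ (C.typ (obj l ω)))
        (θs (C.typ (obj l ω)))).age (arrivalTime X (m + 1) ω - arrivalTime X (l + 1) ω) := by
  obtain ⟨k, rfl⟩ : ∃ k, m = l + 1 + k := ⟨m - (l + 1), by omega⟩
  rw [timersAtRequest, age_timersAfter_add hX fun i h1 h2 => h i (by omega) h2, ← hobj,
    timersAfter_succ_self]

lemma timersAtRequest_of_first (hX : ∀ n, 0 ≤ X n ω) {m : ℕ}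
    (h : ∀ i < m, obj i ω ≠ obj m ω) :
    timersAtRequest C θ θs ψ₀ X obj m ω = (ψ₀ (obj m ω)).age (arrivalTime X (m + 1) ω) := by
  have := age_timersAfter_add (C := C) (θ := θ) (θs := θs) (ψ₀ := ψ₀) hX (l := 0) (k := m)
    (c := obj m ω) fun i _ h2 => h i (by omega)
  simp only [zero_add, arrivalTime_zero, sub_zero] at this
  exact this

section Consecutive

variable (hX : ∀ n, 0 ≤ X n ω) {l m : ℕ} (hlm : l < m) (hobj : obj l ω = obj m ω)
  (h : ∀ i, l < i → i < m → obj i ω ≠ obj m ω)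

include hX hlm hobj h

lemma rem_timersAtRequest_of_consecutive (hθ : ∀ t, 0 ≤ θ t) (hθs : ∀ t, 0 ≤ θs t) :
    (timersAtRequest C θ θs ψ₀ X obj m ω).rem = max (assignedTTL C θ θs ψ₀ X obj l ω -
      (arrivalTime X (m + 1) ω - arrivalTime X (l + 1) ω)) 0 := by
  have h0 : 0 ≤ arrivalTime X (m + 1) ω - arrivalTime X (l + 1) ω :=
    sub_nonneg.2 (arrivalTime_mono hX (by omega))
  rw [timersAtRequest_of_consecutive hX hlm hobj h, Timers.rem_age _ h0, ← timersAfter_succ_self,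
    rem_timersAfter_succ_self hθ hθs]

lemma hit_iff_of_consecutive (hθ : ∀ t, 0 ≤ θ t) (hθs : ∀ t, 0 ≤ θs t) :
    Hit C θ θs ψ₀ X obj m ω ↔ arrivalTime X (m + 1) ω - arrivalTime X (l + 1) ω <
      assignedTTL C θ θs ψ₀ X obj l ω := by
  rw [Hit, Timers.inCache_iff, rem_timersAtRequest_of_consecutive hX hlm hobj h hθ hθs]
  simp

/-- In contrast to a hit, whose threshold is the TTL assigned at `l`, a renewal has a threshold free
of the cache state: the memory reaches back one gap only. -/
lemma renewal_iff_of_consecutive (hs : ∀ t, θs t ≤ θ t) :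
    Renewal C θ θs ψ₀ X obj m ω ↔
      arrivalTime X (m + 1) ω - arrivalTime X (l + 1) ω < θ (C.typ (obj m ω)) := by
  have h0 : 0 ≤ arrivalTime X (m + 1) ω - arrivalTime X (l + 1) ω :=
    sub_nonneg.2 (arrivalTime_mono hX (by omega))
  rw [Renewal, timersAtRequest_of_consecutive hX hlm hobj h,
    Timers.present_age_onRequest (hs _) _ h0, hobj]

end Consecutive

/-- A renewal is either a request shortly after an earlier one for the same object, or the first
request for an object present at time `0`. -/
lemma exists_of_renewal (hX : ∀ n, 0 ≤ X n ω) (hs : ∀ t, θs t ≤ θ t) {n : ℕ}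
    (hR : Renewal C θ θs ψ₀ X obj n ω) :
    (∃ m < n, obj m ω = obj n ω ∧
      arrivalTime X (n + 1) ω - arrivalTime X (m + 1) ω < θ (C.typ (obj n ω))) ∨
    (ψ₀ (obj n ω) ≠ 0 ∧ ∀ i < n, obj i ω ≠ obj n ω) := by
  rcases exists_last_request (V := fun i => obj i ω = obj n ω) n with h | ⟨l, hl, hV, h⟩
  · refine Or.inr ⟨fun h0 => ?_, h⟩
    have hA : 0 ≤ arrivalTime X (n + 1) ω := by
      simpa [arrivalTime_zero] using arrivalTime_mono hX (Nat.zero_le (n + 1))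
    rw [Renewal, timersAtRequest_of_first hX h, h0, Timers.age_zero hA] at hR
    exact Timers.not_present_zero hR
  · exact Or.inl ⟨l, hl, hV, (renewal_iff_of_consecutive hX hl hV h hs).1 hR⟩

/-- The remaining time in the cache comes from the initial state or from an earlier request. -/
lemma rem_timersAfter_le (hX : ∀ n, 0 ≤ X n ω) (hθs : ∀ t, 0 ≤ θs t)
    (hs : ∀ t, θs t ≤ θ t) {R : ℝ} (hR : ∀ t, θ t ≤ R) (c : κ ⊕ ρ) (n : ℕ) :
    (timersAfter C θ θs ψ₀ X obj ω n c).rem ≤ (ψ₀ c).rem ∨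
      ∃ l < n, obj l ω = c ∧ (timersAfter C θ θs ψ₀ X obj ω n c).rem ≤
        max (R - (arrivalTime X n ω - arrivalTime X (l + 1) ω)) 0 := by
  have hθ : ∀ t, 0 ≤ θ t := fun t => (hθs t).trans (hs t)
  induction n with
  | zero => exact Or.inl le_rfl
  | succ n ih =>
    by_cases hn : obj n ω = c
    · subst hn
      refine Or.inr ⟨n, n.lt_succ_self, rfl, ?_⟩
      rw [rem_timersAfter_succ_self hθ hθs, sub_self, sub_zero]
      refine le_max_of_le_left ?_
      unfold assignedTTL
      split_ifs
      exacts [hR _, (hs _).trans (hR _)]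
    · rw [timersAfter_succ_of_ne hn, Timers.rem_age _ (hX n)]
      rcases ih with ih | ⟨l, hl, hc, ih⟩
      · refine Or.inl (max_le ?_ (Timers.rem_nonneg _))
        linarith [hX n]
      · refine Or.inr ⟨l, by omega, hc, max_le ?_ (le_max_right _ _)⟩
        rw [arrivalTime_succ]
        have := hX n
        rcases le_max_iff.1 ih with h | h
        · exact le_max_of_le_left (by linarith)
        · exact le_max_of_le_right (by linarith)

end Pathwise

/-! ### The time integral of the cache size -/

/-- The integral of the indicator of `s < a + r` over `[a, v]`. -/
lemma intervalIntegral_indicator_lt {a v r : ℝ} (hav : a ≤ v) (hr : 0 ≤ r) :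
    ∫ s in a..v, (Set.Iio (a + r)).indicator (fun _ => (1 : ℝ)) s = min (v - a) r := by
  rw [intervalIntegral.integral_of_le hav, integral_indicator_const _ measurableSet_Iio,
    smul_eq_mul, mul_one, measureReal_restrict_apply measurableSet_Iio]
  rcases lt_or_ge v (a + r) with h | h
  · rw [show Set.Iio (a + r) ∩ Set.Ioc a v = Set.Ioc a v from
      Set.inter_eq_right.2 fun s hs => hs.2.trans_lt h, Real.volume_real_Ioc_of_le hav,
      min_eq_left (by linarith)]
  · rw [show Set.Iio (a + r) ∩ Set.Ioc a v = Set.Ioo a (a + r) by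
      ext s
      simp only [Set.mem_inter_iff, Set.mem_Iio, Set.mem_Ioc, Set.mem_Ioo]
      exact ⟨fun h => ⟨h.2.1, h.1⟩, fun h' => ⟨h'.2, h'.1, h'.2.le.trans h⟩⟩,
      Real.volume_real_Ioo_of_le (by linarith), min_eq_right (by linarith)]
    ring

section Pathwise

variable {Ω κ τ ρ : Type*} {C : Catalog κ τ ρ} {θ θs : τ → ℝ} {ψ₀ : κ ⊕ ρ → Timers}
  {X : ℕ → Ω → ℝ} {obj : ℕ → Ω → κ ⊕ ρ} {ω : Ω}

open Classical in
/-- Indicator of the presence of an object in the cache at time `s`. -/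
noncomputable def occupancy (C : Catalog κ τ ρ) (θ θs : τ → ℝ) (ψ₀ : κ ⊕ ρ → Timers)
    (X : ℕ → Ω → ℝ) (obj : ℕ → Ω → κ ⊕ ρ) (ω : Ω) (c : κ ⊕ ρ) (s : ℝ) : ℝ :=
  if (timersAt C θ θs ψ₀ X obj ω s c).InCache then 1 else 0

-- Between two arrivals the object is only ageing, so within the segment it is in the cache exactly
-- before its remaining lifetime runs out.
open Classical in
lemma integral_occupancy_segment (hX : ∀ n, 0 ≤ X n ω) (c : κ ⊕ ρ) {n : ℕ} {v : ℝ}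
    (h1 : arrivalTime X n ω ≤ v) (h2 : v ≤ arrivalTime X (n + 1) ω) :
    IntervalIntegrable (occupancy C θ θs ψ₀ X obj ω c) volume (arrivalTime X n ω) v ∧
    ∫ s in arrivalTime X n ω..v, occupancy C θ θs ψ₀ X obj ω c s =
      min (v - arrivalTime X n ω) (timersAfter C θ θs ψ₀ X obj ω n c).rem := by
  set a := arrivalTime X n ω
  set r := (timersAfter C θ θs ψ₀ X obj ω n c).rem
  have hind : IntervalIntegrable ((Set.Iio (a + r)).indicator (fun _ => (1 : ℝ))) volume a v :=
    ⟨(integrable_const 1).indicator measurableSet_Iio,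
      (integrable_const 1).indicator measurableSet_Iio⟩
  have hae : ∀ᵐ s ∂volume, s ∈ Set.uIoc a v →
      (Set.Iio (a + r)).indicator (fun _ => (1 : ℝ)) s = occupancy C θ θs ψ₀ X obj ω c s := by
    -- The endpoint `v` may be the next arrival, where the request count jumps; a single point is
    -- negligible.
    have hne : ∀ᵐ s ∂(volume : Measure ℝ), s ≠ v := by simp [ae_iff]
    filter_upwards [hne] with s hsv hs
    rw [Set.uIoc_of_le h1] at hs
    have hsv' : s < v := lt_of_le_of_ne hs.2 hsv
    rw [occupancy, timersAt, requestCount_eq hX hs.1.le (hsv'.trans_le h2)]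
    rw [Set.indicator_apply]
    refine if_congr ?_ rfl rfl
    rw [Timers.inCache_iff, Timers.rem_age _ (sub_nonneg.2 hs.1.le), Set.mem_Iio]
    simp only [lt_max_iff, lt_irrefl, or_false, sub_pos]
    exact sub_lt_iff_lt_add'.symm
  refine ⟨hind.congr_ae ?_, ?_⟩
  · rw [EventuallyEq, ae_restrict_iff' measurableSet_uIoc]
    exact hae
  · rw [← intervalIntegral.integral_congr_ae hae,
      intervalIntegral_indicator_lt h1 (Timers.rem_nonneg _)]

open Classical in
/-- Time integral of the occupancy of the cache by one object, by a potential argument. -/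
lemma integral_occupancy_arrivalTime (hX : ∀ n, 0 ≤ X n ω) (hθ : ∀ t, 0 ≤ θ t)
    (hθs : ∀ t, 0 ≤ θs t) (c : κ ⊕ ρ) (n : ℕ) :
    IntervalIntegrable (occupancy C θ θs ψ₀ X obj ω c) volume 0 (arrivalTime X n ω) ∧
    ∫ s in (0 : ℝ)..arrivalTime X n ω, occupancy C θ θs ψ₀ X obj ω c s =
      (ψ₀ c).rem - (timersAfter C θ θs ψ₀ X obj ω n c).rem +
        ∑ k ∈ Finset.range n, if obj k ω = c then assignedTTL C θ θs ψ₀ X obj k ω -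
          (timersAtRequest C θ θs ψ₀ X obj k ω).rem else 0 := by
  induction n with
  | zero => simp [arrivalTime_zero, timersAfter]
  | succ n ih =>
    obtain ⟨h1, h2⟩ := integral_occupancy_segment (C := C) (θ := θ) (θs := θs) (ψ₀ := ψ₀)
      (obj := obj) hX c (n := n) (v := arrivalTime X (n + 1) ω)
      (arrivalTime_mono hX n.le_succ) le_rfl
    refine ⟨ih.1.trans h1, ?_⟩
    rw [← intervalIntegral.integral_add_adjacent_intervals ih.1 h1, ih.2, h2,
      Finset.sum_range_succ, arrivalTime_succ, add_sub_cancel_left]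
    -- The time spent in the cache during a segment equals the drop of the remaining lifetime. A
    -- request then resets that lifetime from its leftover to the assigned TTL, which is the term
    -- added to the sum.
    have key : ∀ x r : ℝ, min x r = r - max (r - x) 0 := fun x r => by
      rcases le_total x r with h | h
      · rw [min_eq_left h, max_eq_left (by linarith)]; ring
      · rw [min_eq_right h, max_eq_right (by linarith)]; ring
    rw [key, ← Timers.rem_age _ (hX n)]
    by_cases hn : obj n ω = c
    · subst hn
      rw [if_pos rfl, rem_timersAfter_succ_self hθ hθs, timersAtRequest]
      ring
    · rw [if_neg hn, timersAfter_succ_of_ne hn]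
      ring

-- After the last arrival before `u` the object stays in the cache for at most its current remaining
-- lifetime, so the potential at the two ends bounds the error.
open Classical in
lemma integral_occupancy (hX : ∀ n, 0 ≤ X n ω) (hθ : ∀ t, 0 ≤ θ t)
    (hθs : ∀ t, 0 ≤ θs t) (c : κ ⊕ ρ) {n : ℕ} {u : ℝ} (h1 : arrivalTime X n ω ≤ u)
    (h2 : u < arrivalTime X (n + 1) ω) :
    IntervalIntegrable (occupancy C θ θs ψ₀ X obj ω c) volume 0 u ∧
    |(∫ s in (0 : ℝ)..u, occupancy C θ θs ψ₀ X obj ω c s) -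
      ∑ k ∈ Finset.range n, (if obj k ω = c then assignedTTL C θ θs ψ₀ X obj k ω -
          (timersAtRequest C θ θs ψ₀ X obj k ω).rem else 0)| ≤
      (ψ₀ c).rem + (timersAfter C θ θs ψ₀ X obj ω n c).rem := by
  obtain ⟨h3, h4⟩ := integral_occupancy_arrivalTime (C := C) (θ := θ) (θs := θs) (ψ₀ := ψ₀)
    (obj := obj) hX hθ hθs c n
  obtain ⟨h5, h6⟩ := integral_occupancy_segment (C := C) (θ := θ) (θs := θs) (ψ₀ := ψ₀)
    (obj := obj) hX c h1 h2.le
  refine ⟨h3.trans h5, ?_⟩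
  rw [← intervalIntegral.integral_add_adjacent_intervals h3 h5, h4, h6]
  have h7 := Timers.rem_nonneg (ψ₀ c)
  have h8 := Timers.rem_nonneg (timersAfter C θ θs ψ₀ X obj ω n c)
  have h9 : 0 ≤ u - arrivalTime X n ω := sub_nonneg.2 h1
  have h10 := min_le_right (u - arrivalTime X n ω) (timersAfter C θ θs ψ₀ X obj ω n c).rem
  have h11 := le_min h9 h8
  rw [abs_le]
  constructor <;> linarith

/-- The objects that can have nonzero timers after `n` requests. -/
lemma timersAfter_eq_zero (hX : ∀ n, 0 ≤ X n ω) {c : κ ⊕ ρ} (h0 : ψ₀ c = 0) {n : ℕ}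
    (h : ∀ i < n, obj i ω ≠ c) : timersAfter C θ θs ψ₀ X obj ω n c = 0 := by
  induction n with
  | zero => exact h0
  | succ n ih =>
    rw [timersAfter_succ_of_ne (h n n.lt_succ_self), ih fun i hi => h i (by omega),
      Timers.age_zero (hX n)]

open Classical in
/-- The time integral of the cache size differs from the sum of the contributions of the requests
by at most the potentials at both ends. -/
lemma abs_integral_cacheSize_sub_le (hX : ∀ n, 0 ≤ X n ω) (hθ : ∀ t, 0 ≤ θ t)
    (hθs : ∀ t, 0 ≤ θs t) (t : τ) {n : ℕ} {u : ℝ} (hu : 0 ≤ u) (h1 : arrivalTime X n ω ≤ u)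
    (h2 : u < arrivalTime X (n + 1) ω) {F : Finset (κ ⊕ ρ)} (hF₀ : ∀ c, ψ₀ c ≠ 0 → c ∈ F)
    (hF : ∀ i < n, obj i ω ∈ F) (hsize : ∀ c, 0 ≤ C.size c)
    (hA : Tendsto (fun n => arrivalTime X n ω) atTop atTop) :
    |(∫ s in (0 : ℝ)..u, cacheSize C θ θs ψ₀ X obj t ω s) -
      ∑ k ∈ Finset.range n, (if C.typ (obj k ω) = t then C.size (obj k ω) *
        (assignedTTL C θ θs ψ₀ X obj k ω -
          (timersAtRequest C θ θs ψ₀ X obj k ω).rem) else 0)| ≤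
      ∑ c ∈ F, C.size c * ((ψ₀ c).rem + (timersAfter C θ θs ψ₀ X obj ω n c).rem) := by
  set Ft := F.filter fun c => C.typ c = t with hFt
  -- Until time `u` only objects of `F`, initially stored or already requested, can be in the cache,
  -- so the `finsum` is a sum over a fixed finite set and may be exchanged with the integral.
  have hcache : ∀ s ∈ Set.uIcc 0 u, cacheSize C θ θs ψ₀ X obj t ω s =
      ∑ c ∈ Ft, C.size c * occupancy C θ θs ψ₀ X obj ω c s := by
    intro s hs
    rw [Set.uIcc_of_le hu] at hs
    obtain ⟨m, hm1, hm2⟩ := exists_arrival_interval hA hs.1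
    have hmn : m ≤ n := by
      by_contra! hlt
      have := arrivalTime_mono hX (Nat.succ_le_of_lt hlt)
      simp only [Nat.succ_eq_add_one] at this
      linarith [hs.2]
    have hset : {c : κ ⊕ ρ | C.typ c = t ∧ (timersAt C θ θs ψ₀ X obj ω s c).InCache} =
        ↑(Ft.filter fun c => (timersAt C θ θs ψ₀ X obj ω s c).InCache) := by
      ext c
      simp only [hFt, Finset.coe_filter, Finset.mem_filter, Set.mem_ofPred_eq]
      refine ⟨fun h => ⟨⟨?_, h.1⟩, h.2⟩, fun h => ⟨h.1.2, h.2⟩⟩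
      by_contra hc
      have h0 : ψ₀ c = 0 := by
        by_contra h0
        exact hc (hF₀ c h0)
      have h3 := h.2
      rw [timersAt, requestCount_eq hX hm1 hm2, timersAfter_eq_zero hX h0
        (fun i hi hi' => hc (hi' ▸ hF i (by omega))), Timers.age_zero (sub_nonneg.2 hm1),
        Timers.inCache_iff, Timers.rem_zero] at h3
      exact lt_irrefl _ h3
    rw [cacheSize, hset, finsum_mem_coe_finset, Finset.sum_filter]
    refine Finset.sum_congr rfl fun c _ => ?_
    simp [occupancy]
  have hocc := fun c => integral_occupancy (C := C) (θ := θ) (θs := θs) (ψ₀ := ψ₀)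
    (obj := obj) hX hθ hθs c h1 h2
  rw [intervalIntegral.integral_congr hcache,
    intervalIntegral.integral_finsetSum fun c _ => (hocc c).1.const_mul _]
  simp_rw [intervalIntegral.integral_const_mul]
  have hsum : ∑ k ∈ Finset.range n, (if C.typ (obj k ω) = t then C.size (obj k ω) *
        (assignedTTL C θ θs ψ₀ X obj k ω -
          (timersAtRequest C θ θs ψ₀ X obj k ω).rem) else 0) =
      ∑ c ∈ Ft, C.size c * ∑ k ∈ Finset.range n, (if obj k ω = c then
        assignedTTL C θ θs ψ₀ X obj k ω - (timersAtRequest C θ θs ψ₀ X obj k ω).rem else 0) := by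
    simp_rw [Finset.mul_sum]
    rw [Finset.sum_comm]
    refine Finset.sum_congr rfl fun k hk => ?_
    simp only [mul_ite, mul_zero]
    rw [Finset.sum_ite_eq]
    exact if_congr (by simp [hFt, hF k (Finset.mem_range.1 hk)]) rfl rfl
  rw [hsum, ← Finset.sum_sub_distrib]
  calc _ ≤ ∑ c ∈ Ft, C.size c * ((ψ₀ c).rem + (timersAfter C θ θs ψ₀ X obj ω n c).rem) := by
        refine (Finset.abs_sum_le_sum_abs _ _).trans (Finset.sum_le_sum fun c _ => ?_)
        rw [← mul_sub, abs_mul, abs_of_nonneg (hsize c)]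
        exact mul_le_mul_of_nonneg_left (hocc c).2 (hsize c)
    _ ≤ _ := Finset.sum_le_sum_of_subset_of_nonneg (Finset.filter_subset _ _) fun c _ _ =>
        mul_nonneg (hsize c) (add_nonneg (Timers.rem_nonneg _) (Timers.rem_nonneg _))

open Classical in
/-- The potential after `n` requests is controlled by the number of recent requests. -/
lemma sum_size_mul_rem_le (hX : ∀ n, 0 ≤ X n ω)
    (hθs : ∀ t, 0 ≤ θs t) (hs : ∀ t, θs t ≤ θ t) {R W : ℝ} (hR : ∀ t, θ t ≤ R) (hR0 : 0 ≤ R)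
    (hsize : ∀ c, 0 ≤ C.size c) (hW : ∀ c, C.size c ≤ W) (F : Finset (κ ⊕ ρ)) (n : ℕ) :
    ∑ c ∈ F, C.size c * (timersAfter C θ θs ψ₀ X obj ω n c).rem ≤
      ∑ c ∈ F, C.size c * (ψ₀ c).rem + W * R * ∑ l ∈ Finset.range n,
        if arrivalTime X n ω - arrivalTime X (l + 1) ω < R then (1 : ℝ) else 0 := by
  have hterm : ∀ l, (0 : ℝ) ≤ if arrivalTime X n ω - arrivalTime X (l + 1) ω < R then 1 else 0 :=
    fun l => by positivity
  -- A lifetime that does not come from the initial state is positive only if the object was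
  -- requested less than `R` ago; it is at most `R` and is charged to that request.
  have hper : ∀ c, C.size c * (timersAfter C θ θs ψ₀ X obj ω n c).rem ≤
      C.size c * (ψ₀ c).rem + W * R * ∑ l ∈ Finset.range n, (if obj l ω = c then
        if arrivalTime X n ω - arrivalTime X (l + 1) ω < R then (1 : ℝ) else 0 else 0) := by
    intro c
    have hW0 : 0 ≤ W := (hsize c).trans (hW c)
    have hnn : ∀ l, (0 : ℝ) ≤ if obj l ω = c then
        if arrivalTime X n ω - arrivalTime X (l + 1) ω < R then (1 : ℝ) else 0 else 0 :=
      fun l => by split_ifs <;> norm_num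
    have hsum0 := Finset.sum_nonneg fun l (_ : l ∈ Finset.range n) => hnn l
    have hc0 := mul_nonneg (hsize c) (Timers.rem_nonneg (ψ₀ c))
    rcases rem_timersAfter_le (C := C) (ψ₀ := ψ₀) (obj := obj) hX hθs hs hR c n with
      h | ⟨l, hl, hlc, h⟩
    · have h1 := mul_le_mul_of_nonneg_left h (hsize c)
      have h2 := mul_nonneg (mul_nonneg hW0 hR0) hsum0
      linarith
    · by_cases hlt : arrivalTime X n ω - arrivalTime X (l + 1) ω < R
      · have h3 : (1 : ℝ) ≤ ∑ l ∈ Finset.range n, (if obj l ω = c then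
            if arrivalTime X n ω - arrivalTime X (l + 1) ω < R then (1 : ℝ) else 0 else 0) := by
          refine le_trans (le_of_eq ?_)
            (Finset.single_le_sum (fun l _ => hnn l) (Finset.mem_range.2 hl))
          rw [if_pos hlc, if_pos hlt]
        have h4 : 0 ≤ arrivalTime X n ω - arrivalTime X (l + 1) ω :=
          sub_nonneg.2 (arrivalTime_mono hX (Nat.succ_le_of_lt hl))
        have h5 : (timersAfter C θ θs ψ₀ X obj ω n c).rem ≤ R :=
          h.trans (max_le (by linarith) hR0)
        have h6 := mul_le_mul (hW c) h5 (Timers.rem_nonneg _) hW0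
        have h7 := mul_le_mul_of_nonneg_left h3 (mul_nonneg hW0 hR0)
        linarith
      · have h5 : (timersAfter C θ θs ψ₀ X obj ω n c).rem = 0 :=
          le_antisymm (h.trans (max_le (by linarith) le_rfl)) (Timers.rem_nonneg _)
        have h2 := mul_nonneg (mul_nonneg hW0 hR0) hsum0
        rw [h5, mul_zero]
        linarith
  refine (Finset.sum_le_sum fun c _ => hper c).trans ?_
  rw [Finset.sum_add_distrib, ← Finset.mul_sum, Finset.sum_comm]
  -- Nonnegativity of `W` has to be witnessed by some object: one of `F`, or a requested one if `F`
  -- is empty and n is positive.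
  rcases F.eq_empty_or_nonempty with rfl | ⟨c, hc⟩
  · simp only [Finset.sum_empty, Finset.sum_const_zero, mul_zero, add_zero, zero_add]
    rcases Finset.eq_empty_or_nonempty (Finset.range n) with h | ⟨l, -⟩
    · simp [h]
    · exact mul_nonneg (mul_nonneg ((hsize (obj l ω)).trans (hW _)) hR0)
        (Finset.sum_nonneg fun l _ => hterm l)
  · refine add_le_add_right (mul_le_mul_of_nonneg_left (Finset.sum_le_sum fun l _ => ?_)
      (mul_nonneg ((hsize c).trans (hW c)) hR0)) _
    rw [Finset.sum_ite_eq]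
    split_ifs <;> norm_num

open Classical in
/-- The number of requests in a time window of fixed length is negligible. -/
lemma tendsto_recent_requests (hX : ∀ n, 0 ≤ X n ω) {a : ℝ} (ha : 0 < a)
    (hA : Tendsto (fun n : ℕ => arrivalTime X n ω / n) atTop (𝓝 a)) (R : ℝ) :
    Tendsto (fun n : ℕ => (∑ l ∈ Finset.range n,
      if arrivalTime X n ω - arrivalTime X (l + 1) ω < R then (1 : ℝ) else 0) / n)
      atTop (𝓝 0) := by
  rw [Metric.tendsto_atTop]
  suffices h : ∀ ε : ℝ, 0 < ε → ε < 1 → ∃ N : ℕ, ∀ n ≥ N, (∑ l ∈ Finset.range n,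
      if arrivalTime X n ω - arrivalTime X (l + 1) ω < R then (1 : ℝ) else 0) ≤ ε * n by
    intro ε hε
    obtain ⟨N, hN⟩ := h (min (ε / 2) (1 / 2)) (by positivity)
      (lt_of_le_of_lt (min_le_right _ _) (by norm_num))
    refine ⟨max N 1, fun n hn => ?_⟩
    have hn0 : (0 : ℝ) < n := by exact_mod_cast (le_max_right N 1).trans hn
    have h1 := hN n ((le_max_left _ _).trans hn)
    rw [Real.dist_0_eq_abs, abs_of_nonneg (div_nonneg (Finset.sum_nonneg fun l _ => by positivity)
      hn0.le), div_lt_iff₀ hn0]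
    refine h1.trans_lt (mul_lt_mul_of_pos_right ?_ hn0)
    exact (min_le_left _ _).trans_lt (by linarith)
  intro ε hε hε1
  -- By linear growth the arrivals numbered (1 - ε) n and n are about a ε n apart, eventually more
  -- than `R`. Recent requests then have index at least `j n`, and there are at most ε n of them.
  set j : ℕ → ℕ := fun n => ⌈(1 - ε) * (n : ℝ)⌉₊ with hj
  have hj1 : Tendsto (fun n : ℕ => (j n : ℝ) / n) atTop (𝓝 (1 - ε)) :=
    (tendsto_nat_ceil_mul_div_atTop (by linarith : (0 : ℝ) ≤ 1 - ε)).comp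
      tendsto_natCast_atTop_atTop
  have hj2 : Tendsto j atTop atTop :=
    tendsto_nat_ceil_atTop.comp (tendsto_natCast_atTop_atTop.const_mul_atTop (by linarith))
  have hAj : Tendsto (fun n : ℕ => arrivalTime X (j n) ω / n) atTop (𝓝 (a * (1 - ε))) := by
    refine ((hA.comp hj2).mul hj1).congr' ?_
    filter_upwards [hj2.eventually_gt_atTop 0] with n hn
    have : (j n : ℝ) ≠ 0 := by exact_mod_cast hn.ne'
    simp only [Function.comp]
    field_simp
  have hd := (hA.sub hAj).sub (tendsto_const_div_atTop_nhds_zero_nat R)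
  have hpos : 0 < a - a * (1 - ε) - 0 := by nlinarith
  obtain ⟨N, hN⟩ := eventually_atTop.1 ((hd.eventually_const_lt hpos).and (eventually_gt_atTop 0))
  refine ⟨N, fun n hn => ?_⟩
  obtain ⟨h1, h2⟩ := hN n hn
  have hn0 : (0 : ℝ) < n := by exact_mod_cast h2
  rw [← sub_div, ← sub_div] at h1
  have h3 : R < arrivalTime X n ω - arrivalTime X (j n) ω := by
    have := (div_pos_iff_of_pos_right hn0).1 h1
    linarith
  rw [Finset.sum_boole]
  have hsub : (Finset.range n).filter (fun l =>
      arrivalTime X n ω - arrivalTime X (l + 1) ω < R) ⊆ Finset.Ico (j n) n := by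
    intro l hl
    obtain ⟨hl1, hl2⟩ := Finset.mem_filter.1 hl
    refine Finset.mem_Ico.2 ⟨?_, Finset.mem_range.1 hl1⟩
    by_contra! hlt
    have := arrivalTime_mono hX (Nat.succ_le_of_lt hlt)
    simp only [Nat.succ_eq_add_one] at this
    linarith
  have hcard := Finset.card_le_card hsub
  rw [Nat.card_Ico] at hcard
  have hjn : j n ≤ n := by
    refine Nat.ceil_le.2 ?_
    nlinarith
  have h4 : (1 - ε) * (n : ℝ) ≤ j n := Nat.le_ceil _
  have h5 : (((Finset.range n).filter (fun l =>
      arrivalTime X n ω - arrivalTime X (l + 1) ω < R)).card : ℝ) ≤ (n : ℝ) - j n := by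
    rw [← Nat.cast_sub hjn]
    exact_mod_cast hcard
  linarith

end Pathwise

/-! ### The request model as a marked chain -/

section Model

variable {Ω κ τ ρ : Type*} {C : Catalog κ τ ρ} {X : ℕ → Ω → ℝ} {obj : ℕ → Ω → κ ⊕ ρ}

lemma label_eq_inl_iff {o : κ ⊕ ρ} {c : κ} : C.label o = Sum.inl c ↔ o = Sum.inl c := by
  cases o <;> simp [Catalog.label]

/-- The type of an object with a given label. -/
def labelType (C : Catalog κ τ ρ) : κ ⊕ τ → τ := Sum.elim C.recType id

lemma typ_eq (o : κ ⊕ ρ) : C.typ o = labelType C (C.label o) := by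
  cases o <;> rfl

lemma weight_eq (v : κ → ℝ) (vr : τ → ℝ) (o : κ ⊕ ρ) :
    C.weight v vr o = Sum.elim v vr (C.label o) := by
  cases o <;> rfl

variable [MeasurableSpace Ω] [Fintype κ] [Fintype τ] {μ : Measure Ω} {lam : ℝ}
  {P : Matrix (κ ⊕ τ) (κ ⊕ τ) ℝ} {π : κ ⊕ τ → ℝ}

lemma IsRequestModel.exists_isMarkedChain [DecidableEq κ] [DecidableEq τ]
    (h : IsRequestModel C μ X obj lam P π) :
    ∃ η, IsMarkedChain μ X (fun n ω => C.label (obj n ω)) P η ∧ η ≪ volume := by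
  obtain ⟨f, -, -, -, -, hf⟩ := h.density_X
  refine ⟨_, ⟨h.measurable_X, h.indep_X, hf, h.measurable_Z, h.indep_X_Z, ?_, ?_, h.markov⟩,
    withDensity_absolutelyContinuous _ _⟩
  · exact (Matrix.mem_rowStochastic.1 h.stochastic).1
  · intro w
    have := congrFun (Matrix.mem_rowStochastic.1 h.stochastic).2 w
    simpa [Matrix.mulVec, dotProduct] using this

lemma IsRequestModel.ae_nonneg [DecidableEq κ] [DecidableEq τ]
    (h : IsRequestModel C μ X obj lam P π) : ∀ᵐ ω ∂μ, ∀ n, 0 ≤ X n ω := by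
  obtain ⟨f, -, -, hneg, -, hf⟩ := h.density_X
  refine ae_all_iff.2 fun n => ?_
  have h1 : μ.map (X n) (Set.Iio 0) = 0 := by
    rw [hf n, withDensity_apply _ measurableSet_Iio]
    refine (setLIntegral_congr_fun measurableSet_Iio fun x hx => ?_).trans lintegral_zero
    simp [hneg x hx]
  rw [Measure.map_apply (h.measurable_X n) measurableSet_Iio] at h1
  rw [ae_iff]
  convert h1 using 2
  ext ω
  simp

/-- The law of large numbers for the arrival times. -/
lemma IsRequestModel.ae_tendsto_arrivalTime [DecidableEq κ] [DecidableEq τ]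
    (h : IsRequestModel C μ X obj lam P π) :
    ∀ᵐ ω ∂μ, Tendsto (fun n : ℕ => arrivalTime X n ω / n) atTop (𝓝 (1 / lam)) := by
  obtain ⟨f, -, -, -, -, hf⟩ := h.density_X
  have := strong_law_ae_real X (h.integrable_X 0) (fun i j hij => h.indep_X.indepFun hij)
    (fun i => ⟨(h.measurable_X i).aemeasurable, (h.measurable_X 0).aemeasurable,
      by rw [hf i, hf 0]⟩)
  rwa [h.mean_X 0] at this

variable {η : Measure ℝ} {c : κ}

/-- `Nat.nth`, `firstVisit` and `nextVisit` are all infima of sets of naturals, so the random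
variables agree for every outcome, default values included. The initial law of the chain plays no
role in the result. -/
lemma interArrivalLaw_eq [IsProbabilityMeasure μ]
    (hZ : IsMarkedChain μ X (fun n ω => C.label (obj n ω)) P η)
    (hrec : ∀ᵐ ω ∂μ, ∀ l, ∃ m, l < m ∧ C.label (obj m ω) = Sum.inl c) :
    interArrivalLaw μ X obj c = gapLaw P η (Sum.inl c) := by
  rw [← hZ.map_gap_firstVisit hrec, interArrivalLaw]
  congr 1
  ext ω
  have h0 : Nat.nth (fun n => obj n ω = Sum.inl c) 0 =
      firstVisit (fun n ω => C.label (obj n ω)) (Sum.inl c) ω := by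
    rw [Nat.nth_eq_sInf]
    simp [firstVisit, label_eq_inl_iff]
  have h1 : Nat.nth (fun n => obj n ω = Sum.inl c) 1 = nextVisit (fun n ω => C.label (obj n ω))
      (Sum.inl c) (firstVisit (fun n ω => C.label (obj n ω)) (Sum.inl c) ω) ω := by
    rw [Nat.nth_eq_sInf, nextVisit, ← h0]
    congr 1
    ext m
    simp [label_eq_inl_iff, and_comm]
  rw [objectArrival, objectArrival, h0, h1, gap]

/-- The cache compares gaps with a TTL strictly, the c.d.f. weakly; the absence of atoms reconciles
the two. -/
lemma interArrivalCDF_eq [IsProbabilityMeasure μ]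
    (hZ : IsMarkedChain μ X (fun n ω => C.label (obj n ω)) P η) (hη : η ≪ volume)
    (hrec : ∀ᵐ ω ∂μ, ∀ l, ∃ m, l < m ∧ C.label (obj m ω) = Sum.inl c) (x : ℝ) :
    interArrivalCDF μ X obj c x = (gapLaw P η (Sum.inl c)).real (Set.Iio x) := by
  rw [interArrivalCDF, interArrivalLaw_eq hZ hrec]
  refine measureReal_congr (eventuallyEq_set.2 ?_)
  have : ∀ᵐ y ∂(gapLaw P η (Sum.inl c)), y ≠ x := by
    simpa [ae_iff] using hZ.gapLaw_singleton hη (Sum.inl c) x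
  filter_upwards [this] with y hy
  exact ⟨fun h => lt_of_le_of_ne h hy, fun h => (Set.mem_Iio.1 h).le⟩

/-- The time spent in the cache within a gap `y` by an object with TTL `x`. -/
noncomputable def clip (x y : ℝ) : ℝ := max 0 (min y x)

lemma measurable_clip (x : ℝ) : Measurable (clip x) :=
  measurable_const.max (measurable_id.min measurable_const)

lemma clip_nonneg (x y : ℝ) : 0 ≤ clip x y := le_max_left _ _

lemma clip_le {x : ℝ} (hx : 0 ≤ x) (y : ℝ) : clip x y ≤ x := max_le hx (min_le_right _ _)

/-- The unused part of a TTL `x` after a gap `y` is what the timer shows at the next request. -/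
lemma sub_clip {x y : ℝ} (hx : 0 ≤ x) (hy : 0 ≤ y) : x - clip x y = max (x - y) 0 := by
  rw [clip, max_eq_right (le_min hy hx)]
  rcases le_total y x with h | h
  · rw [min_eq_left h, max_eq_left (by linarith)]
  · rw [min_eq_right h, max_eq_right (by linarith), sub_self]

lemma truncatedMean_eq [IsProbabilityMeasure μ]
    (hZ : IsMarkedChain μ X (fun n ω => C.label (obj n ω)) P η)
    (hrec : ∀ᵐ ω ∂μ, ∀ l, ∃ m, l < m ∧ C.label (obj m ω) = Sum.inl c) {x : ℝ} (hx : 0 ≤ x) :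
    truncatedMean μ X obj c x = ∫ y, clip x y ∂(gapLaw P η (Sum.inl c)) := by
  have := hZ.isProbabilityMeasure_gapLaw hrec
  rw [truncatedMean, interArrivalCDF, interArrivalLaw_eq hZ hrec]
  set ν := gapLaw P η (Sum.inl c)
  -- The identity on (0, x] and the constant x beyond it give the two terms of the truncated mean.
  have e : clip x = fun y => (Set.Ioc 0 x).indicator (fun y => y) y +
      (Set.Ioi x).indicator (fun _ => x) y := by
    ext y
    simp only [clip, Set.indicator_apply, Set.mem_Ioc, Set.mem_Ioi]
    rcases le_or_gt y 0 with h | h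
    · rw [if_neg (fun h' => absurd h'.1 (not_lt.2 h)), if_neg (by linarith), add_zero,
        max_eq_left ((min_le_left _ _).trans h)]
    · rcases le_or_gt y x with h' | h'
      · rw [if_pos ⟨h, h'⟩, if_neg (not_lt.2 h'), add_zero, min_eq_left h', max_eq_right h.le]
      · rw [if_neg (fun h2 => absurd h2.2 (not_le.2 h')), if_pos h', zero_add, min_eq_right h'.le,
          max_eq_right hx]
  rw [e, integral_add, integral_indicator measurableSet_Ioc,
    integral_indicator_const _ measurableSet_Ioi, ← Set.compl_Iic,
    probReal_compl_eq_one_sub measurableSet_Iic, smul_eq_mul]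
  · ring
  · rw [integrable_indicator_iff measurableSet_Ioc]
    refine Integrable.of_bound measurable_id.aestronglyMeasurable x ?_
    filter_upwards [ae_restrict_mem measurableSet_Ioc] with y hy
    simpa [abs_of_pos hy.1] using hy.2
  · exact (integrable_const x).indicator measurableSet_Ioi

end Model

/-! ### The cache state of a recurring object is determined by the past -/

section Measurability

variable {Ω κ τ ρ : Type*} {C : Catalog κ τ ρ} {θ θs : τ → ℝ} {ψ₀ : κ ⊕ ρ → Timers}
  {X : ℕ → Ω → ℝ} {obj : ℕ → Ω → κ ⊕ ρ}

/-- All three timers are measurable. -/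
structure MeasurableTimers [MeasurableSpace Ω] (T : Ω → Timers) : Prop where
  deep : Measurable fun ω => (T ω).deep
  shallow : Measurable fun ω => (T ω).shallow
  shadow : Measurable fun ω => (T ω).shadow

lemma MeasurableTimers.age {m : MeasurableSpace Ω} {T : Ω → Timers} (hT : MeasurableTimers T)
    {x : Ω → ℝ} (hx : Measurable x) : MeasurableTimers fun ω => (T ω).age (x ω) :=
  ⟨(hT.deep.sub hx).max measurable_const, (hT.shallow.sub hx).max measurable_const,
    (hT.shadow.sub hx).max measurable_const⟩

lemma MeasurableTimers.measurableSet_present {m : MeasurableSpace Ω} {T : Ω → Timers}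
    (hT : MeasurableTimers T) : MeasurableSet {ω | (T ω).Present} := by
  have h1 := measurableSet_lt (measurable_const (a := (0 : ℝ))) hT.deep
  have h2 := measurableSet_lt (measurable_const (a := (0 : ℝ))) hT.shallow
  have h3 := measurableSet_lt (measurable_const (a := (0 : ℝ))) hT.shadow
  exact (h1.union h2).union ((h1.union h2).compl.inter h3)

open Classical in
lemma MeasurableTimers.ite {m : MeasurableSpace Ω} {T T' : Ω → Timers}
    (hT : MeasurableTimers T) (hT' : MeasurableTimers T') {p : Ω → Prop}
    (hp : MeasurableSet {ω | p ω}) : MeasurableTimers fun ω => if p ω then T ω else T' ω := by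
  refine ⟨?_, ?_, ?_⟩ <;> simp only [apply_ite Timers.deep, apply_ite Timers.shallow,
    apply_ite Timers.shadow]
  exacts [hT.deep.ite hp hT'.deep, hT.shallow.ite hp hT'.shallow, hT.shadow.ite hp hT'.shadow]

lemma measurableTimers_const {m : MeasurableSpace Ω} (ψ : Timers) :
    MeasurableTimers fun _ : Ω => ψ :=
  ⟨measurable_const, measurable_const, measurable_const⟩

lemma MeasurableTimers.onRequest {m : MeasurableSpace Ω} {T : Ω → Timers}
    (hT : MeasurableTimers T) (a b : ℝ) : MeasurableTimers fun ω => (T ω).onRequest a b := by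
  simp only [Timers.onRequest_eq]
  exact (measurableTimers_const _).ite (measurableTimers_const _) hT.measurableSet_present

/-- The label reveals whether a given recurring object is requested, and the initial timers are
deterministic; hence its timers arise from past labels and marks by measurable updates. A label
would not identify a rare object. -/
lemma measurableTimers_timersAfter (c : κ) {m n : ℕ} (hn : n ≤ m) :
    @MeasurableTimers Ω (pastAlg X (fun n ω => C.label (obj n ω)) m)
      fun ω => timersAfter C θ θs ψ₀ X obj ω n (Sum.inl c) := by
  classical
  induction n with
  | zero => exact @measurableTimers_const _ (pastAlg X (fun n ω => C.label (obj n ω)) m) _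
  | succ n ih =>
    have hage := (ih (by omega)).age (measurable_pastAlg (X := X)
      (Z := fun n ω => C.label (obj n ω)) (show n ≤ m by omega))
    have hset := measurableSet_pastAlg (X := X) (Z := fun n ω => C.label (obj n ω))
      (show n ≤ m by omega) {Sum.inl c}
    have heq : ∀ ω, Sum.inl c = obj n ω ↔ C.label (obj n ω) ∈ ({Sum.inl c} : Set (κ ⊕ τ)) :=
      fun ω => by rw [Set.mem_singleton_iff, label_eq_inl_iff, eq_comm]
    have := (hage.onRequest (θ (C.typ (Sum.inl c))) (θs (C.typ (Sum.inl c)))).ite hage hset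
    convert this using 2 with ω
    simp only [timersAfter]
    by_cases h : Sum.inl c = obj n ω
    · rw [if_pos h, if_pos ((heq ω).1 h)]
    · rw [if_neg h, if_neg (mt (heq ω).2 h)]

/-- The condition on the label is essential: `Renewal` refers to whichever object is requested, and
only on this event is that object fixed. -/
lemma measurableSet_renewal (c : κ) (l : ℕ) :
    MeasurableSet[pastAlg X (fun n ω => C.label (obj n ω)) l]
      {ω | C.label (obj l ω) = Sum.inl c ∧ Renewal C θ θs ψ₀ X obj l ω} := by
  have hT := (measurableTimers_timersAfter (C := C) (θ := θ) (θs := θs) (ψ₀ := ψ₀) (X := X)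
    (obj := obj) c (le_refl l)).age (measurable_pastAlg (X := X)
      (Z := fun n ω => C.label (obj n ω)) (le_refl l))
  have hset := measurableSet_pastAlg (X := X) (Z := fun n ω => C.label (obj n ω))
      (le_refl l) {Sum.inl c}
  have := @MeasurableSet.inter _ (pastAlg X (fun n ω => C.label (obj n ω)) l) _ _ hset
    hT.measurableSet_present
  convert this using 1
  ext ω
  simp only [Set.mem_ofPred_eq, Set.mem_inter_iff, Set.mem_singleton_iff, Renewal, timersAtRequest]
  refine and_congr_right fun h => ?_
  rw [label_eq_inl_iff.1 h]

end Measurability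

/-! ### Limits along the sequence of requests -/

section Limits

variable {Ω κ τ ρ : Type*} {C : Catalog κ τ ρ} {θ θs : τ → ℝ} {ψ₀ : κ ⊕ ρ → Timers}
  {X : ℕ → Ω → ℝ} {obj : ℕ → Ω → κ ⊕ ρ}

lemma consecutive_label {ω : Ω} {c : κ} {l m : ℕ} (hl : C.label (obj l ω) = Sum.inl c)
    (hm : C.label (obj m ω) = Sum.inl c)
    (h : ∀ i, l < i → i < m → C.label (obj i ω) ≠ Sum.inl c) :
    obj l ω = obj m ω ∧ ∀ i, l < i → i < m → obj i ω ≠ obj m ω := by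
  rw [label_eq_inl_iff] at hl hm
  refine ⟨hl.trans hm.symm, fun i h1 h2 h3 => h i h1 h2 ?_⟩
  rw [label_eq_inl_iff, h3, hm]

lemma exists_rem_bound (hψ₀ : {c | ψ₀ c ≠ 0}.Finite) : ∃ K, 0 ≤ K ∧ ∀ c, (ψ₀ c).rem ≤ K := by
  refine ⟨∑ c ∈ hψ₀.toFinset, (ψ₀ c).rem, Finset.sum_nonneg fun c _ => Timers.rem_nonneg _,
    fun c => ?_⟩
  by_cases hc : ψ₀ c = 0
  · rw [hc, Timers.rem_zero]
    exact Finset.sum_nonneg fun c _ => Timers.rem_nonneg _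
  · exact Finset.single_le_sum (f := fun c => (ψ₀ c).rem) (fun c _ => Timers.rem_nonneg _)
      (hψ₀.mem_toFinset.2 hc)

lemma exists_rem_timersAtRequest_bound (hψ₀ : {c | ψ₀ c ≠ 0}.Finite) {R : ℝ} (hR0 : 0 ≤ R)
    (hR : ∀ t, θ t ≤ R) (hθs : ∀ t, 0 ≤ θs t) (hs : ∀ t, θs t ≤ θ t) :
    ∃ K, R ≤ K ∧ ∀ ω, (∀ n, 0 ≤ X n ω) → ∀ n,
      (timersAtRequest C θ θs ψ₀ X obj n ω).rem ≤ K := by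
  obtain ⟨K, hK0, hK⟩ := exists_rem_bound hψ₀
  refine ⟨K + R, by linarith, fun ω hX n => ?_⟩
  rw [timersAtRequest, Timers.rem_age _ (hX n)]
  refine max_le ?_ (by linarith)
  have hXn := hX n
  rcases rem_timersAfter_le (C := C) (ψ₀ := ψ₀) (obj := obj) hX hθs hs hR (obj n ω) n with
    h | ⟨l, hl, -, h⟩
  · linarith [hK (obj n ω)]
  · have h4 : 0 ≤ arrivalTime X n ω - arrivalTime X (l + 1) ω :=
      sub_nonneg.2 (arrivalTime_mono hX (Nat.succ_le_of_lt hl))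
    have := h.trans (max_le (by linarith : _ ≤ R) hR0)
    linarith

/-- This lets `Renewal` play the role of the flag in `ae_tendsto_flagged_gap`. -/
lemma ae_renewal_iff_gap [MeasurableSpace Ω] {μ : Measure Ω} (hX : ∀ᵐ ω ∂μ, ∀ n, 0 ≤ X n ω) (hs : ∀ t, θs t ≤ θ t) (c : κ) :
    ∀ᵐ ω ∂μ, ∀ l m, l < m → C.label (obj l ω) = Sum.inl c → C.label (obj m ω) = Sum.inl c →
      (∀ i, l < i → i < m → C.label (obj i ω) ≠ Sum.inl c) → (Renewal C θ θs ψ₀ X obj m ω ↔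
        gap X (fun n ω => C.label (obj n ω)) (Sum.inl c) l ω < θ (C.recType c)) := by
  filter_upwards [hX] with ω hX l m hlm hl hm h
  obtain ⟨h1, h2⟩ := consecutive_label hl hm h
  rw [renewal_iff_of_consecutive hX hlm h1 h2 hs,
    gap_eq_of_consecutive (Z := fun n ω => C.label (obj n ω)) hlm hm h, label_eq_inl_iff.1 hm]
  rfl

section Recurring

variable [MeasurableSpace Ω] [Fintype κ] [Fintype τ] {μ : Measure Ω}
  {P : Matrix (κ ⊕ τ) (κ ⊕ τ) ℝ} {η : Measure ℝ} [IsProbabilityMeasure μ] {c : κ} {p : ℝ}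

open Classical in
/-- Frequency of the hits of a recurring object. -/
lemma ae_tendsto_hit (hZ : IsMarkedChain μ X (fun n ω => C.label (obj n ω)) P η) (hη : η ≪ volume)
    (hrec : ∀ᵐ ω ∂μ, ∀ l, ∃ m, l < m ∧ C.label (obj m ω) = Sum.inl c)
    (hfreq : ∀ᵐ ω ∂μ, Tendsto (fun n : ℕ =>
      (∑ l ∈ Finset.range n, if C.label (obj l ω) = Sum.inl c then (1 : ℝ) else 0) / n)
      atTop (𝓝 p))
    (hX : ∀ᵐ ω ∂μ, ∀ n, 0 ≤ X n ω) (hθs : ∀ t, 0 ≤ θs t) (hs : ∀ t, θs t ≤ θ t) :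
    ∀ᵐ ω ∂μ, Tendsto (fun n : ℕ => (∑ l ∈ Finset.range n, if C.label (obj l ω) = Sum.inl c then
      (if Hit C θ θs ψ₀ X obj l ω then (1 : ℝ) else 0) else 0) / n) atTop
      (𝓝 (p * (interArrivalCDF μ X obj c (θ (C.recType c)) ^ 2 +
        (1 - interArrivalCDF μ X obj c (θ (C.recType c))) *
          interArrivalCDF μ X obj c (θs (C.recType c))))) := by
  have hθ : ∀ t, 0 ≤ θ t := fun t => (hθs t).trans (hs t)
  have hφ : ∀ x : ℝ, Measurable ((Set.Iio x).indicator fun _ : ℝ => (1 : ℝ)) :=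
    fun x => measurable_const.indicator measurableSet_Iio
  have hφb : ∀ x y : ℝ, |(Set.Iio x).indicator (fun _ : ℝ => (1 : ℝ)) y| ≤ 1 := fun x y => by
    by_cases h : y ∈ Set.Iio x <;> simp [h]
  have key := hZ.ae_tendsto_flagged_gap hrec (by convert hfreq)
    (measurableSet_renewal (C := C) (θ := θ) (θs := θs) (ψ₀ := ψ₀) (X := X) (obj := obj) c)
    (ae_renewal_iff_gap hX hs c) (hφ (θ (C.recType c))) (hφb _) (hφ (θs (C.recType c))) (hφb _)
  simp_rw [integral_indicator_const _ measurableSet_Iio, smul_eq_mul, mul_one,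
    ← interArrivalCDF_eq hZ hη hrec, ← sq] at key
  filter_upwards [key, hX] with ω key hX
  -- A hit is decided at the preceding visit, by the renewal flag there and the gap that follows;
  -- moving the indicator back costs a bounded error.
  refine tendsto_div_of_abs_sub_le (K := 2 * 1) (fun n => ?_) key
  convert abs_sum_sub_sum_le_of_consecutive (M := 1)
    (V := fun l => C.label (obj l ω) = Sum.inl c) (a := fun m =>
      if Hit C θ θs ψ₀ X obj m ω then (1 : ℝ) else 0)
    (b := fun l => if Renewal C θ θs ψ₀ X obj l ω then
      (Set.Iio (θ (C.recType c))).indicator (fun _ => (1 : ℝ))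
        (gap X (fun n ω => C.label (obj n ω)) (Sum.inl c) l ω)
      else (Set.Iio (θs (C.recType c))).indicator (fun _ => (1 : ℝ))
        (gap X (fun n ω => C.label (obj n ω)) (Sum.inl c) l ω))
    (fun m => by split_ifs <;> simp) (fun m => by split_ifs; exacts [hφb _ _, hφb _ _])
    (fun l m hlm hl hm h => ?_) n
  obtain ⟨h1, h2⟩ := consecutive_label hl hm h
  simp only [hit_iff_of_consecutive hX hlm h1 h2 hθ hθs]
  rw [← gap_eq_of_consecutive (Z := fun n ω => C.label (obj n ω)) hlm hm h]
  simp only [assignedTTL, label_eq_inl_iff.1 hl, Set.indicator_apply, Set.mem_Iio,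
    Catalog.typ, Sum.elim_inl]
  by_cases hR : Renewal C θ θs ψ₀ X obj l ω <;> simp [hR]

open Classical in
/-- Average contribution of the requests for a recurring object to the cache size. -/
lemma ae_tendsto_size (hZ : IsMarkedChain μ X (fun n ω => C.label (obj n ω)) P η) (hη : η ≪ volume)
    (hrec : ∀ᵐ ω ∂μ, ∀ l, ∃ m, l < m ∧ C.label (obj m ω) = Sum.inl c)
    (hfreq : ∀ᵐ ω ∂μ, Tendsto (fun n : ℕ =>
      (∑ l ∈ Finset.range n, if C.label (obj l ω) = Sum.inl c then (1 : ℝ) else 0) / n)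
      atTop (𝓝 p))
    (hX : ∀ᵐ ω ∂μ, ∀ n, 0 ≤ X n ω) (hθs : ∀ t, 0 ≤ θs t) (hs : ∀ t, θs t ≤ θ t) {R : ℝ}
    (hR0 : 0 ≤ R) (hR : ∀ t, θ t ≤ R) (hψ₀ : {c | ψ₀ c ≠ 0}.Finite) :
    ∀ᵐ ω ∂μ, Tendsto (fun n : ℕ => (∑ l ∈ Finset.range n, if C.label (obj l ω) = Sum.inl c then
      assignedTTL C θ θs ψ₀ X obj l ω - (timersAtRequest C θ θs ψ₀ X obj l ω).rem else 0) / n)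
      atTop (𝓝 (p * (interArrivalCDF μ X obj c (θ (C.recType c)) *
          truncatedMean μ X obj c (θ (C.recType c)) +
        (1 - interArrivalCDF μ X obj c (θ (C.recType c))) *
          truncatedMean μ X obj c (θs (C.recType c))))) := by
  have hθ : ∀ t, 0 ≤ θ t := fun t => (hθs t).trans (hs t)
  have hb : ∀ x : ℝ, 0 ≤ x → x ≤ R → ∀ y, |clip x y| ≤ R := fun x h0 hx y => by
    rw [abs_of_nonneg (clip_nonneg x y)]
    exact (clip_le h0 y).trans hx
  have hb' : ∀ x : ℝ, 0 ≤ x → x ≤ R → ∀ y, |x - clip x y| ≤ R := fun x h0 hx y => by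
    have h1 := clip_nonneg x y
    have h2 := clip_le h0 y
    rw [abs_of_nonneg (by linarith)]
    linarith
  have key := hZ.ae_tendsto_flagged_gap hrec (by convert hfreq)
    (measurableSet_renewal (C := C) (θ := θ) (θs := θs) (ψ₀ := ψ₀) (X := X) (obj := obj) c)
    (ae_renewal_iff_gap hX hs c) (measurable_clip (θ (C.recType c))) (hb _ (hθ _) (hR _))
    (measurable_clip (θs (C.recType c))) (hb _ (hθs _) ((hs _).trans (hR _)))
  simp_rw [← interArrivalCDF_eq hZ hη hrec, ← truncatedMean_eq hZ hrec (hθ _),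
    ← truncatedMean_eq hZ hrec (hθs _)] at key
  obtain ⟨K, hRK, hK⟩ := exists_rem_timersAtRequest_bound (C := C) (X := X) (obj := obj)
    hψ₀ hR0 hR hθs hs
  filter_upwards [key, hX] with ω key hX
  refine tendsto_div_of_abs_sub_le (K := 2 * K) (fun n => ?_) key
  -- The leftover lifetime at a request is moved to the preceding visit, where it reads TTL minus
  -- `clip`. Subtracted from the TTL assigned at that visit, it leaves `clip` of the gap.
  have hdiff := abs_sum_sub_sum_le_of_consecutive (M := K)
    (V := fun l => C.label (obj l ω) = Sum.inl c)
    (a := fun m => (timersAtRequest C θ θs ψ₀ X obj m ω).rem)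
    (b := fun l => if Renewal C θ θs ψ₀ X obj l ω then θ (C.recType c) -
      clip (θ (C.recType c)) (gap X (fun n ω => C.label (obj n ω)) (Sum.inl c) l ω)
      else θs (C.recType c) -
        clip (θs (C.recType c)) (gap X (fun n ω => C.label (obj n ω)) (Sum.inl c) l ω))
    (fun m => by
      rw [abs_of_nonneg (Timers.rem_nonneg _)]
      exact hK ω hX m)
    (fun m => by
      split_ifs
      exacts [(hb' _ (hθ _) (hR _) _).trans hRK,
        (hb' _ (hθs _) ((hs _).trans (hR _)) _).trans hRK])
    (fun l m hlm hl hm h => ?_) n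
  · rw [abs_sub_comm] at hdiff
    convert hdiff using 2
    rw [← Finset.sum_sub_distrib, ← Finset.sum_sub_distrib]
    refine Finset.sum_congr rfl fun l _ => ?_
    by_cases hl : C.label (obj l ω) = Sum.inl c
    · simp only [assignedTTL, label_eq_inl_iff.1 hl, Catalog.typ, Sum.elim_inl]
      split_ifs <;> ring
    · simp [hl]
  · obtain ⟨h1, h2⟩ := consecutive_label hl hm h
    have h0 : 0 ≤ arrivalTime X (m + 1) ω - arrivalTime X (l + 1) ω :=
      sub_nonneg.2 (arrivalTime_mono hX (by omega))
    simp only [rem_timersAtRequest_of_consecutive hX hlm h1 h2 hθ hθs]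
    rw [gap_eq_of_consecutive (Z := fun n ω => C.label (obj n ω)) hlm hm h,
      sub_clip (hθ _) h0, sub_clip (hθs _) h0]
    simp only [assignedTTL, label_eq_inl_iff.1 hl, Catalog.typ, Sum.elim_inl]
    split_ifs <;> rfl

end Recurring

section Rare

variable {ω : Ω} {t : τ}

open Classical in
/-- Renewals of rare objects are negligible. -/
lemma tendsto_rare_renewal (hX : ∀ n, 0 ≤ X n ω) (hs : ∀ t, θs t ≤ θ t) {R : ℝ}
    (hR : ∀ t, θ t ≤ R) (hψ₀ : {c | ψ₀ c ≠ 0}.Finite)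
    (hb : Tendsto (fun m : ℕ => 1 / (m : ℝ) * ∑ l ∈ Finset.Icc m (m + m),
      if Bursty C X obj R t l ω then (1 : ℝ) else 0) atTop (𝓝 0)) :
    Tendsto (fun n : ℕ => (∑ l ∈ Finset.range n, if C.label (obj l ω) = Sum.inr t ∧
      Renewal C θ θs ψ₀ X obj l ω then (1 : ℝ) else 0) / n) atTop (𝓝 0) := by
  have h1 := tendsto_average_zero_of_windows (fun n => by positivity) hb
  have h2 := h1.add (tendsto_const_div_atTop_nhds_zero_nat (hψ₀.toFinset.card : ℝ))
  rw [add_zero] at h2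
  refine squeeze_zero (fun n => div_nonneg (Finset.sum_nonneg fun l _ => by positivity)
    (Nat.cast_nonneg n)) (fun n => ?_) h2
  rw [← add_div]
  refine div_le_div_of_nonneg_right ?_ (Nat.cast_nonneg n)
  -- Renewals that are not explained by an earlier request are first requests for initially stored
  -- objects, at most one for each of these.
  have hcard : (∑ l ∈ Finset.range n, if ψ₀ (obj l ω) ≠ 0 ∧ ∀ i < l, obj i ω ≠ obj l ω
      then (1 : ℝ) else 0) ≤ hψ₀.toFinset.card := by
    rw [Finset.sum_boole]
    refine Nat.cast_le.2 (Finset.card_le_card_of_injOn (fun l => obj l ω) (fun l hl => ?_) ?_)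
    · exact hψ₀.mem_toFinset.2 (Finset.mem_filter.1 hl).2.1
    · intro i hi j hj hij
      have hi' := (Finset.mem_filter.1 hi).2.2
      have hj' := (Finset.mem_filter.1 hj).2.2
      rcases lt_trichotomy i j with h | h | h
      exacts [absurd hij (hj' i h), h, absurd hij.symm (hi' j h)]
  refine le_trans ?_ (add_le_add le_rfl hcard)
  rw [← Finset.sum_add_distrib]
  refine Finset.sum_le_sum fun l _ => ?_
  by_cases hl : C.label (obj l ω) = Sum.inr t ∧ Renewal C θ θs ψ₀ X obj l ω
  · rw [if_pos hl]
    rcases exists_of_renewal hX hs hl.2 with ⟨m, hm, h3, h4⟩ | h3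
    · rw [if_pos (show Bursty C X obj R t l ω from ⟨hl.1, m, hm, h3, h4.trans_le (hR _)⟩)]
      have : (0 : ℝ) ≤ if ψ₀ (obj l ω) ≠ 0 ∧ ∀ i < l, obj i ω ≠ obj l ω then (1 : ℝ) else 0 := by
        positivity
      linarith
    · rw [if_pos h3]
      have : (0 : ℝ) ≤ if Bursty C X obj R t l ω then (1 : ℝ) else 0 := by positivity
      linarith
  · rw [if_neg hl]
    positivity

open Classical in
/-- Average contribution of the requests for rare objects to the cache size. -/
lemma tendsto_rare_size (hX : ∀ n, 0 ≤ X n ω) (hθs : ∀ t, 0 ≤ θs t) (hs : ∀ t, θs t ≤ θ t)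
    {R p : ℝ} (hR0 : 0 ≤ R) (hR : ∀ t, θ t ≤ R) (hψ₀ : {c | ψ₀ c ≠ 0}.Finite)
    (hren : Tendsto (fun n : ℕ => (∑ l ∈ Finset.range n, if C.label (obj l ω) = Sum.inr t ∧
      Renewal C θ θs ψ₀ X obj l ω then (1 : ℝ) else 0) / n) atTop (𝓝 0))
    (hfreq : Tendsto (fun n : ℕ => (∑ l ∈ Finset.range n, if C.label (obj l ω) = Sum.inr t then
      (1 : ℝ) else 0) / n) atTop (𝓝 p)) :
    Tendsto (fun n : ℕ => (∑ l ∈ Finset.range n, if C.label (obj l ω) = Sum.inr t then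
      assignedTTL C θ θs ψ₀ X obj l ω - (timersAtRequest C θ θs ψ₀ X obj l ω).rem else 0) / n)
      atTop (𝓝 (p * θs t)) := by
  obtain ⟨K, hRK, hK⟩ := exists_rem_timersAtRequest_bound (C := C) (X := X) (obj := obj)
    hψ₀ hR0 hR hθs hs
  -- Without a renewal the leftover is 0 and the assigned TTL is `θs t`, so the term vanishes;
  -- renewals have density zero and deviate by at most `2 * K`.
  have h1 : Tendsto (fun n : ℕ => (∑ l ∈ Finset.range n, if C.label (obj l ω) = Sum.inr t then
      assignedTTL C θ θs ψ₀ X obj l ω - (timersAtRequest C θ θs ψ₀ X obj l ω).rem - θs t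
      else 0) / n) atTop (𝓝 0) := by
    have h2 := hren.const_mul (2 * K)
    rw [mul_zero] at h2
    refine squeeze_zero_norm (fun n => ?_) h2
    rw [norm_div, Real.norm_natCast, ← mul_div_assoc, Finset.mul_sum]
    refine div_le_div_of_nonneg_right ((norm_sum_le _ _).trans (Finset.sum_le_sum fun l _ => ?_))
      (Nat.cast_nonneg n)
    by_cases hl : C.label (obj l ω) = Sum.inr t
    · have ht : C.typ (obj l ω) = t := by rw [typ_eq, hl]; rfl
      by_cases hren : Renewal C θ θs ψ₀ X obj l ω
      · have h3 := hK ω hX l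
        have h4 := Timers.rem_nonneg (timersAtRequest C θ θs ψ₀ X obj l ω)
        simp only [hl, hren, assignedTTL, ht, if_true, and_self, Real.norm_eq_abs, mul_one]
        have h5 := hs t
        have h6 := hθs t
        have h7 := hR t
        rw [abs_le]
        constructor <;> linarith
      · have h3 : (timersAtRequest C θ θs ψ₀ X obj l ω).rem = 0 := by
          refine le_antisymm (not_lt.1 fun h => hren (Or.inl ?_)) (Timers.rem_nonneg _)
          exact (Timers.inCache_iff _).2 h
        simp [hl, hren, assignedTTL, ht, h3]
    · simp [hl]
  have h2 := h1.add (hfreq.mul_const (θs t))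
  rw [zero_add] at h2
  refine h2.congr fun n => ?_
  rw [div_mul_eq_mul_div, ← add_div, Finset.sum_mul, ← Finset.sum_add_distrib]
  congr 1
  refine Finset.sum_congr rfl fun l _ => ?_
  split_ifs <;> ring

end Rare

open Classical in
/-- Assembling the averages over the requests of one type from those over the labels. -/
lemma tendsto_typed_average [Fintype κ] [Fintype τ] {ω : Ω} {q : ℕ → ℝ} {x : κ ⊕ τ → ℝ}
    (h : ∀ z, Tendsto (fun n : ℕ => (∑ l ∈ Finset.range n, if C.label (obj l ω) = z then
      q l else 0) / n) atTop (𝓝 (x z))) (v : κ → ℝ) (vr : τ → ℝ) (t : τ) :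
    Tendsto (fun n : ℕ => (∑ l ∈ Finset.range n, if C.typ (obj l ω) = t then
      C.weight v vr (obj l ω) * q l else 0) / n) atTop
      (𝓝 ((∑ c with C.recType c = t, v c * x (Sum.inl c)) + vr t * x (Sum.inr t))) := by
  have h1 := tendsto_finsetSum (Finset.univ : Finset (κ ⊕ τ)) fun z _ =>
    (h z).const_mul (if labelType C z = t then Sum.elim v vr z else 0)
  have e : ∑ z, (if labelType C z = t then Sum.elim v vr z else 0) * x z =
      (∑ c with C.recType c = t, v c * x (Sum.inl c)) + vr t * x (Sum.inr t) := by
    rw [Fintype.sum_sum_type, Finset.sum_filter]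
    congr 1
    · refine Finset.sum_congr rfl fun c _ => ?_
      by_cases hc : C.recType c = t <;> simp [labelType, hc]
    · rw [Finset.sum_eq_single_of_mem t (Finset.mem_univ t) fun t' _ ht' => ?_]
      · simp [labelType]
      · simp [labelType, ht']
  rw [e] at h1
  refine h1.congr fun n => ?_
  simp_rw [← mul_div_assoc]
  rw [← Finset.sum_div]
  congr 1
  simp_rw [Finset.mul_sum]
  rw [Finset.sum_comm]
  refine Finset.sum_congr rfl fun l _ => ?_
  simp only [mul_ite, mul_zero, Finset.sum_ite_eq, Finset.mem_univ, if_true, typ_eq, weight_eq,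
    ite_mul, zero_mul]

end Limits

/-! ### From averages over requests to limits in real time -/

section RealTime

variable {Ω κ τ ρ : Type*} {C : Catalog κ τ ρ} {θ θs : τ → ℝ} {ψ₀ : κ ⊕ ρ → Timers}
  {X : ℕ → Ω → ℝ} {obj : ℕ → Ω → κ ⊕ ρ} {ω : Ω}

lemma size_nonneg (C : Catalog κ τ ρ) (c : κ ⊕ ρ) : 0 ≤ C.size c := by
  rcases c with c | r
  exacts [(C.recSize_pos c).le, (C.rareSize_pos _).le]

/-- Sizes depend only on the label, and there are finitely many labels even if the rare objects are
infinitely many. -/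
lemma exists_size_bound [Fintype κ] [Fintype τ] (C : Catalog κ τ ρ) :
    ∃ W, ∀ c, C.size c ≤ W := by
  refine ⟨∑ z : κ ⊕ τ, Sum.elim C.recSize C.rareSize z, fun c => ?_⟩
  rw [Catalog.size, weight_eq]
  refine Finset.single_le_sum (f := fun z => Sum.elim C.recSize C.rareSize z) (fun z _ => ?_)
    (Finset.mem_univ _)
  rcases z with c | t
  exacts [(C.recSize_pos c).le, (C.rareSize_pos t).le]

lemma tendsto_arrivalTime_atTop {a : ℝ} (ha : 0 < a)
    (hA : Tendsto (fun n : ℕ => arrivalTime X n ω / n) atTop (𝓝 a)) :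
    Tendsto (fun n => arrivalTime X n ω) atTop atTop := by
  refine (hA.pos_mul_atTop ha tendsto_natCast_atTop_atTop).congr' ?_
  filter_upwards [eventually_gt_atTop 0] with n hn
  have : (n : ℝ) ≠ 0 := by positivity
  field_simp

open Classical in
/-- Time average of the cache size, per request. -/
lemma tendsto_integral_cacheSize [Fintype κ] [Fintype τ] (hX : ∀ n, 0 ≤ X n ω)
    (hθs : ∀ t, 0 ≤ θs t) (hs : ∀ t, θs t ≤ θ t) {R a : ℝ} (hR0 : 0 ≤ R) (hR : ∀ t, θ t ≤ R)
    (hψ₀ : {c | ψ₀ c ≠ 0}.Finite) (ha : 0 < a)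
    (hA : Tendsto (fun n : ℕ => arrivalTime X n ω / n) atTop (𝓝 a)) {t : τ} {x : ℝ}
    (h : Tendsto (fun n : ℕ => (∑ l ∈ Finset.range n, if C.typ (obj l ω) = t then
      C.size (obj l ω) * (assignedTTL C θ θs ψ₀ X obj l ω -
        (timersAtRequest C θ θs ψ₀ X obj l ω).rem) else 0) / n) atTop (𝓝 x)) :
    Tendsto (fun u : ℝ => (∫ s in (0 : ℝ)..u, cacheSize C θ θs ψ₀ X obj t ω s) /
      requestCount X ω u) atTop (𝓝 x) := by
  have hθ : ∀ t, 0 ≤ θ t := fun t => (hθs t).trans (hs t)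
  have hAtop := tendsto_arrivalTime_atTop ha hA
  have hN := tendsto_requestCount hX hAtop
  obtain ⟨W, hW⟩ := exists_size_bound C
  -- The initial potential enters twice: as the left endpoint, and in the bound on the final
  -- potential by initial lifetimes plus recent requests.
  set K := ∑ c ∈ hψ₀.toFinset, C.size c * (ψ₀ c).rem
  have he := (tendsto_const_div_atTop_nhds_zero_nat (2 * K)).add
    ((tendsto_recent_requests hX ha hA R).const_mul (W * R))
  rw [mul_zero, add_zero] at he
  have hdiff : Tendsto (fun u : ℝ => (∫ s in (0 : ℝ)..u, cacheSize C θ θs ψ₀ X obj t ω s) /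
      requestCount X ω u - (∑ l ∈ Finset.range (requestCount X ω u), if C.typ (obj l ω) = t then
      C.size (obj l ω) * (assignedTTL C θ θs ψ₀ X obj l ω -
        (timersAtRequest C θ θs ψ₀ X obj l ω).rem) else 0) / requestCount X ω u)
      atTop (𝓝 0) := by
    refine squeeze_zero_norm' ?_ (he.comp hN)
    filter_upwards [eventually_ge_atTop 0] with u hu
    obtain ⟨n, hn1, hn2⟩ := exists_arrival_interval hAtop hu
    simp only [Function.comp, requestCount_eq hX hn1 hn2]
    set F := hψ₀.toFinset ∪ (Finset.range n).image fun l => obj l ω with hF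
    have hK : ∑ c ∈ F, C.size c * (ψ₀ c).rem = K := by
      refine (Finset.sum_subset Finset.subset_union_left fun c _ hc => ?_).symm
      rw [hψ₀.mem_toFinset, Set.mem_ofPred_eq, not_not] at hc
      rw [hc, Timers.rem_zero, mul_zero]
    have h1 := abs_integral_cacheSize_sub_le (C := C) (θ := θ) (θs := θs) (ψ₀ := ψ₀) (obj := obj)
      hX hθ hθs t hu hn1 hn2 (F := F)
      (fun c hc => Finset.mem_union_left _ (hψ₀.mem_toFinset.2 hc))
      (fun i hi => Finset.mem_union_right _
        (Finset.mem_image_of_mem (fun l => obj l ω) (Finset.mem_range.2 hi)))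
      (size_nonneg C) hAtop
    have h2 := sum_size_mul_rem_le (C := C) (ψ₀ := ψ₀) (obj := obj) hX hθs hs hR hR0
      (size_nonneg C) hW F n
    simp_rw [mul_add] at h1
    rw [Finset.sum_add_distrib, hK] at h1
    rw [hK] at h2
    rw [← sub_div, norm_div, Real.norm_natCast, Real.norm_eq_abs, ← mul_div_assoc, ← add_div]
    exact div_le_div_of_nonneg_right (by linarith) (Nat.cast_nonneg n)
  have := hdiff.add (h.comp hN)
  rw [zero_add] at this
  refine this.congr fun u => ?_
  simp [Function.comp]

/-- Passing from averages to ratios. -/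
lemma tendsto_ratio {ι : Type*} {l : Filter ι} {N : ι → ℕ} (hN : Tendsto N l atTop)
    {f g : ι → ℝ} {x y k : ℝ} (hf : Tendsto (fun i => f i / N i) l (𝓝 x))
    (hg : Tendsto (fun i => g i / N i) l (𝓝 y)) (hy : y ≠ 0) (hk : k ≠ 0) :
    Tendsto (fun i => f i / g i) l (𝓝 ((x * k) / (y * k))) := by
  -- The factor `k` is the arrival rate in the applications: it occurs above and below in the
  -- limiting formulas, but not in averages per request.
  rw [mul_div_mul_right _ _ hk]
  refine (hf.div hg hy).congr' ?_
  filter_upwards [hN.eventually_gt_atTop 0] with i hi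
  have : (N i : ℝ) ≠ 0 := by exact_mod_cast hi.ne'
  exact div_div_div_cancel_right₀ this _ _

end RealTime

open Classical in
/-- Limits of the requested weight per request and of the weighted hit ratio, given the limiting
frequencies of the labels and of their hits. -/
theorem tendsto_of_label_averages {Ω κ τ ρ : Type*} [MeasurableSpace Ω] [Fintype κ]
    [Fintype τ] {μ : Measure Ω} {C : FTTL.Catalog κ τ ρ} {X : ℕ → Ω → ℝ}
    {obj : ℕ → Ω → κ ⊕ ρ} {lam : ℝ} {π : κ ⊕ τ → ℝ} {θ θs : τ → ℝ} {ψ₀ : κ ⊕ ρ → FTTL.Timers}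
    {ω : Ω} {N : ℝ → ℕ} (hNdef : N = requestCount X ω) (hN : Tendsto N atTop atTop)
    (hπ : ∀ z, 0 < π z) (hlam : 0 < lam)
    (hfreq : ∀ z, Tendsto (fun n : ℕ => (∑ l ∈ Finset.range n,
      if C.label (obj l ω) = z then (1 : ℝ) else 0) / n) atTop (𝓝 (π z)))
    (hhit : ∀ c, Tendsto (fun n : ℕ => (∑ l ∈ Finset.range n,
      if C.label (obj l ω) = Sum.inl c then
        (if FTTL.Hit C θ θs ψ₀ X obj l ω then (1 : ℝ) else 0) else 0) / n) atTop
      (𝓝 (π (Sum.inl c) * (interArrivalCDF μ X obj c (θ (C.recType c)) ^ 2 +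
        (1 - interArrivalCDF μ X obj c (θ (C.recType c))) *
          interArrivalCDF μ X obj c (θs (C.recType c))))))
    (hrareHit : ∀ t, Tendsto (fun n : ℕ => (∑ l ∈ Finset.range n,
      if C.label (obj l ω) = Sum.inr t then
        (if FTTL.Hit C θ θs ψ₀ X obj l ω then (1 : ℝ) else 0) else 0) / n) atTop (𝓝 0))
    (v : κ → ℝ) (vr : τ → ℝ) (hv : ∀ c, 0 < v c) (hvr : ∀ t, 0 < vr t) (t : τ) :
    Tendsto (fun u => requestedWeight C X obj (C.weight v vr) t ω u / N u) atTop
      (𝓝 ((∑ c with C.recType c = t, v c * π (Sum.inl c)) + vr t * π (Sum.inr t))) ∧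
    (∑ c with C.recType c = t, v c * π (Sum.inl c)) + vr t * π (Sum.inr t) ≠ 0 ∧
    Tendsto (hitRatio C θ θs ψ₀ X obj (C.weight v vr) t ω) atTop
      (𝓝 (hitRateFormula C μ X obj lam π θ θs v vr t)) := by
  subst hNdef
  have hW := (tendsto_typed_average (C := C) (obj := obj) (ω := ω) (q := fun _ => 1) (x := π)
    hfreq v vr t).comp hN
  simp only [mul_one, Function.comp_def] at hW
  -- The rare term alone is positive, even when no recurring object has type `t`.
  have hpos : (∑ c with C.recType c = t, v c * π (Sum.inl c)) + vr t * π (Sum.inr t) ≠ 0 :=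
    (add_pos_of_nonneg_of_pos (Finset.sum_nonneg fun c _ => (mul_pos (hv c) (hπ _)).le)
      (mul_pos (hvr t) (hπ _))).ne'
  refine ⟨hW, hpos, ?_⟩
  have hH := (tendsto_typed_average (C := C) (obj := obj) (ω := ω)
    (q := fun l => if FTTL.Hit C θ θs ψ₀ X obj l ω then (1 : ℝ) else 0)
    (x := Sum.elim (fun c => π (Sum.inl c) *
      (interArrivalCDF μ X obj c (θ (C.recType c)) ^ 2 +
        (1 - interArrivalCDF μ X obj c (θ (C.recType c))) *
          interArrivalCDF μ X obj c (θs (C.recType c)))) fun _ => 0)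
    (by rintro (c | t); exacts [hhit c, hrareHit t]) v vr t).comp hN
  have := tendsto_ratio hN hH hW hpos hlam.ne'
  convert this using 2
  · rw [hitRatio, hitWeight, requestedWeight]
    congr 1
    refine Finset.sum_congr rfl fun l _ => ?_
    by_cases h1 : C.typ (obj l ω) = t <;> by_cases h2 : FTTL.Hit C θ θs ψ₀ X obj l ω <;>
      simp [h1, h2]
  · rw [hitRateFormula]
    simp only [Sum.elim_inl, Sum.elim_inr, mul_zero, add_zero]
    congr 1
    · rw [Finset.sum_mul]
      refine Finset.sum_congr (by congr) fun c hc => ?_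
      rw [(Finset.mem_filter.1 hc).2]
      ring
    · rw [add_mul, Finset.sum_mul, add_comm]
      congr 1
      refine Finset.sum_congr (by congr) fun c _ => ?_
      ring

end FTTL

/-! ### Assembly of the limits on a common almost sure event -/

theorem mainTheorem4 {Ω κ τ ρ : Type*} [MeasurableSpace Ω] [Fintype κ] [Fintype τ]
    [DecidableEq κ] [DecidableEq τ] (μ : Measure Ω) [IsProbabilityMeasure μ]
    (C : FTTL.Catalog κ τ ρ) (X : ℕ → Ω → ℝ) (obj : ℕ → Ω → κ ⊕ ρ) (lam : ℝ)
    (P : Matrix (κ ⊕ τ) (κ ⊕ τ) ℝ) (π : κ ⊕ τ → ℝ)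
    (hmodel : FTTL.IsRequestModel C μ X obj lam P π)
    (L θ θs : τ → ℝ)
    (hrare : FTTL.RarityCondition C μ X obj ‖L‖)
    (hθs_nonneg : ∀ t, 0 ≤ θs t) (hθs_le : ∀ t, θs t ≤ θ t) (hθ_le : ∀ t, θ t ≤ L t)
    (ψ₀ : κ ⊕ ρ → FTTL.Timers) (hψ₀ : {c | ψ₀ c ≠ 0}.Finite) :
    ∀ᵐ ω ∂μ, ∀ t : τ,
      -- object hit rate
      (FTTL.objectHitRate C θ θs ψ₀ X obj t ω =
          FTTL.hitRateFormula C μ X obj lam π θ θs (fun _ => 1) (fun _ => 1) t ∧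
        Tendsto (FTTL.hitRatio C θ θs ψ₀ X obj (fun _ => 1) t ω) atTop
          (𝓝 (FTTL.hitRateFormula C μ X obj lam π θ θs (fun _ => 1) (fun _ => 1) t))) ∧
      -- byte hit rate
      (FTTL.byteHitRate C θ θs ψ₀ X obj t ω =
          FTTL.hitRateFormula C μ X obj lam π θ θs C.recSize C.rareSize t ∧
        Tendsto (FTTL.hitRatio C θ θs ψ₀ X obj C.size t ω) atTop
          (𝓝 (FTTL.hitRateFormula C μ X obj lam π θ θs C.recSize C.rareSize t))) ∧
      -- normalized size
      (FTTL.normalizedSize C θ θs ψ₀ X obj t ω =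
          FTTL.sizeFormula C μ X obj lam π θ θs t ∧
        Tendsto (FTTL.sizeRatio C θ θs ψ₀ X obj t ω) atTop
          (𝓝 (FTTL.sizeFormula C μ X obj lam π θ θs t))) ∧
      -- rare objects contribute neither hits nor virtual hits
      Tendsto (FTTL.rareHitFraction C θ θs ψ₀ X obj t ω) atTop (𝓝 0) := by
  -- The given decidability instances are replaced by the classical ones, in which the preceding
  -- sums are expressed.
  rename_i dκ dτ _
  have hdκ : dκ = fun a b => Classical.propDecidable (a = b) := Subsingleton.elim _ _
  have hdτ : dτ = fun a b => Classical.propDecidable (a = b) := Subsingleton.elim _ _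
  subst hdκ hdτ
  classical
  obtain ⟨η, hZ, hη⟩ := hmodel.exists_isMarkedChain
  have hπ := FTTL.stationary_pos hmodel.irreducible hmodel.stationary_mem hmodel.stationary
  have hfreq := hZ.ae_tendsto_frequency hmodel.irreducible hmodel.stationary_mem hmodel.stationary
  have hrec := hZ.ae_exists_visit hmodel.irreducible hmodel.stationary_mem hmodel.stationary
  have hX := hmodel.ae_nonneg
  have hR0 : 0 ≤ ‖L‖ := norm_nonneg L
  have hR : ∀ t, θ t ≤ ‖L‖ := fun t =>
    (hθ_le t).trans ((le_abs_self _).trans (norm_le_pi_norm L t))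
  have hfreq' : ∀ z, ∀ᵐ ω ∂μ, Tendsto (fun n : ℕ => (∑ l ∈ Finset.range n,
      if C.label (obj l ω) = z then (1 : ℝ) else 0) / n) atTop (𝓝 (π z)) := fun z => by
    filter_upwards [hfreq] with ω h
    convert h z
  have hhit : ∀ᵐ ω ∂μ, ∀ c, _ := ae_all_iff.2 fun c => FTTL.ae_tendsto_hit (θ := θ) (θs := θs)
    (ψ₀ := ψ₀) (p := π (Sum.inl c)) hZ hη (hrec (Sum.inl c)) (hfreq' (Sum.inl c)) hX hθs_nonneg hθs_le
  have hsize : ∀ᵐ ω ∂μ, ∀ c, _ := ae_all_iff.2 fun c => FTTL.ae_tendsto_size (θ := θ) (θs := θs)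
    (ψ₀ := ψ₀) (p := π (Sum.inl c)) hZ hη (hrec (Sum.inl c)) (hfreq' (Sum.inl c)) hX hθs_nonneg hθs_le hR0 hR hψ₀
  -- The window length `N m = m` is admissible since √m / m = 1 / √m tends to 0; dyadic windows then
  -- suffice for averages from the start.
  have hbursty : ∀ᵐ ω ∂μ, ∀ t, _ := ae_all_iff.2 fun t => hrare t (fun m => m) (by
    refine (Asymptotics.isLittleO_iff_tendsto' ?_).2 ?_
    · filter_upwards [eventually_gt_atTop 0] with m hm h0
      exact absurd h0 (by exact_mod_cast hm.ne')
    · have h1 : Tendsto (fun m : ℕ => (Real.sqrt m)⁻¹) atTop (𝓝 0) :=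
        tendsto_inv_atTop_zero.comp (Real.tendsto_sqrt_atTop.comp tendsto_natCast_atTop_atTop)
      refine h1.congr fun m => ?_
      rw [Real.sqrt_div_self', one_div])
  filter_upwards [hfreq, hhit, hsize, hbursty, hX, hmodel.ae_tendsto_arrivalTime] with
    ω hfreq hhit hsize hbursty hX hA
  have hlam : 0 < 1 / lam := one_div_pos.2 hmodel.lam_pos
  have hN := FTTL.tendsto_requestCount hX (FTTL.tendsto_arrivalTime_atTop hlam hA)
  have hren := fun t => FTTL.tendsto_rare_renewal (ψ₀ := ψ₀) hX hθs_le hR hψ₀ (hbursty t)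
  have hrareHit : ∀ t, Tendsto (fun n : ℕ => (∑ l ∈ Finset.range n,
      if C.label (obj l ω) = Sum.inr t then
        (if FTTL.Hit C θ θs ψ₀ X obj l ω then (1 : ℝ) else 0) else 0) / n) atTop (𝓝 0) := by
    intro t
    refine squeeze_zero (fun n => div_nonneg (Finset.sum_nonneg fun l _ => by
      split_ifs <;> norm_num) (Nat.cast_nonneg n)) (fun n => ?_) (hren t)
    refine div_le_div_of_nonneg_right (Finset.sum_le_sum fun l _ => ?_) (Nat.cast_nonneg n)
    by_cases h1 : C.label (obj l ω) = Sum.inr t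
    · by_cases h2 : FTTL.Hit C θ θs ψ₀ X obj l ω
      · have h3 : FTTL.Renewal C θ θs ψ₀ X obj l ω := Or.inl h2
        simp [h1, h2, h3]
      · simp only [h1, h2, if_true, if_false]
        positivity
    · simp [h1]
  have key := FTTL.tendsto_of_label_averages (μ := μ) (lam := lam) rfl hN hπ hmodel.lam_pos
    (by convert hfreq) (by convert hhit) (by convert hrareHit)
  intro t
  have hobj := (key (fun _ => 1) (fun _ => 1) (fun _ => one_pos) (fun _ => one_pos) t).2.2
  have hone : C.weight (fun _ => 1) (fun _ => 1) = fun _ => 1 := by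
    ext (c | r) <;> rfl
  rw [hone] at hobj
  obtain ⟨hW, hWpos, hbyte⟩ := key C.recSize C.rareSize C.recSize_pos C.rareSize_pos t
  have hS := FTTL.tendsto_typed_average (C := C) (obj := obj) (ω := ω)
    (q := fun l => FTTL.assignedTTL C θ θs ψ₀ X obj l ω -
      (FTTL.timersAtRequest C θ θs ψ₀ X obj l ω).rem)
    (x := Sum.elim (fun c => π (Sum.inl c) * (FTTL.interArrivalCDF μ X obj c (θ (C.recType c)) *
          FTTL.truncatedMean μ X obj c (θ (C.recType c)) +
        (1 - FTTL.interArrivalCDF μ X obj c (θ (C.recType c))) *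
          FTTL.truncatedMean μ X obj c (θs (C.recType c)))) fun t => π (Sum.inr t) * θs t)
    (by
      rintro (c | t)
      · convert hsize c
        rfl
      · have := FTTL.tendsto_rare_size (ψ₀ := ψ₀) hX hθs_nonneg hθs_le hR0 hR hψ₀ (hren t)
          (p := π (Sum.inr t)) (by convert hfreq (Sum.inr t))
        convert this
        rfl) C.recSize C.rareSize t
  have hsz : Tendsto (FTTL.sizeRatio C θ θs ψ₀ X obj t ω) atTop
      (𝓝 (FTTL.sizeFormula C μ X obj lam π θ θs t)) := by
    have := FTTL.tendsto_ratio hN (FTTL.tendsto_integral_cacheSize hX hθs_nonneg hθs_le hR0 hR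
      hψ₀ hlam hA hS) hW hWpos hmodel.lam_pos.ne'
    refine Eq.subst (motive := fun x => Tendsto (FTTL.sizeRatio C θ θs ψ₀ X obj t ω) atTop (𝓝 x))
      ?_ this
    rw [FTTL.sizeFormula]
    symm
    simp only [Sum.elim_inl, Sum.elim_inr]
    congr 1
    · rw [add_mul, Finset.sum_mul]
      congr 1
      · refine Finset.sum_congr (by congr) fun c hc => ?_
        rw [(Finset.mem_filter.1 hc).2]
        ring
      · ring
    · rw [add_mul, Finset.sum_mul, add_comm]
      congr 1
      refine Finset.sum_congr (by congr) fun c _ => ?_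
      ring
  have hobj' : Tendsto (FTTL.hitRatio C θ θs ψ₀ X obj (fun _ => 1) t ω) atTop
      (𝓝 (FTTL.hitRateFormula C μ X obj lam π θ θs (fun _ => 1) (fun _ => 1) t)) := by
    convert hobj
  have hbyte' : Tendsto (FTTL.hitRatio C θ θs ψ₀ X obj C.size t ω) atTop
      (𝓝 (FTTL.hitRateFormula C μ X obj lam π θ θs C.recSize C.rareSize t)) := by
    convert hbyte
    rfl
  refine ⟨⟨hobj'.liminf_eq, hobj'⟩, ⟨hbyte'.liminf_eq, hbyte'⟩, ⟨hsz.limsup_eq, hsz⟩, ?_⟩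
  -- `Renewal` unfolds to the disjunction of `Hit` and `VirtualHit`, so this is the density
  -- statement already obtained.
  refine (hren t).congr fun n => ?_
  rw [FTTL.rareHitFraction, one_div, ← div_eq_inv_mul]
  congr 1
  refine Finset.sum_congr rfl fun l _ => ?_
  exact if_congr Iff.rfl rfl rfl
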